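/- \textbf{Setting.} Let $(M,g)$ be a smooth oriented four-dimensional space-time of signature $(-,+,+,+)$ with metric volume element $\eta$ and Levi-Civita connection $\nabla$. Put $G_{\alpha\beta\mu\nu}=g_{\alpha\mu}g_{\beta\nu}-g_{\alpha\nu}g_{\beta\mu}$ and, for 2-forms $F,H$, $(F,H)=\frac12F_{\alpha\beta}H^{\alpha\beta}$ and $(*F)_{\alpha\beta}=\frac12\eta_{\alpha\beta}{}^{\mu\nu}F_{\mu\nu}$. A double 2-form $P$ acts on 2-forms by $P(F)_{\alpha\beta}=\frac12P_{\alpha\beta}{}^{\mu\nu}F_{\mu\nu}$. A self-dual (SD) bivector is a complex 2-form $\mathcal F$ with $*\mathcal F=\mathrm i\mathcal F$; put $\mathcal G=\frac12(G-\mathrm i\eta)$. The curvature convention is $\nabla_\mu\nabla_\nu X^\rho-\nabla_\nu\nabla_\mu X^\rho=R^\rho{}_{\sigma\mu\nu}X^\sigma$, with Ricci tensor $R_{\sigma\nu}=R^\rho{}_{\sigma\rho\nu}$, scalar curvature $R$ and Weyl tensor $W$. The self-dual Weyl tensor is $\mathcal W=\frac12(W-\mathrm i*W)$. A 2+2 structure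 is given by a smooth 2-form $U$ that is at each point the volume element of a time-like plane $V$; let $H$ be its orthogonal complement, and let $v$ and $h=g-v$ be the orthogonal projectors onto $V$ and $H$. The structure is umbilical if the symmetric part $S_v$ of $Q_v(x,y)=h(\nabla_{v(x)}v(y))$ satisfies $S_v=\frac12\,v\otimes\operatorname{tr}S_v$, and likewise with $v$ and $h$ interchanged. Its canonical SD bivector is $\mathcal U=\frac1{\sqrt2}(U-\mathrm i*U)$. Put $\xi_\beta=(\delta\mathcal U)_\beta=-\nabla^\alpha\mathcal U_{\alpha\beta}$, $\chi_\beta=\xi^\alpha\mathcal U_{\alpha\beta}$, $T=\nabla\xi-\chi\otimes\xi$ (that is, $T_{\alpha\beta}=\nabla_\alpha\xi_\beta-\chi_\alpha\xi_\beta$), let $A$ be the antisymmetric part of $T$, and define $$\Omega=-\Big[\frac R{12}+(A,\mathcal U)\Big],\qquad \mathcal Z=A_\perp=\mathcal G_\perp(A),\qquad \mathcal G_\perp=\mathcal U\otimes\mathcal U+\mathcal G .$$ The Petrov--Bel type at a point is that of the traceless endomorphism defined by $\mathcal W$ on the complex 3-dimensional space of SD bivectors: type I if it has three distinct eigenvalues;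 types D and II if it has exactly two, with minimal polynomial of degree 2 and 3 respectively; types O, N and III if its only eigenvalue is $0$, with minimal polynomial of degree 1, 2 and 3 respectively. A Debever principal null direction is spanned by a null vector $l\neq0$ with $l_{[\alpha}W_{\beta]\gamma\delta[\epsilon}l_{\nu]}l^\gamma l^\delta=0$. A unitary Debever SD bivector is an SD bivector $\mathcal F$ with $(\mathcal F,\mathcal F)=-1$ whose principal directions (the directions of real null vectors $l\ne0$ with $\mathcal F_{\alpha\beta}l^\beta\propto l_\alpha$) are Debever principal null directions. \textbf{Theorem.} If the space-time admits an umbilical 2+2 structure, then at every point $\mathcal U$ is a unitary Debever SD bivector and the Petrov--Bel type is not N. Moreover, at every point the Petrov--Bel type is \begin{itemize} \item O if and only if $\Omega=0$ and $\mathcal Z=0$; \item III if and only if $\Omega=0$, $\mathcal Z\neq0$ and $(\mathcal Z,\mathcal Z)=0$; \item D if and only if $\Omega\neq0$ and $\mathcal Z=0$; \item II if and only if $\Omega\neq0$, $\mathcal Z\neq0$ and $(\mathcal Z,\mathcal Z)\,(9\Omega^2-4(\mathcal Z,\mathcal Z))=0$; \item I if and only if $(\mathcal Z,\mathcal Z)\,(9\Omega^2-4(\mathcal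 Z,\mathcal Z))\neq0$. \end{itemize} -/

import Mathlib

open scoped Manifold ContDiff

noncomputable section

/-! ## Oriented space-times and 2+2 structures -/

/-- The coordinate space `ℝ⁴`. -/
abbrev Coord := EuclideanSpace ℝ (Fin 4)

/-- The matrix `diag (-1, 1, 1, 1)`. -/
def minkowski (i j : Fin 4) : ℝ := if i = j then (if i = 0 then -1 else 1) else 0

/-- The coordinate vector field `∂_α` of a chart `e`, at the point with coordinates `y`. -/
def coordVector {M : Type*} [TopologicalSpace M] [ChartedSpace Coord M]
    (e : OpenPartialHomeomorph M Coord) (y : Coord) (α : Fin 4) :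
    TangentSpace (𝓡 4) (e.symm y) :=
  mfderiv (𝓡 4) (𝓡 4) e.symm y (EuclideanSpace.single α (1 : ℝ) : Coord)

/-- An oriented space-time on the smooth 4-manifold `M`: a smooth metric of signature
`(-,+,+,+)` and a smooth metric volume element, which takes the value `1` on the positively
oriented orthonormal frames and so encodes the orientation. -/
structure OrientedSpaceTime (M : Type*) [TopologicalSpace M] [ChartedSpace Coord M]
    [IsManifold (𝓡 4) ∞ M] where
  metric : ∀ x : M, LinearMap.BilinForm ℝ (TangentSpace (𝓡 4) x)
  vol : ∀ x : M, (TangentSpace (𝓡 4) x) [⋀^Fin 4]→ₗ[ℝ] ℝ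
  exists_frame : ∀ x : M, ∃ b : Module.Basis (Fin 4) ℝ (TangentSpace (𝓡 4) x),
    (∀ i j, metric x (b i) (b j) = minkowski i j) ∧ vol x b = 1
  smooth_metric : ∀ e ∈ IsManifold.maximalAtlas (𝓡 4) ∞ M, ∀ α β : Fin 4,
    ContDiffOn ℝ ∞
      (fun y : Coord => metric (e.symm y) (coordVector e y α) (coordVector e y β)) e.target
  smooth_vol : ∀ e ∈ IsManifold.maximalAtlas (𝓡 4) ∞ M, ∀ α β γ δ : Fin 4,
    ContDiffOn ℝ ∞
      (fun y : Coord => vol (e.symm y) ![coordVector e y α, coordVector e y β,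
        coordVector e y γ, coordVector e y δ]) e.target

/-- A 2+2 structure, given by its canonical 2-form: the smooth 2-form `U` which at each point is
the volume element `b₀ ∧ b₁` of a time-like plane `span {b₀, b₁}`, with `b` an orthonormal frame
(either orientation of the plane is allowed). -/
structure TwoPlusTwo {M : Type*} [TopologicalSpace M] [ChartedSpace Coord M]
    [IsManifold (𝓡 4) ∞ M] (S : OrientedSpaceTime M) where
  U : ∀ x : M, (TangentSpace (𝓡 4) x) [⋀^Fin 2]→ₗ[ℝ] ℝ
  exists_frame : ∀ x : M, ∃ b : Module.Basis (Fin 4) ℝ (TangentSpace (𝓡 4) x),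
    (∀ i j, S.metric x (b i) (b j) = minkowski i j) ∧
    ∀ u w : TangentSpace (𝓡 4) x,
      U x ![u, w] = S.metric x (b 0) u * S.metric x (b 1) w
        - S.metric x (b 0) w * S.metric x (b 1) u
  smooth_U : ∀ e ∈ IsManifold.maximalAtlas (𝓡 4) ∞ M, ∀ α β : Fin 4,
    ContDiffOn ℝ ∞
      (fun y : Coord => U (e.symm y) ![coordVector e y α, coordVector e y β]) e.target

/-- Components, in a chart, of a metric, a volume element and a 2-form
(only ever used for those of a space-time with a 2+2 structure). -/
structure LocalFields where
  g : Coord → Fin 4 → Fin 4 → ℝ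
  vol : Coord → Fin 4 → Fin 4 → Fin 4 → Fin 4 → ℝ
  U : Coord → Fin 4 → Fin 4 → ℝ

/-- The components of the metric, the volume element and the canonical 2-form in a chart. -/
def TwoPlusTwo.inChart {M : Type*} [TopologicalSpace M] [ChartedSpace Coord M]
    [IsManifold (𝓡 4) ∞ M] {S : OrientedSpaceTime M} (P : TwoPlusTwo S)
    (e : OpenPartialHomeomorph M Coord) : LocalFields where
  g y α β := S.metric (e.symm y) (coordVector e y α) (coordVector e y β)
  vol y α β γ δ := S.vol (e.symm y)
    ![coordVector e y α, coordVector e y β, coordVector e y γ, coordVector e y δ]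
  U y α β := P.U (e.symm y) ![coordVector e y α, coordVector e y β]

/-- The partial derivative `∂_μ f`. -/
def partialD {F : Type*} [NormedAddCommGroup F] [NormedSpace ℝ F] (μ : Fin 4) (f : Coord → F)
    (y : Coord) : F :=
  fderiv ℝ f y (EuclideanSpace.single μ (1 : ℝ))

/-- Complex covariant 2-tensors at a point, in components `F_{αβ}`. -/
abbrev Tensor2 := Fin 4 → Fin 4 → ℂ

/-- Complex covariant 4-tensors at a point, in components `P_{αβμν}`. -/
abbrev Tensor4 := Fin 4 → Fin 4 → Fin 4 → Fin 4 → ℂ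

namespace LocalFields

variable (L : LocalFields) (y : Coord)

/-! ## Levi-Civita connection and curvature -/

/-- The inverse metric `g^{αβ}`. -/
def gInv (α β : Fin 4) : ℝ := (Matrix.of (L.g y))⁻¹ α β

/-- The Christoffel symbols `Γ^l_{μν}` of the Levi-Civita connection. -/
def christoffel (l μ ν : Fin 4) : ℝ :=
  1 / 2 * ∑ σ, L.gInv y l σ *
    (partialD μ (fun z => L.g z σ ν) y + partialD ν (fun z => L.g z σ μ) y
      - partialD σ (fun z => L.g z μ ν) y)

/-- `R^ρ_{σμν}`, with `∇_μ ∇_ν X^ρ - ∇_ν ∇_μ X^ρ = R^ρ_{σμν} X^σ`. -/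
def riemannUp (ρ σ μ ν : Fin 4) : ℝ :=
  partialD μ (fun z => L.christoffel z ρ ν σ) y - partialD ν (fun z => L.christoffel z ρ μ σ) y
    + ∑ l, (L.christoffel y ρ μ l * L.christoffel y l ν σ
      - L.christoffel y ρ ν l * L.christoffel y l μ σ)

/-- The Riemann tensor `R_{ρσμν}`. -/
def riemann (ρ σ μ ν : Fin 4) : ℝ := ∑ l, L.g y ρ l * L.riemannUp y l σ μ ν

/-- The Ricci tensor `R_{σν} = R^ρ_{σρν}`. -/
def ricci (σ ν : Fin 4) : ℝ := ∑ ρ, L.riemannUp y ρ σ ρ ν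

/-- The scalar curvature `R`. -/
def scalarCurv : ℝ := ∑ σ, ∑ ν, L.gInv y σ ν * L.ricci y σ ν

/-- The Weyl tensor `W_{αβμν}` (in dimension four). -/
def weyl (α β μ ν : Fin 4) : ℝ :=
  L.riemann y α β μ ν
    - 1 / 2 * (L.g y α μ * L.ricci y β ν + L.g y β ν * L.ricci y α μ
      - L.g y α ν * L.ricci y β μ - L.g y β μ * L.ricci y α ν)
    + L.scalarCurv y / 6 * (L.g y α μ * L.g y β ν - L.g y α ν * L.g y β μ)

/-- `∇_α ω_β` for a complex 1-form `f`. -/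
def covD1 (f : Coord → Fin 4 → ℂ) (α β : Fin 4) : ℂ :=
  partialD α (fun z => f z β) y - ∑ l, (L.christoffel y l α β : ℂ) * f y l

/-- `∇_α F_{βγ}` for a complex covariant 2-tensor `F`. -/
def covD2 (F : Coord → Tensor2) (α β γ : Fin 4) : ℂ :=
  partialD α (fun z => F z β γ) y - ∑ l, (L.christoffel y l α β : ℂ) * F y l γ
    - ∑ l, (L.christoffel y l α γ : ℂ) * F y β l

/-- The codifferential `(δF)_γ = -∇^α F_{αγ}` of a complex 2-form. On a space-time this is
`* d *`. -/
def codiff (F : Coord → Tensor2) (γ : Fin 4) : ℂ :=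
  -∑ α, ∑ β, (L.gInv y α β : ℂ) * L.covD2 y F α β γ

/-! ## Algebra of complex 2-forms at a point -/

/-- `F^{αβ}`. -/
def raise (F : Tensor2) : Tensor2 :=
  fun α β => ∑ μ, ∑ ν, (L.gInv y α μ : ℂ) * (L.gInv y β ν : ℂ) * F μ ν

/-- `(F, H) = ½ F_{αβ} H^{αβ}`. -/
def pairing (F H : Tensor2) : ℂ := 1 / 2 * ∑ α, ∑ β, F α β * L.raise y H α β

/-- The endomorphism `P(F)_{αβ} = ½ P_{αβ}^{μν} F_{μν}` given by a double 2-form `P`. -/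
def act (P : Tensor4) : Tensor2 →ₗ[ℂ] Tensor2 where
  toFun F := fun α β => 1 / 2 * ∑ μ, ∑ ν, P α β μ ν * L.raise y F μ ν
  map_add' F H := by
    funext α β
    simp only [raise, Pi.add_apply, mul_add, Finset.sum_add_distrib]
  map_smul' c F := by
    funext α β
    simp only [raise, Pi.smul_apply, smul_eq_mul, RingHom.id_apply, Finset.mul_sum]
    refine Finset.sum_congr rfl fun μ _ => Finset.sum_congr rfl fun ν _ =>
      Finset.sum_congr rfl fun ρ _ => Finset.sum_congr rfl fun σ _ => ?_
    ring

/-- `(P ∘ Q)_{αβρσ} = ½ P_{αβ}^{μν} Q_{μνρσ}` for double 2-forms. -/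
def comp (P Q : Tensor4) : Tensor4 :=
  fun α β ρ σ => L.act y P (fun μ ν => Q μ ν ρ σ) α β

/-- The metric volume element `η`, with complex values. -/
def eta : Tensor4 := fun α β μ ν => (L.vol y α β μ ν : ℂ)

/-- The Hodge dual `(*F)_{αβ} = ½ η_{αβ}^{μν} F_{μν}` of a 2-form. -/
def hodge : Tensor2 →ₗ[ℂ] Tensor2 := L.act y (L.eta y)

/-- The metric `𝒢 = ½ (G - i η)` of the space of self-dual bivectors, where
`G_{αβμν} = g_{αμ} g_{βν} - g_{αν} g_{βμ}`. -/
def calG : Tensor4 := fun α β μ ν =>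
  1 / 2 * (((L.g y α μ * L.g y β ν - L.g y α ν * L.g y β μ : ℝ) : ℂ)
    - Complex.I * L.eta y α β μ ν)

/-- The space of self-dual (SD) bivectors: complex 2-forms `F` with `*F = i F`. -/
def sdBivectors : Submodule ℂ Tensor2 where
  carrier := {F | (∀ α β, F α β = -F β α) ∧ L.hodge y F = Complex.I • F}
  add_mem' := by
    rintro F H ⟨hF, hF'⟩ ⟨hH, hH'⟩
    refine ⟨fun α β => ?_, by rw [map_add, hF', hH', smul_add]⟩
    rw [Pi.add_apply, Pi.add_apply, Pi.add_apply, Pi.add_apply, hF α β, hH α β, neg_add]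
  zero_mem' := ⟨fun _ _ => by simp, by simp⟩
  smul_mem' := by
    rintro c F ⟨hF, hF'⟩
    refine ⟨fun α β => ?_, by rw [map_smul, hF', smul_comm]⟩
    rw [Pi.smul_apply, Pi.smul_apply, Pi.smul_apply, Pi.smul_apply, hF α β, smul_neg]

/-! ## Umbilical structures -/

/-- The projector `v = U²` on the time-like plane, `v^α_β = U^{αμ} U_{μβ}`. -/
def projV (α β : Fin 4) : ℝ :=
  ∑ μ, ∑ ν, ∑ ρ, L.gInv y α μ * L.U y μ ν * L.gInv y ν ρ * L.U y ρ β

/-- The projector `h = g - v` on the space-like plane, `h^α_β`. -/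
def projH (α β : Fin 4) : ℝ := (if α = β then 1 else 0) - L.projV y α β

/-- The generalized second fundamental form `Q(∂_α, ∂_β) = q (∇_{p(∂_α)} p(∂_β))` of the plane
with projector `p` and complementary projector `q`; its component on `∂_γ`. -/
def secondForm (p q : Coord → Fin 4 → Fin 4 → ℝ) (α β γ : Fin 4) : ℝ :=
  ∑ l, ∑ μ, q y γ l * p y μ α *
    (partialD μ (fun z => p z l β) y + ∑ ν, L.christoffel y l μ ν * p y ν β)

/-- The symmetric part of the second fundamental form. -/
def symForm (p q : Coord → Fin 4 → Fin 4 → ℝ) (α β γ : Fin 4) : ℝ :=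
  1 / 2 * (L.secondForm y p q α β γ + L.secondForm y p q β α γ)

/-- The 2-plane with projector `p` is umbilical at `y`: the symmetric part `S` of its second
fundamental form equals its trace part `½ p ⊗ tr S`. -/
def UmbilicalPlaneAt (p q : Coord → Fin 4 → Fin 4 → ℝ) : Prop :=
  ∀ α β γ, L.symForm y p q α β γ =
    1 / 2 * (∑ μ, L.g y α μ * p y μ β) * ∑ μ, ∑ ν, L.gInv y μ ν * L.symForm y p q μ ν γ

/-- Both planes of the 2+2 structure are umbilical at `y`. -/
def UmbilicalAt : Prop :=
  L.UmbilicalPlaneAt y L.projV L.projH ∧ L.UmbilicalPlaneAt y L.projH L.projV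

/-! ## The differential concomitants of the structure -/

/-- The canonical SD bivector `𝒰 = (U - i *U) / √2`. -/
def calU : Tensor2 :=
  ((1 / √2 : ℝ) : ℂ) • ((fun α β => (L.U y α β : ℂ))
    - Complex.I • L.hodge y (fun α β => (L.U y α β : ℂ)))

/-- The 1-form `ξ = δ𝒰`. -/
def xi (γ : Fin 4) : ℂ := L.codiff y L.calU γ

/-- The 1-form `χ = i_ξ 𝒰`, `χ_β = ξ^α 𝒰_{αβ}`. -/
def chi (β : Fin 4) : ℂ := ∑ α, ∑ μ, (L.gInv y α μ : ℂ) * L.xi y μ * L.calU y α β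

/-- `T = ∇ξ - χ ⊗ ξ`. -/
def tensorT : Tensor2 := fun α β => L.covD1 y L.xi α β - L.chi y α * L.xi y β

/-- The antisymmetric part `A` of `T`. -/
def tensorA : Tensor2 := fun α β => 1 / 2 * (L.tensorT y α β - L.tensorT y β α)

/-- `Ω = -(R / 12 + (A, 𝒰))`. -/
def Omega : ℂ := -((L.scalarCurv y : ℂ) / 12 + L.pairing y (L.tensorA y) (L.calU y))

/-- `𝒢_⊥ = 𝒰 ⊗ 𝒰 + 𝒢`, acting as the projector on the SD bivectors orthogonal to `𝒰`. -/
def calGperp : Tensor4 := fun α β μ ν => L.calU y α β * L.calU y μ ν + L.calG y α β μ ν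

/-- `𝒵 = A_⊥ = 𝒢_⊥(A)`. -/
def calZ : Tensor2 := L.act y (L.calGperp y) (L.tensorA y)

/-! ## Petrov-Bel types and Debever directions -/

/-- The self-dual Weyl tensor `𝒲 = ½ (W - i *W)`. -/
def calW : Tensor4 := fun α β μ ν =>
  1 / 2 * ((L.weyl y α β μ ν : ℂ)
    - Complex.I * L.comp y (L.eta y) (fun a b c d => (L.weyl y a b c d : ℂ)) α β μ ν)

/-- A real vector `l` spans a Debever principal null direction: it is a non-zero null vector and
`l_{[α} W_{β]γδ[ε} l_{ν]} l^γ l^δ = 0`. -/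
def IsDebeverVector (l : Fin 4 → ℝ) : Prop :=
  l ≠ 0 ∧ (∑ α, ∑ β, L.g y α β * l α * l β = 0) ∧
  let k : Fin 4 → ℝ := fun α => ∑ β, L.g y α β * l β
  let m : Fin 4 → Fin 4 → ℝ := fun β ε => ∑ γ, ∑ δ, L.weyl y β γ δ ε * l γ * l δ
  ∀ α β ε ν, k α * m β ε * k ν - k β * m α ε * k ν - k α * m β ν * k ε + k β * m α ν * k ε = 0

/-- A real vector `l` spans a principal (null) direction of the 2-form `F`: it is a non-zero
null vector with `F_{αβ} l^β = c l_α` for a complex number `c`. -/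
def IsPrincipalNullVector (F : Tensor2) (l : Fin 4 → ℝ) : Prop :=
  l ≠ 0 ∧ (∑ α, ∑ β, L.g y α β * l α * l β = 0) ∧
  ∃ c : ℂ, ∀ α, ∑ β, F α β * (l β : ℂ) = c * ((∑ β, L.g y α β * l β : ℝ) : ℂ)

/-- `F` is a unitary Debever SD bivector: it is self-dual, `(F, F) = -1`, and its principal
directions are Debever principal null directions of the Weyl tensor. -/
def IsUnitaryDebever (F : Tensor2) : Prop :=
  F ∈ L.sdBivectors y ∧ L.pairing y F F = -1 ∧
  ∀ l, L.IsPrincipalNullVector y F l → L.IsDebeverVector y l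

end LocalFields

/-- The Petrov-Bel types. -/
inductive PetrovBel where
  | O | N | III | D | II | I

/-- The number of distinct eigenvalues of an endomorphism. -/
def numEigenvalues {V : Type*} [AddCommGroup V] [Module ℂ V] (f : Module.End ℂ V) : ℕ :=
  {c : ℂ | f.HasEigenvalue c}.ncard

/-- The algebraic type of a traceless endomorphism of a complex 3-dimensional space, given by
the number of its distinct eigenvalues and the degree of its minimal polynomial. -/
def HasPetrovBelType {V : Type*} [AddCommGroup V] [Module ℂ V] (f : Module.End ℂ V) :
    PetrovBel → Prop
  | .O => f = 0
  | .N => numEigenvalues f = 1 ∧ (minpoly ℂ f).natDegree = 2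
  | .III => numEigenvalues f = 1 ∧ (minpoly ℂ f).natDegree = 3
  | .D => numEigenvalues f = 2 ∧ (minpoly ℂ f).natDegree = 2
  | .II => numEigenvalues f = 2 ∧ (minpoly ℂ f).natDegree = 3
  | .I => numEigenvalues f = 3

/-- The space-time has Petrov-Bel type `t` at `y`: the self-dual Weyl tensor maps the space of
SD bivectors into itself, and the endomorphism so obtained has type `t`. -/
def LocalFields.HasType (L : LocalFields) (y : Coord) (t : PetrovBel) : Prop :=
  ∃ h : ∀ F ∈ L.sdBivectors y, L.act y (L.calW y) F ∈ L.sdBivectors y,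
    HasPetrovBelType ((L.act y (L.calW y)).restrict h) t

/-- The 2+2 structure is umbilical: both planes are umbilical, at every point and in every
chart. -/
def TwoPlusTwo.IsUmbilical {M : Type*} [TopologicalSpace M] [ChartedSpace Coord M]
    [IsManifold (𝓡 4) ∞ M] {S : OrientedSpaceTime M} (P : TwoPlusTwo S) : Prop :=
  ∀ e ∈ IsManifold.maximalAtlas (𝓡 4) ∞ M, ∀ y ∈ e.target, (P.inChart e).UmbilicalAt y

end

/-! In an oriented orthonormal frame adapted to the two planes, every algebraic object of the
statement takes its value in one fixed Minkowski model. The theorem thus splits into a differential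
part, which expresses the self-dual Weyl tensor through Ω and 𝒵, and linear algebra on ℂ³.

First derivatives. With an index raised, U satisfies U³ = U, because U² is the projector onto the
plane where U lives. Differentiating this shows that ∇U has only components with one index in each
plane, 16 real numbers. Umbilicity of the two planes imposes eight linear relations on them
(`nablaHat_eqs`), and the remaining eight real parameters are exactly the complex 1-form ξ = δ𝒰.
This yields the first structure equation ∇_α 𝒰 = χ_α 𝒰 − 𝒢_{αμ} ξ^μ (`covD2_calU_of_umbilical`),
which says that ∇𝒰 is the part of −𝒢_{αμ} ξ^μ orthogonal to 𝒰.

Second derivatives. Since 𝒢 is parallel, antisymmetrising the derivative of the first structure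
equation gives the Ricci identity for 𝒰 (`curv_calU`). In it ∇ξ and χ ⊗ ξ occur only through T, and
dχ occurs only along 𝒰. The components orthogonal to 𝒰 are therefore free of dχ, and their self-dual
part in the other index pair is free of the trace-free Ricci tensor. They determine 𝒲
(`frame_algebra`): in the coordinates F_{0a} on SD bivectors, whose first axis is the line of 𝒰, its
matrix has rows (−2Ω, p, q), (p, Ω, 0), (q, 0, Ω). Here p and q are the components of 𝒵, and (𝒵,𝒵) =
−(p² + q²).

Algebra. The characteristic polynomial is (c − Ω)(c² + Ωc − 2Ω² − (p² + q²)). The quadratic factor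
vanishes at c = Ω precisely when (𝒵,𝒵) = 0, and its discriminant is 9Ω² − 4(𝒵,𝒵). If 𝒵 ≠ 0 the
minimal polynomial has degree 3; if 𝒵 = 0 the matrix is diagonal. This gives the list of types, and
excludes N, because a nilpotent matrix of this shape is either zero or of index 3.

Debever property. On the orthogonal complement of 𝒰 the quadratic form of 𝒲 is a multiple of the
metric. Since the Weyl tensor is real, this amounts to real relations among its components, which
make W_{βγδε} l^γ l^δ a symmetrised product of l with a covector for both principal directions l of
𝒰 (`weyl_contract_null`). -/

noncomputable section

/-! ## The Levi-Civita symbol and coframes -/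

/-- The Levi-Civita symbol in dimension four. -/
def leviCivita (α β γ δ : Fin 4) : ℝ :=
  ((β : ℕ) - (α : ℕ) : ℝ) * ((γ : ℕ) - (α : ℕ)) * ((δ : ℕ) - (α : ℕ)) * ((γ : ℕ) - (β : ℕ)) *
    ((δ : ℕ) - (β : ℕ)) * ((δ : ℕ) - (γ : ℕ)) / 12

/-- The symbol is written as a Vandermonde product, so it vanishes on repeated indices and changes
sign under transpositions. The divisor 12 is the value of the product at (0, 1, 2, 3). -/
theorem det_of_rows (v₀ v₁ v₂ v₃ : Fin 4 → ℝ) :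
    (Matrix.of ![v₀, v₁, v₂, v₃]).det =
      ∑ i, ∑ j, ∑ k, ∑ l, leviCivita i j k l * v₀ i * v₁ j * v₂ k * v₃ l := by
  simp [Matrix.det_succ_row_zero, Fin.sum_univ_succ, leviCivita, Fin.succAbove]
  norm_num
  ring

theorem leviCivita_eq_det (α β γ δ : Fin 4) :
    leviCivita α β γ δ = (Matrix.of ![Pi.single α 1, Pi.single β 1, Pi.single γ 1,
      Pi.single δ (1 : ℝ)] : Matrix (Fin 4) (Fin 4) ℝ).det := by
  rw [det_of_rows]
  simp [Pi.single_apply]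

theorem sum_leviCivita_mul (B : Matrix (Fin 4) (Fin 4) ℝ) (a b c d : Fin 4) :
    ∑ i, ∑ j, ∑ k, ∑ l, leviCivita i j k l * B i a * B j b * B k c * B l d =
      B.det * leviCivita a b c d := by
  have h := det_of_rows (fun i => B i a) (fun i => B i b) (fun i => B i c) (fun i => B i d)
  rw [← h, leviCivita_eq_det, ← Matrix.det_transpose B, mul_comm, ← Matrix.det_mul]
  congr 1
  ext i j
  fin_cases i <;> simp [Matrix.mul_apply, Pi.single_apply]

theorem det_of_columns {V : Type*} [AddCommGroup V] [Module ℝ V] (c : Module.Basis (Fin 4) ℝ V)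
    (α β γ δ : Fin 4) : c.det ![c α, c β, c γ, c δ] = leviCivita α β γ δ := by
  rw [Module.Basis.det_apply, leviCivita_eq_det, ← Matrix.det_transpose]
  congr 1
  ext i j
  fin_cases i <;>
    simp [Module.Basis.toMatrix_apply, Pi.single_apply, Finsupp.single_apply, eq_comm]

/-- `C` is the matrix of an oriented orthonormal coframe `C^i_α` adapted to the 2+2 structure, at
the point with coordinates `y`. -/
structure LocalFields.CoframeAt (L : LocalFields) (y : Coord) (C : Matrix (Fin 4) (Fin 4) ℝ) :
    Prop where
  isUnit_det : IsUnit C.det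
  metric : ∀ α β, L.g y α β = ∑ i, ∑ j, minkowski i j * C i α * C j β
  vol : ∀ α β γ δ, L.vol y α β γ δ = C.det * leviCivita α β γ δ
  U : ∀ α β, L.U y α β = C 0 β * C 1 α - C 0 α * C 1 β

/-- A frame adapted to the planes may have the wrong orientation. Multiplying the last covector by
the sign corrects the volume element and changes neither the metric nor U, which involves only the
first two covectors. -/
theorem LocalFields.exists_coframeAt_of_sign {L : LocalFields} {y : Coord}
    {C : Matrix (Fin 4) (Fin 4) ℝ} {s : ℝ} (hs : s = 1 ∨ s = -1) (hC : IsUnit C.det)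
    (hg : ∀ α β, L.g y α β = ∑ i, ∑ j, minkowski i j * C i α * C j β)
    (hv : ∀ α β γ δ, L.vol y α β γ δ = s * C.det * leviCivita α β γ δ)
    (hU : ∀ α β, L.U y α β = C 0 β * C 1 α - C 0 α * C 1 β) :
    ∃ C', L.CoframeAt y C' := by
  have hdet : (Matrix.diagonal ![1, 1, 1, s] * C).det = s * C.det := by
    rw [Matrix.det_mul, Matrix.det_diagonal]
    simp [Fin.prod_univ_four]
  refine ⟨Matrix.diagonal ![1, 1, 1, s] * C, ?_, fun α β => ?_, fun α β γ δ => ?_, fun α β => ?_⟩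
  · rw [hdet]
    rcases hs with rfl | rfl <;> simpa using hC
  · rw [hg]
    have : s * s = 1 := by rcases hs with rfl | rfl <;> norm_num
    simp [Fin.sum_univ_four, Matrix.diagonal_mul, minkowski]
    linear_combination -(C 3 α * C 3 β) * this
  · rw [hv, hdet]
  · simp [hU, Matrix.diagonal_mul]

theorem isUnit_det_orthonormal {Λ : Matrix (Fin 4) (Fin 4) ℝ}
    (h : Λ.transpose * Matrix.of minkowski * Λ = Matrix.of minkowski) : Λ.det = 1 ∨ Λ.det = -1 := by
  have h1 := congrArg Matrix.det h
  have h2 : (Matrix.of minkowski).det = -1 := by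
    have : Matrix.of minkowski = Matrix.diagonal ![-1, 1, 1, 1] := by
      ext i j; fin_cases i <;> fin_cases j <;> simp [minkowski]
    rw [this, Matrix.det_diagonal]; simp [Fin.prod_univ_four]
  rw [Matrix.det_mul, Matrix.det_mul, Matrix.det_transpose, h2] at h1
  have : (Λ.det - 1) * (Λ.det + 1) = 0 := by linear_combination -h1
  rcases mul_eq_zero.1 this with h | h
  · left; linarith
  · right; linarith

section Geometry

variable {M : Type*} [TopologicalSpace M] [ChartedSpace Coord M] [IsManifold (𝓡 4) ∞ M]

omit [IsManifold (𝓡 4) ∞ M] in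
/-- The coordinate vector fields form a basis. -/
theorem exists_basis_coordVector {e : OpenPartialHomeomorph M Coord}
    (he : e ∈ IsManifold.maximalAtlas (𝓡 4) ∞ M) {y : Coord} (hy : y ∈ e.target) :
    ∃ c : Module.Basis (Fin 4) ℝ (TangentSpace (𝓡 4) (e.symm y)),
      ∀ α, c α = coordVector e y α := by
  have hd : e.symm.MDifferentiable (𝓡 4) (𝓡 4) :=
    ⟨(contMDiffOn_symm_of_mem_maximalAtlas he).mdifferentiableOn (by simp),
      (contMDiffOn_of_mem_maximalAtlas he).mdifferentiableOn (by simp)⟩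
  let E := (hd.mfderiv (x := y) hy).toLinearEquiv
  let b : Module.Basis (Fin 4) ℝ Coord := (EuclideanSpace.basisFun (Fin 4) ℝ).toBasis
  refine ⟨b.map E, fun α => ?_⟩
  have hb : b α = EuclideanSpace.single α (1 : ℝ) := by simp [b]
  change E (b α) = _
  rw [hb]
  rfl

variable {S : OrientedSpaceTime M}

theorem toMatrix_orthonormal {x : M} {b c : Module.Basis (Fin 4) ℝ (TangentSpace (𝓡 4) x)}
    (hb : ∀ i j, S.metric x (b i) (b j) = minkowski i j) (α β : Fin 4) :
    S.metric x (c α) (c β) = ∑ i, ∑ j, minkowski i j * b.toMatrix c i α * b.toMatrix c j β := by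
  conv_lhs => rw [← b.sum_toMatrix_smul_self c α, ← b.sum_toMatrix_smul_self c β]
  simp only [map_sum, map_smul, LinearMap.sum_apply, LinearMap.smul_apply, smul_eq_mul, hb,
    Finset.mul_sum]
  rw [Finset.sum_comm]
  refine Finset.sum_congr rfl fun i _ => Finset.sum_congr rfl fun j _ => ?_
  ring

theorem metric_frame_toMatrix {x : M} {b c : Module.Basis (Fin 4) ℝ (TangentSpace (𝓡 4) x)}
    (hb : ∀ i j, S.metric x (b i) (b j) = minkowski i j) (i α : Fin 4) :
    S.metric x (b i) (c α) = ∑ j, minkowski i j * b.toMatrix c j α := by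
  conv_lhs => rw [← b.sum_toMatrix_smul_self c α]
  simp only [map_sum, map_smul, smul_eq_mul, hb]
  exact Finset.sum_congr rfl fun j _ => mul_comm _ _

/-- The frame adapted to U and the oriented frame are given independently. The matrix relating them
is a Lorentz matrix, so the volume of the adapted frame is ±1, which is the sign to be corrected. -/
theorem TwoPlusTwo.exists_coframeAt (P : TwoPlusTwo S) {e : OpenPartialHomeomorph M Coord}
    (he : e ∈ IsManifold.maximalAtlas (𝓡 4) ∞ M) {y : Coord} (hy : y ∈ e.target) :
    ∃ C, (P.inChart e).CoframeAt y C := by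
  obtain ⟨c, hc⟩ := exists_basis_coordVector he hy
  obtain ⟨b, hb, hbU⟩ := P.exists_frame (e.symm y)
  obtain ⟨b', hb', hb'v⟩ := S.exists_frame (e.symm y)
  have hvol : S.vol (e.symm y) b = (b'.toMatrix b).det := by
    conv_lhs => rw [AlternatingMap.eq_smul_basis_det b' (S.vol (e.symm y)), hb'v]
    simp [Module.Basis.det_apply]
  refine LocalFields.exists_coframeAt_of_sign (C := b.toMatrix c)
    (s := S.vol (e.symm y) b) ?_ ?_ ?_ ?_ ?_
  · rw [hvol]
    apply isUnit_det_orthonormal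
    ext i j
    rw [Matrix.of_apply, ← hb i j, toMatrix_orthonormal hb' i j]
    simp [Matrix.mul_apply, Finset.sum_mul]
    rw [Finset.sum_comm]
    refine Finset.sum_congr rfl fun i _ => Finset.sum_congr rfl fun j _ => ?_
    ring
  · rw [← Module.Basis.det_apply]
    exact b.isUnit_det c
  · intro α β
    simp only [TwoPlusTwo.inChart, ← hc]
    exact toMatrix_orthonormal hb α β
  · intro α β γ δ
    simp only [TwoPlusTwo.inChart, ← hc]
    have h1 := AlternatingMap.eq_smul_basis_det c (S.vol (e.symm y))
    have h2 : S.vol (e.symm y) c = S.vol (e.symm y) b * (b.toMatrix c).det := by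
      conv_lhs => rw [AlternatingMap.eq_smul_basis_det b (S.vol (e.symm y))]
      simp [Module.Basis.det_apply]
    rw [← h2, ← det_of_columns c]
    exact congrArg (fun f => f ![c α, c β, c γ, c δ]) h1
  · intro α β
    simp only [TwoPlusTwo.inChart, ← hc, hbU, metric_frame_toMatrix hb]
    -- Lowering the index of the time-like vector b₀ gives minus the first covector of the dual
    -- basis; hence the order of the two terms in the coframe expression of U.
    simp [minkowski]
    ring

end Geometry

/-! ## Partial derivatives of functions and of matrix-valued functions -/

section Calculus

variable {𝕜 : Type*} [RCLike 𝕜] {s : Set Coord} {y : Coord} {μ ν : Fin 4}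

theorem partialD_congr {f g : Coord → 𝕜} (hs : IsOpen s) (hy : y ∈ s) (h : ∀ z ∈ s, f z = g z) :
    partialD μ f y = partialD μ g y := by
  have : f =ᶠ[nhds y] g := Filter.eventuallyEq_of_mem (hs.mem_nhds hy) h
  rw [partialD, this.fderiv_eq, partialD]

theorem partialD_const (c : 𝕜) : partialD μ (fun _ => c) y = 0 := by
  simp [partialD]

theorem partialD_add {f g : Coord → 𝕜} (hf : DifferentiableAt ℝ f y)
    (hg : DifferentiableAt ℝ g y) :
    partialD μ (fun z => f z + g z) y = partialD μ f y + partialD μ g y := by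
  simp [partialD, fderiv_fun_add hf hg]

theorem partialD_sub {f g : Coord → 𝕜} (hf : DifferentiableAt ℝ f y)
    (hg : DifferentiableAt ℝ g y) :
    partialD μ (fun z => f z - g z) y = partialD μ f y - partialD μ g y := by
  simp [partialD, fderiv_fun_sub hf hg]

theorem partialD_mul {f g : Coord → 𝕜} (hf : DifferentiableAt ℝ f y)
    (hg : DifferentiableAt ℝ g y) :
    partialD μ (fun z => f z * g z) y = partialD μ f y * g y + f y * partialD μ g y := by
  simp [partialD, fderiv_fun_mul hf hg]
  ring

theorem partialD_const_mul {f : Coord → 𝕜} (c : 𝕜) (hf : DifferentiableAt ℝ f y) :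
    partialD μ (fun z => c * f z) y = c * partialD μ f y := by
  simp [partialD, fderiv_const_mul hf]

theorem partialD_sum {ι : Type*} {t : Finset ι} {f : ι → Coord → 𝕜}
    (hf : ∀ i ∈ t, DifferentiableAt ℝ (f i) y) :
    partialD μ (fun z => ∑ i ∈ t, f i z) y = ∑ i ∈ t, partialD μ (f i) y := by
  simp [partialD, fderiv_fun_sum hf]

theorem partialD_ofReal {f : Coord → ℝ} (hf : DifferentiableAt ℝ f y) :
    partialD μ (fun z => (f z : ℂ)) y = ((partialD μ f y : ℝ) : ℂ) := by
  have h := (Complex.ofRealCLM.hasFDerivAt (x := f y)).comp y hf.hasFDerivAt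
  have h2 : HasFDerivAt (fun z => (f z : ℂ)) (Complex.ofRealCLM.comp (fderiv ℝ f y)) y := h
  simp [partialD, h2.fderiv]

theorem contDiffOn_partialD {f : Coord → 𝕜} (hs : IsOpen s) (hf : ContDiffOn ℝ ∞ f s) :
    ContDiffOn ℝ ∞ (fun z => partialD μ f z) s := by
  have h := hf.fderiv_of_isOpen hs (m := ∞) (by simp)
  exact h.clm_apply contDiffOn_const

theorem ContDiffOn.differentiableAt_of_isOpen {f : Coord → 𝕜} (hf : ContDiffOn ℝ ∞ f s)
    (hs : IsOpen s) (hy : y ∈ s) : DifferentiableAt ℝ f y :=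
  (hf.contDiffAt (hs.mem_nhds hy)).differentiableAt (by simp)

theorem ContDiffOn.ofReal {f : Coord → ℝ} (hf : ContDiffOn ℝ ∞ f s) :
    ContDiffOn ℝ ∞ (fun z => (f z : ℂ)) s :=
  Complex.ofRealCLM.contDiff.comp_contDiffOn hf

theorem partialD_comm {f : Coord → 𝕜} (hs : IsOpen s) (hf : ContDiffOn ℝ ∞ f s) (hy : y ∈ s) :
    partialD μ (fun z => partialD ν f z) y = partialD ν (fun z => partialD μ f z) y := by
  have hc := hf.contDiffAt (hs.mem_nhds hy)
  have hsymm : IsSymmSndFDerivAt ℝ f y :=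
    hc.isSymmSndFDerivAt (by rw [minSmoothness_of_isRCLikeNormedField]; exact WithTop.coe_le_coe.2 le_top)
  have hd : DifferentiableAt ℝ (fderiv ℝ f) y :=
    ((hf.fderiv_of_isOpen hs (m := ∞) (by simp)).contDiffAt (hs.mem_nhds hy)).differentiableAt
      (by simp)
  have key : ∀ a b : Fin 4, partialD a (fun z => partialD b f z) y =
      fderiv ℝ (fderiv ℝ f) y (EuclideanSpace.single a (1 : ℝ))
        (EuclideanSpace.single b (1 : ℝ)) := by
    intro a b
    have h := hd.hasFDerivAt.clm_apply (hasFDerivAt_const (EuclideanSpace.single b (1 : ℝ)) y)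
    simp [partialD, h.fderiv]
  rw [key, key, hsymm.eq]

/-- The entrywise partial derivative of a matrix-valued function. -/
def matD (μ : Fin 4) (F : Coord → Matrix (Fin 4) (Fin 4) 𝕜) (y : Coord) :
    Matrix (Fin 4) (Fin 4) 𝕜 :=
  Matrix.of fun i j => partialD μ (fun z => F z i j) y

/-- A matrix-valued function with smooth entries. -/
def SmoothMat (s : Set Coord) (F : Coord → Matrix (Fin 4) (Fin 4) 𝕜) : Prop :=
  ∀ i j, ContDiffOn ℝ ∞ (fun z => F z i j) s

/-- A matrix-valued function with entries differentiable at a point. -/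
def DiffMatAt (F : Coord → Matrix (Fin 4) (Fin 4) 𝕜) (y : Coord) : Prop :=
  ∀ i j, DifferentiableAt ℝ (fun z => F z i j) y

variable {F G : Coord → Matrix (Fin 4) (Fin 4) 𝕜}

theorem SmoothMat.diffMatAt (hF : SmoothMat s F) (hs : IsOpen s) (hy : y ∈ s) : DiffMatAt F y :=
  fun i j => (hF i j).differentiableAt_of_isOpen hs hy

theorem SmoothMat.mul (hF : SmoothMat s F) (hG : SmoothMat s G) :
    SmoothMat s (fun z => F z * G z) := fun i j => by
  simp only [Matrix.mul_apply]
  exact ContDiffOn.sum fun k _ => (hF i k).mul (hG k j)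

theorem SmoothMat.ofReal {F : Coord → Matrix (Fin 4) (Fin 4) ℝ} (hF : SmoothMat s F) :
    SmoothMat s (fun z => (F z).map ((↑) : ℝ → ℂ)) := fun i j => (hF i j).ofReal

theorem DiffMatAt.mul (hF : DiffMatAt F y) (hG : DiffMatAt G y) :
    DiffMatAt (fun z => F z * G z) y := fun i j => by
  simp only [Matrix.mul_apply]
  exact DifferentiableAt.fun_sum fun k _ => (hF i k).mul (hG k j)

theorem DiffMatAt.transpose (hF : DiffMatAt F y) : DiffMatAt (fun z => (F z).transpose) y :=
  fun i j => hF j i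

theorem DiffMatAt.add (hF : DiffMatAt F y) (hG : DiffMatAt G y) :
    DiffMatAt (fun z => F z + G z) y := fun i j => (hF i j).add (hG i j)

theorem DiffMatAt.sub (hF : DiffMatAt F y) (hG : DiffMatAt G y) :
    DiffMatAt (fun z => F z - G z) y := fun i j => (hF i j).sub (hG i j)

theorem DiffMatAt.smul {f : Coord → 𝕜} (hf : DifferentiableAt ℝ f y) (hF : DiffMatAt F y) :
    DiffMatAt (fun z => f z • F z) y := fun i j => hf.mul (hF i j)

theorem matD_congr (hs : IsOpen s) (hy : y ∈ s) (h : ∀ z ∈ s, F z = G z) :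
    matD μ F y = matD μ G y := by
  ext i j
  exact partialD_congr hs hy fun z hz => by rw [h z hz]

theorem matD_const (A : Matrix (Fin 4) (Fin 4) 𝕜) : matD μ (fun _ => A) y = 0 := by
  ext i j
  exact partialD_const _

theorem matD_add (hF : DiffMatAt F y) (hG : DiffMatAt G y) :
    matD μ (fun z => F z + G z) y = matD μ F y + matD μ G y := by
  ext i j
  exact partialD_add (hF i j) (hG i j)

theorem matD_sub (hF : DiffMatAt F y) (hG : DiffMatAt G y) :
    matD μ (fun z => F z - G z) y = matD μ F y - matD μ G y := by
  ext i j
  exact partialD_sub (hF i j) (hG i j)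

theorem matD_mul (hF : DiffMatAt F y) (hG : DiffMatAt G y) :
    matD μ (fun z => F z * G z) y = matD μ F y * G y + F y * matD μ G y := by
  ext i j
  simp only [matD, Matrix.mul_apply, Matrix.of_apply, Matrix.add_apply]
  rw [partialD_sum fun k _ => (hF i k).fun_mul (hG k j), ← Finset.sum_add_distrib]
  exact Finset.sum_congr rfl fun k _ => partialD_mul (hF i k) (hG k j)

theorem matD_smul {f : Coord → 𝕜} (hf : DifferentiableAt ℝ f y) (hF : DiffMatAt F y) :
    matD μ (fun z => f z • F z) y = partialD μ f y • F y + f y • matD μ F y := by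
  ext i j
  exact partialD_mul hf (hF i j)

theorem matD_transpose : matD μ (fun z => (F z).transpose) y = (matD μ F y).transpose := rfl

theorem matD_ofReal {F : Coord → Matrix (Fin 4) (Fin 4) ℝ} (hF : DiffMatAt F y) :
    matD μ (fun z => (F z).map ((↑) : ℝ → ℂ)) y = (matD μ F y).map ((↑) : ℝ → ℂ) := by
  ext i j
  exact partialD_ofReal (hF i j)

theorem matD_comm (hs : IsOpen s) (hF : SmoothMat s F) (hy : y ∈ s) :
    matD μ (fun z => matD ν F z) y = matD ν (fun z => matD μ F z) y := by
  ext i j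
  exact partialD_comm hs (hF i j) hy

/-- Jacobi's formula. -/
theorem partialD_det (hF : DiffMatAt F y) :
    partialD μ (fun z => (F z).det) y = ((F y).adjugate * matD μ F y).trace := by
  have h1 : ∀ i, ((F y).adjugate * matD μ F y) i i =
      ∑ σ : Equiv.Perm (Fin 4), (Equiv.Perm.sign σ : 𝕜) *
        ((∏ j ∈ Finset.univ.erase i, F y (σ j) j) * matD μ F y (σ i) i) := by
    intro i
    -- By Cramer's rule this diagonal entry is the determinant of F with column i replaced by its
    -- derivative, which is the i-th summand of the Leibniz rule.
    have h2 : ((F y).adjugate * matD μ F y) i i =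
        Matrix.cramer (F y) (fun j => matD μ F y j i) i := by
      rw [Matrix.cramer_eq_adjugate_mulVec]
      rfl
    rw [h2, Matrix.cramer_apply, Matrix.det_apply']
    refine Finset.sum_congr rfl fun σ _ => ?_
    rw [← Finset.mul_prod_erase Finset.univ _ (Finset.mem_univ i), Matrix.updateCol_self,
      mul_comm (matD μ F y (σ i) i)]
    congr 2
    refine Finset.prod_congr rfl fun j hj => ?_
    rw [Matrix.updateCol_ne (Finset.ne_of_mem_erase hj)]
  have h3 : HasFDerivAt (fun z => (F z).det)
      (∑ σ : Equiv.Perm (Fin 4), (Equiv.Perm.sign σ : 𝕜) •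
        ∑ i, (∏ j ∈ Finset.univ.erase i, F y (σ j) j) •
          fderiv ℝ (fun z => F z (σ i) i) y) y := by
    simp only [Matrix.det_apply']
    refine HasFDerivAt.fun_sum fun σ _ => HasFDerivAt.const_mul ?_ _
    exact HasFDerivAt.finsetProd fun i _ => (hF (σ i) i).hasFDerivAt
  rw [partialD, h3.fderiv, Matrix.trace]
  simp only [Matrix.diag_apply, h1]
  rw [Finset.sum_comm]
  simp [Finset.mul_sum, matD, partialD]

theorem SmoothMat.det (hF : SmoothMat s F) : ContDiffOn ℝ ∞ (fun z => (F z).det) s := by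
  simp only [Matrix.det_apply']
  exact ContDiffOn.sum fun σ _ => contDiffOn_const.mul (contDiffOn_prod fun i _ => hF _ _)

theorem SmoothMat.inv {F : Coord → Matrix (Fin 4) (Fin 4) ℝ} (hF : SmoothMat s F)
    (h : ∀ z ∈ s, (F z).det ≠ 0) : SmoothMat s (fun z => (F z)⁻¹) := fun i j => by
  simp only [Matrix.inv_def, Matrix.smul_apply, Matrix.adjugate_apply, smul_eq_mul,
    Ring.inverse_eq_inv']
  refine (hF.det.inv h).mul (SmoothMat.det fun k l => ?_)
  by_cases hk : k = j
  · subst hk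
    simpa using contDiffOn_const
  · simpa [Matrix.updateRow_ne hk] using hF k l

end Calculus

/-! ## Metric compatibility and symmetries of the curvature -/

/-- Twelve times the Levi-Civita symbol, as an integer. -/
def leviCivitaInt (α β γ δ : Fin 4) : ℤ :=
  ((β : ℕ) - (α : ℕ) : ℤ) * ((γ : ℕ) - (α : ℕ)) * ((δ : ℕ) - (α : ℕ)) * ((γ : ℕ) - (β : ℕ)) *
    ((δ : ℕ) - (β : ℕ)) * ((δ : ℕ) - (γ : ℕ))

/-- This is the derivation property for elementary matrices. The integer normalisation makes it a
decidable statement over finitely many indices. -/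
theorem leviCivitaInt_derivation : ∀ α β γ δ i j : Fin 4,
    ((if j = α then leviCivitaInt i β γ δ else 0) + (if j = β then leviCivitaInt α i γ δ else 0) +
      (if j = γ then leviCivitaInt α β i δ else 0) + (if j = δ then leviCivitaInt α β γ i else 0)) =
      if i = j then leviCivitaInt α β γ δ else 0 := by
  decide +kernel

theorem leviCivita_eq_int (α β γ δ : Fin 4) :
    leviCivita α β γ δ = (leviCivitaInt α β γ δ : ℝ) / 12 := by
  simp [leviCivita, leviCivitaInt]

/-- The action of an endomorphism on the Levi-Civita symbol as a derivation is multiplication by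
its trace. -/
theorem leviCivita_derivation (Γ : Matrix (Fin 4) (Fin 4) ℝ) (α β γ δ : Fin 4) :
    ∑ l, (Γ l α * leviCivita l β γ δ + Γ l β * leviCivita α l γ δ + Γ l γ * leviCivita α β l δ
      + Γ l δ * leviCivita α β γ l) = Γ.trace * leviCivita α β γ δ := by
  -- Expanding over all entries of Γ reduces the claim, by linearity, to elementary matrices.
  have h2 : ∀ l α (x : ℝ), Γ l α * x = ∑ j, Γ l j * (if j = α then x else 0) := by
    intro l α x; simp
  have h3 : ∀ l, Γ l α * leviCivita l β γ δ + Γ l β * leviCivita α l γ δ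
      + Γ l γ * leviCivita α β l δ + Γ l δ * leviCivita α β γ l =
      ∑ j, Γ l j * (if l = j then leviCivita α β γ δ else 0) := by
    intro l
    rw [h2 l α, h2 l β, h2 l γ, h2 l δ]
    simp only [← Finset.sum_add_distrib, ← mul_add]
    refine Finset.sum_congr rfl fun j _ => ?_
    congr 1
    have := congrArg (fun n : ℤ => (n : ℝ) / 12) (leviCivitaInt_derivation α β γ δ l j)
    push_cast at this
    simp only [add_div, ite_div, zero_div] at this
    simpa only [leviCivita_eq_int] using this
  simp only [h3, Matrix.trace, Finset.sum_mul]
  simp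

namespace LocalFields

/-- The metric as a matrix. -/
def gMat (L : LocalFields) (y : Coord) : Matrix (Fin 4) (Fin 4) ℝ := Matrix.of (L.g y)

/-- The inverse metric as a matrix. -/
def gInvMat (L : LocalFields) (y : Coord) : Matrix (Fin 4) (Fin 4) ℝ := (L.gMat y)⁻¹

/-- The canonical 2-form as a matrix. -/
def uMat (L : LocalFields) (y : Coord) : Matrix (Fin 4) (Fin 4) ℝ := Matrix.of (L.U y)

/-- The matrix `(Γ_μ)^l_ν` of Christoffel symbols. -/
def chr (L : LocalFields) (μ : Fin 4) (y : Coord) : Matrix (Fin 4) (Fin 4) ℝ :=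
  Matrix.of fun l ν => L.christoffel y l μ ν

/-- The curvature matrix `(R_{μν})^ρ_σ`. -/
def curv (L : LocalFields) (μ ν : Fin 4) (y : Coord) : Matrix (Fin 4) (Fin 4) ℝ :=
  Matrix.of fun ρ σ => L.riemannUp y ρ σ μ ν

theorem gInvMat_apply (L : LocalFields) (y : Coord) (α β : Fin 4) :
    L.gInvMat y α β = L.gInv y α β := rfl

theorem curv_eq (L : LocalFields) (y : Coord) (μ ν : Fin 4) :
    L.curv μ ν y = matD μ (L.chr ν) y - matD ν (L.chr μ) y + L.chr μ y * L.chr ν y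
      - L.chr ν y * L.chr μ y := by
  ext ρ σ
  simp only [curv, riemannUp, Matrix.of_apply, Finset.sum_sub_distrib, Matrix.add_apply,
    Matrix.sub_apply, Matrix.mul_apply]
  simp only [matD, chr, Matrix.of_apply]
  ring

theorem riemann_antisymm_right (L : LocalFields) (y : Coord) (ρ σ μ ν : Fin 4) :
    L.riemann y ρ σ μ ν = -L.riemann y ρ σ ν μ := by
  simp only [riemann, riemannUp, Finset.sum_sub_distrib]
  rw [← Finset.sum_neg_distrib]
  refine Finset.sum_congr rfl fun l _ => ?_
  ring

/-- Smooth components, on an open set, of a metric, a volume element and a 2-form which admit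
adapted coframes at every point. -/
structure RegularOn (L : LocalFields) (s : Set Coord) : Prop where
  isOpen : IsOpen s
  smooth_g : ∀ α β, ContDiffOn ℝ ∞ (fun z => L.g z α β) s
  smooth_vol : ∀ α β γ δ, ContDiffOn ℝ ∞ (fun z => L.vol z α β γ δ) s
  smooth_U : ∀ α β, ContDiffOn ℝ ∞ (fun z => L.U z α β) s
  exists_coframeAt : ∀ z ∈ s, ∃ C, L.CoframeAt z C

variable {L : LocalFields} {s : Set Coord} {y : Coord} {C : Matrix (Fin 4) (Fin 4) ℝ}

theorem CoframeAt.gMat_eq (h : L.CoframeAt y C) :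
    L.gMat y = C.transpose * Matrix.of minkowski * C := by
  ext α β
  simp only [gMat, Matrix.of_apply, h.metric, Matrix.mul_apply, Matrix.transpose_apply,
    Finset.sum_mul]
  rw [Finset.sum_comm]
  refine Finset.sum_congr rfl fun i _ => Finset.sum_congr rfl fun j _ => ?_
  ring

theorem minkowski_eq_diagonal :
    Matrix.of minkowski = Matrix.diagonal ![-1, 1, 1, 1] := by
  ext i j; fin_cases i <;> fin_cases j <;> simp [minkowski]

theorem minkowski_mul_self : Matrix.of minkowski * Matrix.of minkowski = 1 := by
  rw [minkowski_eq_diagonal, Matrix.diagonal_mul_diagonal, ← Matrix.diagonal_one]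
  congr 1
  ext i; fin_cases i <;> simp

theorem minkowski_transpose : (Matrix.of minkowski).transpose = Matrix.of minkowski := by
  rw [minkowski_eq_diagonal, Matrix.diagonal_transpose]

/-- This relation lets the derivative of the volume element be computed from that of the metric. -/
theorem CoframeAt.det_gMat (h : L.CoframeAt y C) : (L.gMat y).det = -(L.vol y 0 1 2 3) ^ 2 := by
  have h1 : leviCivita 0 1 2 3 = 1 := by norm_num [leviCivita]
  rw [h.gMat_eq, Matrix.det_mul, Matrix.det_mul, Matrix.det_transpose, h.vol, h1,
    minkowski_eq_diagonal, Matrix.det_diagonal]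
  simp [Fin.prod_univ_four]
  ring

theorem CoframeAt.vol_eq (h : L.CoframeAt y C) (α β γ δ : Fin 4) :
    L.vol y α β γ δ = L.vol y 0 1 2 3 * leviCivita α β γ δ := by
  have h1 : leviCivita 0 1 2 3 = 1 := by norm_num [leviCivita]
  rw [h.vol, h.vol 0 1 2 3, h1, mul_one]

theorem CoframeAt.vol_ne_zero (h : L.CoframeAt y C) : L.vol y 0 1 2 3 ≠ 0 := by
  have h1 : leviCivita 0 1 2 3 = 1 := by norm_num [leviCivita]
  rw [h.vol, h1, mul_one]
  exact h.isUnit_det.ne_zero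

theorem CoframeAt.det_ne_zero (h : L.CoframeAt y C) : (L.gMat y).det ≠ 0 := by
  rw [h.det_gMat]
  simpa using h.vol_ne_zero

theorem CoframeAt.gMat_transpose (h : L.CoframeAt y C) : (L.gMat y).transpose = L.gMat y := by
  rw [h.gMat_eq]
  simp only [Matrix.transpose_mul, Matrix.transpose_transpose, minkowski_transpose,
    Matrix.mul_assoc]

theorem CoframeAt.g_symm (h : L.CoframeAt y C) (α β : Fin 4) : L.g y α β = L.g y β α :=
  congrFun (congrFun h.gMat_transpose β) α

theorem CoframeAt.gInv_mul (h : L.CoframeAt y C) : L.gInvMat y * L.gMat y = 1 :=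
  Matrix.nonsing_inv_mul _ (isUnit_iff_ne_zero.2 h.det_ne_zero)

theorem CoframeAt.mul_gInv (h : L.CoframeAt y C) : L.gMat y * L.gInvMat y = 1 :=
  Matrix.mul_nonsing_inv _ (isUnit_iff_ne_zero.2 h.det_ne_zero)

theorem CoframeAt.uMat_transpose (h : L.CoframeAt y C) : (L.uMat y).transpose = -L.uMat y := by
  ext α β
  simp [uMat, h.U]

namespace RegularOn

variable (h : L.RegularOn s) (hy : y ∈ s)
include h

theorem smoothMat_g : SmoothMat s L.gMat := h.smooth_g

theorem smoothMat_u : SmoothMat s L.uMat := h.smooth_U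

theorem smoothMat_gInv : SmoothMat s L.gInvMat :=
  h.smoothMat_g.inv fun z hz => by
    obtain ⟨C, hC⟩ := h.exists_coframeAt z hz
    exact hC.det_ne_zero

theorem smooth_gInv (α β : Fin 4) : ContDiffOn ℝ ∞ (fun z => L.gInv z α β) s :=
  h.smoothMat_gInv α β

theorem smooth_christoffel (l μ ν : Fin 4) :
    ContDiffOn ℝ ∞ (fun z => L.christoffel z l μ ν) s := by
  unfold christoffel
  have hd := fun a b c => contDiffOn_partialD (μ := c) h.isOpen (h.smooth_g a b)
  exact contDiffOn_const.mul (ContDiffOn.sum fun σ _ =>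
    (h.smooth_gInv l σ).mul (((hd _ _ _).add (hd _ _ _)).sub (hd _ _ _)))

theorem smoothMat_chr (μ : Fin 4) : SmoothMat s (L.chr μ) := fun l ν => h.smooth_christoffel l μ ν

include hy

theorem christoffel_symm (l μ ν : Fin 4) : L.christoffel y l μ ν = L.christoffel y l ν μ := by
  have hg : ∀ σ μ ν, partialD σ (fun z => L.g z μ ν) y = partialD σ (fun z => L.g z ν μ) y :=
    fun σ μ ν => partialD_congr h.isOpen hy fun z hz => by
      obtain ⟨C, hC⟩ := h.exists_coframeAt z hz
      exact hC.g_symm μ ν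
  simp only [christoffel]
  congr 1
  refine Finset.sum_congr rfl fun σ _ => ?_
  rw [hg σ μ ν]
  ring

theorem sum_g_mul_christoffel (α μ ν : Fin 4) :
    ∑ l, L.g y α l * L.christoffel y l μ ν =
      1 / 2 * (partialD μ (fun z => L.g z α ν) y + partialD ν (fun z => L.g z α μ) y
        - partialD α (fun z => L.g z μ ν) y) := by
  obtain ⟨C, hC⟩ := h.exists_coframeAt y hy
  have h1 : ∀ σ, ∑ l, L.g y α l * L.gInv y l σ = if α = σ then 1 else 0 := fun σ => by
    have := congrFun (congrFun hC.mul_gInv α) σ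
    rwa [Matrix.mul_apply, Matrix.one_apply] at this
  set X : Fin 4 → ℝ := fun σ => partialD μ (fun z => L.g z σ ν) y +
    partialD ν (fun z => L.g z σ μ) y - partialD σ (fun z => L.g z μ ν) y with hX
  have h2 : ∑ l, L.g y α l * L.christoffel y l μ ν =
      ∑ σ, (∑ l, L.g y α l * L.gInv y l σ) * (1 / 2 * X σ) := by
    simp only [christoffel, Finset.mul_sum, Finset.sum_mul]
    rw [Finset.sum_comm]
    refine Finset.sum_congr rfl fun i _ => Finset.sum_congr rfl fun j _ => ?_
    simp only [hX]
    ring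
  rw [h2]
  simp [h1, hX]

/-- Metric compatibility. -/
theorem matD_g (μ : Fin 4) :
    matD μ L.gMat y = (L.chr μ y).transpose * L.gMat y + L.gMat y * L.chr μ y := by
  obtain ⟨C, hC⟩ := h.exists_coframeAt y hy
  have hg : ∀ σ μ ν, partialD σ (fun z => L.g z μ ν) y = partialD σ (fun z => L.g z ν μ) y :=
    fun σ μ ν => partialD_congr h.isOpen hy fun z hz => by
      obtain ⟨C, hC⟩ := h.exists_coframeAt z hz
      exact hC.g_symm μ ν
  ext α β
  have h1 : ((L.chr μ y).transpose * L.gMat y) α β =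
      ∑ l, L.g y β l * L.christoffel y l μ α := by
    simp only [Matrix.mul_apply, Matrix.transpose_apply]
    refine Finset.sum_congr rfl fun l _ => ?_
    rw [hC.g_symm β l, mul_comm]
    rfl
  have h2 : (L.gMat y * L.chr μ y) α β = ∑ l, L.g y α l * L.christoffel y l μ β := rfl
  rw [Matrix.add_apply, h1, h2, h.sum_g_mul_christoffel hy, h.sum_g_mul_christoffel hy, hg μ β α,
    hg β μ α, hg α μ β]
  change partialD μ (fun z => L.g z α β) y = _
  ring

/-- Differentiate g⁻¹ g = 1, insert metric compatibility, and multiply by g⁻¹ on the right. -/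
theorem matD_gInv (μ : Fin 4) :
    matD μ L.gInvMat y =
      -(L.chr μ y * L.gInvMat y) - L.gInvMat y * (L.chr μ y).transpose := by
  obtain ⟨C, hC⟩ := h.exists_coframeAt y hy
  have h1 := matD_mul (μ := μ) (h.smoothMat_gInv.diffMatAt h.isOpen hy)
    (h.smoothMat_g.diffMatAt h.isOpen hy)
  have h2 : matD μ (fun z => L.gInvMat z * L.gMat z) y = 0 := by
    rw [← matD_const (1 : Matrix (Fin 4) (Fin 4) ℝ) (μ := μ) (y := y)]
    refine matD_congr h.isOpen hy fun z hz => ?_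
    obtain ⟨C, hC⟩ := h.exists_coframeAt z hz
    exact hC.gInv_mul
  rw [h2, h.matD_g hy] at h1
  have h3 := congrArg (· * L.gInvMat y) h1
  simp only [zero_mul, add_mul, mul_add, mul_assoc, hC.mul_gInv, mul_one] at h3
  rw [← mul_assoc (L.gInvMat y) (L.gMat y), hC.gInv_mul, one_mul] at h3
  rw [sub_eq_add_neg, ← sub_eq_zero, h3]
  abel

/-- The volume element is parallel. With w = η₀₁₂₃, differentiating det g = −w² directly and by
Jacobi's formula gives ∂w = w tr Γ. The trace is then redistributed over the four indices by the
derivation property of the Levi-Civita symbol. -/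
theorem partialD_vol (μ α β γ δ : Fin 4) :
    partialD μ (fun z => L.vol z α β γ δ) y =
      ∑ l, (L.christoffel y l μ α * L.vol y l β γ δ + L.christoffel y l μ β * L.vol y α l γ δ
        + L.christoffel y l μ γ * L.vol y α β l δ + L.christoffel y l μ δ * L.vol y α β γ l) := by
  obtain ⟨C, hC⟩ := h.exists_coframeAt y hy
  set w : Coord → ℝ := fun z => L.vol z 0 1 2 3 with hw
  have hd : DifferentiableAt ℝ w y := (h.smooth_vol 0 1 2 3).differentiableAt_of_isOpen h.isOpen hy
  have h1 : partialD μ (fun z => (L.gMat z).det) y = -(2 * w y * partialD μ w y) := by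
    have : partialD μ (fun z => (L.gMat z).det) y = partialD μ (fun z => -1 * (w z * w z)) y :=
      partialD_congr h.isOpen hy fun z hz => by
        obtain ⟨C, hC⟩ := h.exists_coframeAt z hz
        rw [hC.det_gMat]
        ring
    rw [this, partialD_const_mul _ (hd.fun_mul hd), partialD_mul hd hd]
    ring
  have h2 : partialD μ (fun z => (L.gMat z).det) y = -(2 * w y * (w y * (L.chr μ y).trace)) := by
    rw [partialD_det (h.smoothMat_g.diffMatAt h.isOpen hy), h.matD_g hy, mul_add,
      Matrix.trace_add, ← mul_assoc, ← mul_assoc, Matrix.adjugate_mul,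
      Matrix.trace_mul_cycle, Matrix.mul_adjugate, hC.det_gMat]
    simp [hw]
    ring
  have h3 : partialD μ w y = w y * (L.chr μ y).trace :=
    mul_left_cancel₀ (mul_ne_zero two_ne_zero hC.vol_ne_zero) (neg_injective (h1.symm.trans h2))
  have h4 : partialD μ (fun z => L.vol z α β γ δ) y =
      partialD μ (fun z => leviCivita α β γ δ * w z) y :=
    partialD_congr h.isOpen hy fun z hz => by
      obtain ⟨C, hC⟩ := h.exists_coframeAt z hz
      rw [hC.vol_eq, mul_comm]
  rw [h4, partialD_const_mul _ hd, h3]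
  have h5 := leviCivita_derivation (L.chr μ y) α β γ δ
  calc _ = w y * ((L.chr μ y).trace * leviCivita α β γ δ) := by ring
    _ = _ := by
      rw [← h5, Finset.mul_sum]
      refine Finset.sum_congr rfl fun l _ => ?_
      rw [hC.vol_eq l β γ δ, hC.vol_eq α l γ δ, hC.vol_eq α β l δ, hC.vol_eq α β γ l]
      simp only [chr, Matrix.of_apply, hw]
      ring

/-- This is the Ricci identity for the metric: metric compatibility is differentiated once more and
the second partial derivatives of g commute. -/
theorem gMat_mul_curv_antisymm (μ ν : Fin 4) :
    (L.curv μ ν y).transpose * L.gMat y + L.gMat y * L.curv μ ν y = 0 := by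
  have hd : ∀ a b, matD a (fun z => matD b L.gMat z) y =
      (matD a (L.chr b) y).transpose * L.gMat y + (L.chr b y).transpose * matD a L.gMat y +
        (matD a L.gMat y * L.chr b y + L.gMat y * matD a (L.chr b) y) := by
    intro a b
    have hc := (h.smoothMat_chr b).diffMatAt h.isOpen hy
    have hg := h.smoothMat_g.diffMatAt h.isOpen hy
    rw [matD_congr h.isOpen hy fun z hz => h.matD_g hz b,
      matD_add (hc.transpose.mul hg) (hg.mul hc), matD_mul hc.transpose hg, matD_mul hg hc,
      matD_transpose]
  have h1 := matD_comm (μ := μ) (ν := ν) h.isOpen h.smoothMat_g hy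
  rw [hd, hd, h.matD_g hy, h.matD_g hy] at h1
  rw [curv_eq]
  simp only [Matrix.transpose_sub, Matrix.transpose_add, Matrix.transpose_mul]
  rw [← sub_eq_zero] at h1
  rw [← h1]
  noncomm_ring

theorem riemann_antisymm_left (ρ σ μ ν : Fin 4) : L.riemann y ρ σ μ ν = -L.riemann y σ ρ μ ν := by
  obtain ⟨C, hC⟩ := h.exists_coframeAt y hy
  have h1 := congrFun (congrFun (h.gMat_mul_curv_antisymm hy μ ν) ρ) σ
  have h2 : (L.curv μ ν y).transpose * L.gMat y = (L.gMat y * L.curv μ ν y).transpose := by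
    rw [Matrix.transpose_mul, hC.gMat_transpose]
  rw [h2] at h1
  have h3 : L.riemann y σ ρ μ ν + L.riemann y ρ σ μ ν = 0 := h1
  linarith

/-- The first Bianchi identity. -/
theorem riemann_bianchi (ρ σ μ ν : Fin 4) :
    L.riemann y ρ σ μ ν + L.riemann y ρ μ ν σ + L.riemann y ρ ν σ μ = 0 := by
  have h1 : ∀ l a b c, partialD c (fun z => L.christoffel z l a b) y =
      partialD c (fun z => L.christoffel z l b a) y := fun l a b c =>
    partialD_congr h.isOpen hy fun z hz => h.christoffel_symm hz l a b
  simp only [riemann, ← Finset.sum_add_distrib, ← mul_add]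
  refine Finset.sum_eq_zero fun l _ => ?_
  simp only [riemannUp, Finset.sum_sub_distrib]
  rw [h1 l ν σ μ, h1 l μ σ ν, h1 l ν μ σ]
  simp only [h.christoffel_symm hy _ ν σ, h.christoffel_symm hy _ μ σ, h.christoffel_symm hy _ ν μ]
  ring

/-- The classical octahedron argument: combine the four first Bianchi identities, one for each
cyclic rotation of the indices, with the two antisymmetries. -/
theorem riemann_pair_symm (ρ σ μ ν : Fin 4) : L.riemann y ρ σ μ ν = L.riemann y μ ν ρ σ := by
  have b := h.riemann_bianchi hy
  have l := h.riemann_antisymm_left hy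
  have r := L.riemann_antisymm_right y
  linarith [b ρ σ μ ν, b σ μ ν ρ, b μ ν ρ σ, b ν ρ σ μ, l ρ σ μ ν, l μ ν ρ σ, r ρ σ μ ν,
    r μ ν ρ σ, l ρ μ ν σ, r ρ μ ν σ, l ρ ν σ μ, r ρ ν σ μ, l σ μ ν ρ, r σ μ ν ρ, l σ ν ρ μ,
    r σ ν ρ μ, l σ ρ μ ν, r σ ρ μ ν, l ν ρ σ μ, r ν ρ σ μ, r μ ρ σ ν, l μ ρ σ ν, r ν σ μ ρ,
    l ν σ μ ρ, r ν μ ρ σ, l ν μ ρ σ, r μ σ ν ρ, l μ σ ν ρ, r μ ν σ ρ, l μ ν σ ρ, l ρ σ ν μ,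
    r ρ μ σ ν, r σ μ ρ ν, l ρ μ σ ν, r ρ ν μ σ, l ρ ν μ σ]

end RegularOn

end LocalFields

/-! ## Components in an adapted frame -/

/-- The complexification of a real matrix. -/
def toC (A : Matrix (Fin 4) (Fin 4) ℝ) : Matrix (Fin 4) (Fin 4) ℂ := A.map Complex.ofRealHom

theorem toC_apply (A : Matrix (Fin 4) (Fin 4) ℝ) (i j : Fin 4) : toC A i j = (A i j : ℂ) := rfl

theorem toC_mul (A B : Matrix (Fin 4) (Fin 4) ℝ) : toC (A * B) = toC A * toC B := Matrix.map_mul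

theorem toC_add (A B : Matrix (Fin 4) (Fin 4) ℝ) : toC (A + B) = toC A + toC B := by
  ext i j; simp [toC_apply]

theorem toC_sub (A B : Matrix (Fin 4) (Fin 4) ℝ) : toC (A - B) = toC A - toC B := by
  ext i j; simp [toC_apply]

theorem toC_neg (A : Matrix (Fin 4) (Fin 4) ℝ) : toC (-A) = -toC A := by
  ext i j; simp [toC_apply]

theorem toC_one : toC 1 = 1 := by
  ext i j
  rw [toC_apply, Matrix.one_apply, Matrix.one_apply]
  split_ifs <;> simp

theorem toC_transpose (A : Matrix (Fin 4) (Fin 4) ℝ) :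
    toC A.transpose = (toC A).transpose := rfl

theorem toC_injective : Function.Injective toC := fun A B h => by
  ext i j
  exact Complex.ofReal_injective (congrFun (congrFun h i) j)

/-- The components `F_{ij} = F(b_i, b_j)` of a 2-tensor in the frame with matrix `B`. -/
def pull (B : Matrix (Fin 4) (Fin 4) ℝ) : Tensor2 →ₗ[ℂ] Tensor2 where
  toFun F := (toC B).transpose * Matrix.of F * toC B
  map_add' F G := by
    change (toC B).transpose * (Matrix.of F + Matrix.of G) * toC B = _
    rw [mul_add, add_mul]
    rfl
  map_smul' c F := by
    change (toC B).transpose * (c • Matrix.of F) * toC B = _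
    rw [Matrix.mul_smul, Matrix.smul_mul]
    rfl

theorem pull_eq (B : Matrix (Fin 4) (Fin 4) ℝ) (F : Tensor2) :
    Matrix.of (pull B F) = (toC B).transpose * Matrix.of F * toC B := rfl

theorem pull_apply (B : Matrix (Fin 4) (Fin 4) ℝ) (F : Tensor2) (i j : Fin 4) :
    pull B F i j = ∑ α, ∑ β, (B α i : ℂ) * (B β j : ℂ) * F α β := by
  change ((toC B).transpose * Matrix.of F * toC B) i j = _
  simp only [Matrix.mul_apply, Finset.sum_mul, Matrix.transpose_apply, toC_apply, Matrix.of_apply]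
  rw [Finset.sum_comm]
  refine Finset.sum_congr rfl fun _ _ => Finset.sum_congr rfl fun _ _ => ?_
  ring

theorem pull_pull {B C : Matrix (Fin 4) (Fin 4) ℝ} (h : B * C = 1) (F : Tensor2) :
    pull C (pull B F) = F := by
  have h1 : toC B * toC C = 1 := by rw [← toC_mul, h, toC_one]
  have h2 : (toC C).transpose * (toC B).transpose = 1 := by
    rw [← Matrix.transpose_mul, h1, Matrix.transpose_one]
  change (toC C).transpose * ((toC B).transpose * Matrix.of F * toC B) * toC C = _
  rw [← mul_assoc, ← mul_assoc, h2, one_mul, mul_assoc, h1, mul_one]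
  rfl

theorem pull_congr {B : Matrix (Fin 4) (Fin 4) ℝ} (F : Fin 4 → Fin 4 → Tensor2) (X : Tensor2)
    (c : ℂ) : pull B (fun α β => c * ∑ k, ∑ l, F k l α β * X k l) =
      fun i j => c * ∑ k, ∑ l, pull B (F k l) i j * X k l := by
  have : (fun α β => c * ∑ k, ∑ l, F k l α β * X k l : Tensor2) =
      c • ∑ k, ∑ l, X k l • F k l := by
    funext α β
    simp [Finset.sum_apply, mul_comm]
  rw [this]
  funext i j
  simp [Finset.sum_apply, mul_comm]

/-- The components of a 4-tensor in the frame with matrix `B`. -/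
def pull4 (B : Matrix (Fin 4) (Fin 4) ℝ) (P : Tensor4) : Tensor4 :=
  fun i j k l => pull B (fun α β => pull B (P α β) k l) i j


/-- The contraction of two 2-tensors. -/
def contract (F X : Tensor2) : ℂ := ∑ μ, ∑ ν, F μ ν * X μ ν

theorem contract_eq_trace (F X : Tensor2) :
    contract F X = (Matrix.of F * (Matrix.of X).transpose).trace := by
  simp [contract, Matrix.trace, Matrix.mul_apply]

/-- Pulling covariant indices back along B is adjoint to pushing contravariant indices forward. -/
theorem contract_push (B : Matrix (Fin 4) (Fin 4) ℝ) (F X : Tensor2) :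
    contract F (toC B * Matrix.of X * (toC B).transpose) = contract (pull B F) X := by
  refine (contract_eq_trace _ _).trans ((Eq.symm ?_).trans (contract_eq_trace _ _).symm)
  rw [pull_eq]
  change _ = (Matrix.of F * (toC B * Matrix.of X * (toC B).transpose).transpose).trace
  rw [Matrix.transpose_mul, Matrix.transpose_mul, Matrix.transpose_transpose]
  simp only [mul_assoc]
  rw [Matrix.trace_mul_comm (toC B).transpose]
  simp only [mul_assoc]

theorem pull_contract (B : Matrix (Fin 4) (Fin 4) ℝ) (P : Tensor4) (c : ℂ) (X : Tensor2) :
    pull B (fun α β => c * contract (pull B (P α β)) X) =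
      fun i j => c * contract (pull4 B P i j) X :=
  pull_congr (fun k l α β => pull B (P α β) k l) X c

/-- The model of a space-time with a 2+2 structure at a point: Minkowski space with the plane
spanned by the first two vectors of the standard frame. -/
def minkowskiModel : LocalFields where
  g _ := minkowski
  vol _ := leviCivita
  U _ i j := if i = 0 ∧ j = 1 then -1 else if i = 1 ∧ j = 0 then 1 else 0

/-! ### Transport of the algebraic operations to the Minkowski model -/

namespace LocalFields

variable {L : LocalFields} {s : Set Coord} {y : Coord} {B C : Matrix (Fin 4) (Fin 4) ℝ}

theorem gInvMat_minkowskiModel : minkowskiModel.gInvMat y = Matrix.of minkowski :=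
  Matrix.inv_eq_left_inv minkowski_mul_self

theorem gInv_minkowskiModel (i j : Fin 4) : minkowskiModel.gInv y i j = minkowski i j :=
  congrFun (congrFun gInvMat_minkowskiModel i) j

theorem raise_eq (L : LocalFields) (y : Coord) (F : Tensor2) :
    Matrix.of (L.raise y F) = toC (L.gInvMat y) * Matrix.of F * (toC (L.gInvMat y)).transpose := by
  ext α β
  simp only [raise, Matrix.of_apply, Matrix.mul_apply, Matrix.transpose_apply, toC_apply,
    gInvMat_apply, Finset.sum_mul]
  rw [Finset.sum_comm]
  refine Finset.sum_congr rfl fun _ _ => Finset.sum_congr rfl fun _ _ => ?_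
  ring

theorem act_apply (L : LocalFields) (y : Coord) (P : Tensor4) (F : Tensor2) (α β : Fin 4) :
    L.act y P F α β = 1 / 2 * contract (P α β) (L.raise y F) := rfl

theorem pairing_eq (L : LocalFields) (y : Coord) (F H : Tensor2) :
    L.pairing y F H = 1 / 2 * contract F (L.raise y H) := rfl

/-- The frame with matrix `B` dual to an adapted coframe. -/
structure FrameAt (L : LocalFields) (y : Coord) (B : Matrix (Fin 4) (Fin 4) ℝ) : Prop where
  isUnit : IsUnit B.det
  coframe : L.CoframeAt y B⁻¹

theorem CoframeAt.frameAt (h : L.CoframeAt y C) : L.FrameAt y C⁻¹ :=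
  ⟨by simpa using h.isUnit_det, by rwa [Matrix.nonsing_inv_nonsing_inv _ h.isUnit_det]⟩

namespace FrameAt

theorem mul_inv (h : L.FrameAt y B) : B * B⁻¹ = 1 := Matrix.mul_nonsing_inv _ h.isUnit

theorem inv_mul (h : L.FrameAt y B) : B⁻¹ * B = 1 := Matrix.nonsing_inv_mul _ h.isUnit

theorem toC_mul_inv (h : L.FrameAt y B) : toC B * toC B⁻¹ = 1 := by
  rw [← toC_mul, h.mul_inv, toC_one]

theorem toC_inv_mul (h : L.FrameAt y B) : toC B⁻¹ * toC B = 1 := by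
  rw [← toC_mul, h.inv_mul, toC_one]

theorem pull_injective (h : L.FrameAt y B) : Function.Injective (pull B) := fun F G hFG => by
  rw [← pull_pull h.mul_inv F, hFG, pull_pull h.mul_inv]

theorem transpose_mul_gMat_mul (h : L.FrameAt y B) :
    B.transpose * L.gMat y * B = Matrix.of minkowski := by
  have h1 : B.transpose * B⁻¹.transpose = 1 := by
    rw [← Matrix.transpose_mul, h.inv_mul, Matrix.transpose_one]
  rw [h.coframe.gMat_eq, ← mul_assoc, ← mul_assoc, h1, one_mul, mul_assoc, h.inv_mul, mul_one]

theorem gInvMat_eq (h : L.FrameAt y B) :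
    L.gInvMat y = B * Matrix.of minkowski * B.transpose := by
  have h1 : B⁻¹.transpose * B.transpose = 1 := by
    rw [← Matrix.transpose_mul, h.mul_inv, Matrix.transpose_one]
  apply Matrix.inv_eq_left_inv
  rw [h.coframe.gMat_eq]
  calc B * Matrix.of minkowski * B.transpose * (B⁻¹.transpose * Matrix.of minkowski * B⁻¹)
      = B * Matrix.of minkowski * (B⁻¹ * B).transpose * Matrix.of minkowski * B⁻¹ := by
        rw [Matrix.transpose_mul]; simp only [mul_assoc]
    _ = B * (Matrix.of minkowski * Matrix.of minkowski) * B⁻¹ := by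
        rw [h.inv_mul, Matrix.transpose_one, mul_one]; simp only [mul_assoc]
    _ = 1 := by rw [minkowski_mul_self, mul_one, h.mul_inv]

/-- The inverse metric is B η Bᵀ with η = diag(−1, 1, 1, 1), so raising indices in coordinates is
raising them in the frame followed by a push-forward. -/
theorem raise_eq_push (h : L.FrameAt y B) (F : Tensor2) :
    Matrix.of (L.raise y F) =
      toC B * Matrix.of (minkowskiModel.raise 0 (pull B F)) * (toC B).transpose := by
  rw [raise_eq, raise_eq, pull_eq, h.gInvMat_eq, gInvMat_minkowskiModel]
  simp only [toC_mul, toC_transpose, Matrix.transpose_mul, Matrix.transpose_transpose, mul_assoc]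

theorem contract_raise (h : L.FrameAt y B) (F H : Tensor2) :
    contract F (L.raise y H) = contract (pull B F) (minkowskiModel.raise 0 (pull B H)) := by
  rw [← contract_push]
  exact congrArg (contract F) (h.raise_eq_push H)

theorem pairing (h : L.FrameAt y B) (F H : Tensor2) :
    L.pairing y F H = minkowskiModel.pairing 0 (pull B F) (pull B H) := by
  rw [pairing_eq, pairing_eq, h.contract_raise]

/-- Naturality of the action of double 2-forms. It is what allows pointwise identities to be checked
by components in the model. -/
theorem pull_act (h : L.FrameAt y B) (P : Tensor4) (F : Tensor2) :
    pull B (L.act y P F) = minkowskiModel.act 0 (pull4 B P) (pull B F) := by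
  have h1 : L.act y P F = fun α β =>
      1 / 2 * contract (pull B (P α β)) (minkowskiModel.raise 0 (pull B F)) := by
    funext α β
    rw [act_apply, h.contract_raise]
  rw [h1, pull_contract]
  rfl

theorem pull_g (h : L.FrameAt y B) :
    pull B (fun α β => (L.g y α β : ℂ)) = fun i j => (minkowski i j : ℂ) := by
  have : (toC B).transpose * toC (L.gMat y) * toC B = toC (Matrix.of minkowski) := by
    rw [← h.transpose_mul_gMat_mul]
    simp only [toC_mul, toC_transpose]
  exact this

/-- Contraction with four copies of B produces det B, which cancels the determinant of the coframe;
orientation of the coframe enters here. -/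
theorem pull4_eta (h : L.FrameAt y B) : pull4 B (L.eta y) = minkowskiModel.eta 0 := by
  funext i j k l
  simp only [pull4, pull_apply, eta, h.coframe.vol, minkowskiModel]
  have h1 := sum_leviCivita_mul B i j k l
  have h2 : B⁻¹.det * B.det = 1 := by rw [← Matrix.det_mul, h.inv_mul, Matrix.det_one]
  have h3 : ∑ α, ∑ β, B α i * B β j * ∑ μ, ∑ ν, B μ k * B ν l *
      (B⁻¹.det * leviCivita α β μ ν) = leviCivita i j k l := by
    calc _ = B⁻¹.det * ∑ α, ∑ β, ∑ μ, ∑ ν,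
          leviCivita α β μ ν * B α i * B β j * B μ k * B ν l := by
          simp only [Finset.mul_sum]
          refine Finset.sum_congr rfl fun _ _ => Finset.sum_congr rfl fun _ _ =>
            Finset.sum_congr rfl fun _ _ => Finset.sum_congr rfl fun _ _ => ?_
          ring
      _ = _ := by rw [h1, ← mul_assoc, h2, one_mul]
  have h4 := congrArg (fun r : ℝ => (r : ℂ)) h3
  push_cast at h4
  simpa using h4

theorem pull_U (h : L.FrameAt y B) :
    pull B (fun α β => (L.U y α β : ℂ)) = fun i j => (minkowskiModel.U 0 i j : ℂ) := by
  have h1 : ∀ i j, ∑ α, B⁻¹ i α * B α j = if i = j then 1 else 0 := fun i j => by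
    rw [← Matrix.mul_apply, h.inv_mul, Matrix.one_apply]
  have h2 : ∀ i j, ∑ α, ∑ β, B α i * B β j * L.U y α β = minkowskiModel.U 0 i j := by
    intro i j
    calc _ = (∑ α, B⁻¹ 1 α * B α i) * (∑ β, B⁻¹ 0 β * B β j) -
          (∑ α, B⁻¹ 0 α * B α i) * (∑ β, B⁻¹ 1 β * B β j) := by
          simp only [h.coframe.U, Finset.sum_mul_sum, ← Finset.sum_sub_distrib]
          refine Finset.sum_congr rfl fun _ _ => Finset.sum_congr rfl fun _ _ => ?_
          ring
      _ = _ := by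
          rw [h1, h1, h1, h1]
          fin_cases i <;> fin_cases j <;> simp [minkowskiModel]
  funext i j
  rw [pull_apply, ← h2]
  push_cast
  rfl

theorem pull_hodge (h : L.FrameAt y B) (F : Tensor2) :
    pull B (L.hodge y F) = minkowskiModel.hodge 0 (pull B F) := by
  rw [hodge, h.pull_act, h.pull4_eta, hodge]

theorem pull_calU (h : L.FrameAt y B) : pull B (L.calU y) = minkowskiModel.calU 0 := by
  rw [calU, map_smul, map_sub, map_smul, h.pull_hodge, h.pull_U, calU]

theorem pull4_add (B : Matrix (Fin 4) (Fin 4) ℝ) (P Q : Tensor4) :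
    pull4 B (fun α β μ ν => P α β μ ν + Q α β μ ν) =
      fun i j k l => pull4 B P i j k l + pull4 B Q i j k l := by
  funext i j k l
  simp only [pull4, pull_apply, mul_add, Finset.sum_add_distrib]

theorem pull4_const_mul (B : Matrix (Fin 4) (Fin 4) ℝ) (c : ℂ) (P : Tensor4) :
    pull4 B (fun α β μ ν => c * P α β μ ν) = fun i j k l => c * pull4 B P i j k l := by
  funext i j k l
  simp only [pull4, pull_apply, Finset.mul_sum]
  refine Finset.sum_congr rfl fun _ _ => Finset.sum_congr rfl fun _ _ =>
    Finset.sum_congr rfl fun _ _ => Finset.sum_congr rfl fun _ _ => ?_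
  ring

theorem pull4_tensor (B : Matrix (Fin 4) (Fin 4) ℝ) (F G : Tensor2) :
    pull4 B (fun α β μ ν => F α β * G μ ν) = fun i j k l => pull B F i j * pull B G k l := by
  funext i j k l
  have h1 : ∀ α β, pull B (fun μ ν => F α β * G μ ν) = F α β • pull B G := fun α β =>
    map_smul (pull B) (F α β) G
  have h2 : pull B (fun α β => pull B G k l * F α β) = pull B G k l • pull B F :=
    map_smul (pull B) (pull B G k l) F
  have h3 : pull4 B (fun α β μ ν => F α β * G μ ν) i j k l =
      pull B (fun α β => pull B G k l * F α β) i j := by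
    simp only [pull4, h1, Pi.smul_apply, smul_eq_mul, mul_comm]
  rw [h3, h2]
  exact mul_comm _ _

theorem pull4_tensor_mid (B : Matrix (Fin 4) (Fin 4) ℝ) (F G : Tensor2) :
    pull4 B (fun α β μ ν => F α μ * G β ν) = fun i j k l => pull B F i k * pull B G j l := by
  funext i j k l
  simp only [pull4, pull_apply]
  rw [Finset.sum_mul_sum]
  refine Finset.sum_congr rfl fun _ _ => Finset.sum_congr rfl fun _ _ => ?_
  rw [Finset.sum_mul_sum]
  simp only [Finset.mul_sum]
  refine Finset.sum_congr rfl fun _ _ => Finset.sum_congr rfl fun _ _ => ?_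
  ring

theorem pull4_tensor_cross (B : Matrix (Fin 4) (Fin 4) ℝ) (F G : Tensor2) :
    pull4 B (fun α β μ ν => F α ν * G β μ) = fun i j k l => pull B F i l * pull B G j k := by
  funext i j k l
  simp only [pull4, pull_apply]
  rw [Finset.sum_mul_sum]
  refine Finset.sum_congr rfl fun _ _ => Finset.sum_congr rfl fun _ _ => ?_
  rw [Finset.sum_mul_sum]
  simp only [Finset.mul_sum]
  rw [Finset.sum_comm]
  refine Finset.sum_congr rfl fun _ _ => Finset.sum_congr rfl fun _ _ => ?_
  ring

theorem pull4_calG (h : L.FrameAt y B) : pull4 B (L.calG y) = minkowskiModel.calG 0 := by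
  have h1 : L.calG y = fun α β μ ν => 1 / 2 * (((L.g y α μ : ℂ) * (L.g y β ν : ℂ) +
      (-1) * ((L.g y α ν : ℂ) * (L.g y β μ : ℂ))) + (-Complex.I) * L.eta y α β μ ν) := by
    funext α β μ ν
    simp only [calG]
    push_cast
    ring
  rw [h1, pull4_const_mul, pull4_add, pull4_add, pull4_const_mul, pull4_const_mul,
    pull4_tensor_mid B (fun α μ => (L.g y α μ : ℂ)) (fun α μ => (L.g y α μ : ℂ)),
    pull4_tensor_cross B (fun α μ => (L.g y α μ : ℂ)) (fun α μ => (L.g y α μ : ℂ)), h.pull_g,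
    h.pull4_eta]
  funext i j k l
  simp only [calG, minkowskiModel]
  push_cast
  ring

theorem pull4_calGperp (h : L.FrameAt y B) :
    pull4 B (L.calGperp y) = minkowskiModel.calGperp 0 := by
  unfold calGperp
  rw [pull4_add, pull4_tensor, h.pull4_calG, h.pull_calU]

theorem pull4_comp (h : L.FrameAt y B) (P Q : Tensor4) :
    pull4 B (L.comp y P Q) = minkowskiModel.comp 0 (pull4 B P) (pull4 B Q) := by
  funext i j k l
  have h1 : ∀ α β, pull B (fun ρ σ => L.comp y P Q α β ρ σ) k l =
      L.act y P (fun μ ν => pull B (Q μ ν) k l) α β := by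
    intro α β
    have h2 : (fun μ ν => pull B (Q μ ν) k l) = ∑ ρ, ∑ σ,
        ((B ρ k : ℂ) * (B σ l : ℂ)) • (fun μ ν => Q μ ν ρ σ : Tensor2) := by
      funext μ ν
      simp [pull_apply, Finset.sum_apply]
    rw [h2, pull_apply]
    simp [Finset.sum_apply, comp]
  have h3 : pull4 B (L.comp y P Q) i j k l =
      pull B (L.act y P (fun μ ν => pull B (Q μ ν) k l)) i j :=
    congrArg (fun F => pull B F i j) (funext fun α => funext fun β => h1 α β)
  rw [h3, h.pull_act]
  rfl

end FrameAt

end LocalFields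

/-! ## Covariant derivatives of complex tensors -/

theorem contract_add_left (F G X : Tensor2) :
    contract (fun α β => F α β + G α β) X = contract F X + contract G X := by
  simp only [contract, add_mul, Finset.sum_add_distrib]

theorem contract_add_right (F X Y : Tensor2) :
    contract F (fun α β => X α β + Y α β) = contract F X + contract F Y := by
  simp only [contract, mul_add, Finset.sum_add_distrib]

theorem contract_sum_left (c : Fin 4 → ℂ) (F : Fin 4 → Tensor2) (X : Tensor2) :
    contract (fun α β => ∑ l, c l * F l α β) X = ∑ l, c l * contract (F l) X := by
  simp only [contract, Finset.sum_mul, Finset.mul_sum, mul_assoc]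
  exact (Finset.sum_congr rfl fun _ _ => Finset.sum_comm).trans Finset.sum_comm

theorem contract_transpose_mul (A F X : Matrix (Fin 4) (Fin 4) ℂ) :
    contract (A.transpose * F : Matrix _ _ ℂ) X = contract F (A * X : Matrix _ _ ℂ) := by
  refine (contract_eq_trace _ _).trans (Eq.trans ?_ (contract_eq_trace _ _).symm)
  change (A.transpose * F * X.transpose).trace = (F * (A * X).transpose).trace
  rw [Matrix.transpose_mul, mul_assoc, Matrix.trace_mul_comm, mul_assoc]

theorem contract_mul (A F X : Matrix (Fin 4) (Fin 4) ℂ) :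
    contract (F * A : Matrix _ _ ℂ) X = contract F (X * A.transpose : Matrix _ _ ℂ) := by
  refine (contract_eq_trace _ _).trans (Eq.trans ?_ (contract_eq_trace _ _).symm)
  change (F * A * X.transpose).trace = (F * (X * A.transpose).transpose).trace
  rw [Matrix.transpose_mul, mul_assoc, Matrix.transpose_transpose]

theorem partialD_contract {y : Coord} {μ : Fin 4} {F X : Coord → Tensor2}
    (hF : DiffMatAt (fun z => Matrix.of (F z)) y) (hX : DiffMatAt (fun z => Matrix.of (X z)) y) :
    partialD μ (fun z => contract (F z) (X z)) y =
      contract (fun α β => partialD μ (fun z => F z α β) y) (X y) +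
        contract (F y) (fun α β => partialD μ (fun z => X z α β) y) := by
  have hd : ∀ i j, DifferentiableAt ℝ (fun z => F z i j * X z i j) y := fun i j =>
    (hF i j).fun_mul (hX i j)
  simp only [contract]
  rw [partialD_sum fun i _ => DifferentiableAt.fun_sum fun j _ => hd i j,
    ← Finset.sum_add_distrib]
  refine Finset.sum_congr rfl fun i _ => ?_
  rw [partialD_sum fun j _ => hd i j, ← Finset.sum_add_distrib]
  exact Finset.sum_congr rfl fun j _ => partialD_mul (hF i j) (hX i j)

namespace LocalFields

variable {L : LocalFields} {s : Set Coord} {y : Coord}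

/-- A 4-tensor field with vanishing covariant derivative at `y`. -/
structure IsParallelAt (L : LocalFields) (P : Coord → Tensor4) (y : Coord) : Prop where
  diff : ∀ α β γ δ, DifferentiableAt ℝ (fun z => P z α β γ δ) y
  eq : ∀ μ α β γ δ, partialD μ (fun z => P z α β γ δ) y =
    ∑ l, ((L.christoffel y l μ α : ℂ) * P y l β γ δ + (L.christoffel y l μ β : ℂ) * P y α l γ δ
      + (L.christoffel y l μ γ : ℂ) * P y α β l δ + (L.christoffel y l μ δ : ℂ) * P y α β γ l)

/-- The matrix form of the covariant derivative turns later index computations into identities in a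
noncommutative ring. -/
theorem covD2_eq_matD (L : LocalFields) (y : Coord) (F : Coord → Tensor2) (μ : Fin 4) :
    Matrix.of (L.covD2 y F μ) = matD μ (fun z => Matrix.of (F z)) y -
      (toC (L.chr μ y)).transpose * Matrix.of (F y) - Matrix.of (F y) * toC (L.chr μ y) := by
  ext α β
  simp only [covD2, matD, Matrix.sub_apply, Matrix.of_apply, Matrix.mul_apply,
    Matrix.transpose_apply, toC_apply, chr]
  congr 1
  exact Finset.sum_congr rfl fun _ _ => mul_comm _ _

theorem covD2_sub {F G : Coord → Tensor2} (hF : DiffMatAt (fun z => Matrix.of (F z)) y)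
    (hG : DiffMatAt (fun z => Matrix.of (G z)) y) (μ : Fin 4) :
    L.covD2 y (fun z => F z - G z) μ = L.covD2 y F μ - L.covD2 y G μ := by
  have h1 : Matrix.of (L.covD2 y (fun z => F z - G z) μ) =
      Matrix.of (L.covD2 y F μ) - Matrix.of (L.covD2 y G μ) := by
    have h2 := matD_sub (μ := μ) hF hG
    simp only [covD2_eq_matD]
    change matD μ (fun z => Matrix.of (F z) - Matrix.of (G z)) y -
      _ * (Matrix.of (F y) - Matrix.of (G y)) - (Matrix.of (F y) - Matrix.of (G y)) * _ = _
    rw [h2]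
    noncomm_ring
  exact h1

theorem covD2_const_smul {F : Coord → Tensor2} (hF : DiffMatAt (fun z => Matrix.of (F z)) y)
    (c : ℂ) (μ : Fin 4) : L.covD2 y (fun z => c • F z) μ = c • L.covD2 y F μ := by
  funext α β
  have h1 : partialD μ (fun z => (c • F z) α β) y = c * partialD μ (fun z => F z α β) y :=
    partialD_const_mul c (hF α β)
  simp only [covD2, h1]
  simp only [covD2, Pi.smul_apply, smul_eq_mul, mul_sub, Finset.mul_sum, mul_left_comm c]

namespace RegularOn

variable (h : L.RegularOn s) (hy : y ∈ s)
include h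

theorem smooth_raise {F : Coord → Tensor2} (hF : ∀ α β, ContDiffOn ℝ ∞ (fun z => F z α β) s)
    (α β : Fin 4) : ContDiffOn ℝ ∞ (fun z => L.raise z (F z) α β) s := by
  unfold raise
  exact ContDiffOn.sum fun _ _ => ContDiffOn.sum fun _ _ =>
    ((h.smooth_gInv _ _).ofReal.mul (h.smooth_gInv _ _).ofReal).mul (hF _ _)

theorem smooth_act {P : Coord → Tensor4} {F : Coord → Tensor2}
    (hP : ∀ α β γ δ, ContDiffOn ℝ ∞ (fun z => P z α β γ δ) s)
    (hF : ∀ α β, ContDiffOn ℝ ∞ (fun z => F z α β) s) (α β : Fin 4) :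
    ContDiffOn ℝ ∞ (fun z => L.act z (P z) (F z) α β) s := by
  simp only [act_apply, contract]
  exact contDiffOn_const.mul (ContDiffOn.sum fun _ _ => ContDiffOn.sum fun _ _ =>
    (hP _ _ _ _).mul (h.smooth_raise hF _ _))

theorem smooth_eta (α β γ δ : Fin 4) : ContDiffOn ℝ ∞ (fun z => L.eta z α β γ δ) s :=
  (h.smooth_vol α β γ δ).ofReal

theorem smooth_UC (α β : Fin 4) : ContDiffOn ℝ ∞ (fun z => (L.U z α β : ℂ)) s :=
  (h.smooth_U α β).ofReal

theorem smooth_hodge_U (α β : Fin 4) :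
    ContDiffOn ℝ ∞ (fun z => L.hodge z (fun μ ν => (L.U z μ ν : ℂ)) α β) s :=
  h.smooth_act h.smooth_eta h.smooth_UC α β

theorem smooth_calU (α β : Fin 4) : ContDiffOn ℝ ∞ (fun z => L.calU z α β) s :=
  contDiffOn_const.mul ((h.smooth_UC α β).sub (contDiffOn_const.mul (h.smooth_hodge_U α β)))

theorem smooth_covD2 {F : Coord → Tensor2} (hF : ∀ α β, ContDiffOn ℝ ∞ (fun z => F z α β) s)
    (μ α β : Fin 4) : ContDiffOn ℝ ∞ (fun z => L.covD2 z F μ α β) s := by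
  unfold covD2
  exact ((contDiffOn_partialD h.isOpen (hF α β)).sub (ContDiffOn.sum fun _ _ =>
    (h.smooth_christoffel _ _ _).ofReal.mul (hF _ _))).sub (ContDiffOn.sum fun _ _ =>
    (h.smooth_christoffel _ _ _).ofReal.mul (hF _ _))

theorem smooth_xi (γ : Fin 4) : ContDiffOn ℝ ∞ (fun z => L.xi z γ) s := by
  unfold xi codiff
  exact (ContDiffOn.sum fun _ _ => ContDiffOn.sum fun _ _ =>
    (h.smooth_gInv _ _).ofReal.mul (h.smooth_covD2 h.smooth_calU _ _ _)).neg

theorem smooth_chi (β : Fin 4) : ContDiffOn ℝ ∞ (fun z => L.chi z β) s := by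
  unfold chi
  exact ContDiffOn.sum fun _ _ => ContDiffOn.sum fun _ _ =>
    ((h.smooth_gInv _ _).ofReal.mul (h.smooth_xi _)).mul (h.smooth_calU _ _)

include hy

theorem partialD_g (μ α β : Fin 4) : partialD μ (fun z => L.g z α β) y =
    ∑ l, (L.christoffel y l μ α * L.g y l β + L.christoffel y l μ β * L.g y α l) := by
  have h1 := congrFun (congrFun (h.matD_g hy μ) α) β
  rw [Finset.sum_add_distrib]
  refine h1.trans ?_
  rw [Matrix.add_apply, Matrix.mul_apply, Matrix.mul_apply]
  congr 1
  exact Finset.sum_congr rfl fun _ _ => mul_comm _ _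

theorem isParallelAt_eta : L.IsParallelAt L.eta y where
  diff α β γ δ := (h.smooth_eta α β γ δ).differentiableAt_of_isOpen h.isOpen hy
  eq μ α β γ δ := by
    refine (partialD_ofReal ((h.smooth_vol α β γ δ).differentiableAt_of_isOpen h.isOpen hy)).trans ?_
    rw [h.partialD_vol hy]
    push_cast
    rfl

theorem isParallelAt_calG : L.IsParallelAt L.calG y := by
  have hg : ∀ α β, DifferentiableAt ℝ (fun z => L.g z α β) y := fun α β =>
    (h.smooth_g α β).differentiableAt_of_isOpen h.isOpen hy
  have hgg : ∀ α β μ ν, DifferentiableAt ℝ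
      (fun z => L.g z α μ * L.g z β ν - L.g z α ν * L.g z β μ) y := fun α β μ ν =>
    ((hg _ _).fun_mul (hg _ _)).fun_sub ((hg _ _).fun_mul (hg _ _))
  have hggC : ∀ α β μ ν, DifferentiableAt ℝ (fun z =>
      ((L.g z α μ * L.g z β ν - L.g z α ν * L.g z β μ : ℝ) : ℂ)) y := fun α β μ ν =>
    Complex.ofRealCLM.differentiableAt.comp y (hgg α β μ ν)
  have he := (h.isParallelAt_eta hy).diff
  have hd : ∀ α β μ ν, DifferentiableAt ℝ (fun z =>
      ((L.g z α μ * L.g z β ν - L.g z α ν * L.g z β μ : ℝ) : ℂ)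
        - Complex.I * L.eta z α β μ ν) y := fun α β μ ν =>
    (hggC α β μ ν).fun_sub ((he α β μ ν).const_mul _)
  refine ⟨fun α β γ δ => (hd α β γ δ).const_mul _, fun κ α β μ ν => ?_⟩
  simp only [calG]
  rw [partialD_const_mul _ (hd α β μ ν), partialD_sub (hggC α β μ ν) ((he α β μ ν).const_mul _),
    partialD_const_mul _ (he α β μ ν), (h.isParallelAt_eta hy).eq, partialD_ofReal (hgg α β μ ν),
    partialD_sub ((hg _ _).fun_mul (hg _ _)) ((hg _ _).fun_mul (hg _ _)),
    partialD_mul (hg _ _) (hg _ _), partialD_mul (hg _ _) (hg _ _), h.partialD_g hy,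
    h.partialD_g hy, h.partialD_g hy, h.partialD_g hy]
  push_cast
  simp only [Finset.sum_mul, Finset.mul_sum, ← Finset.sum_add_distrib, ← Finset.sum_sub_distrib]
  exact Finset.sum_congr rfl fun l _ => by ring

/-- Raising indices commutes with ∇ because the inverse metric is parallel; the two Christoffel
terms are those of a contravariant 2-tensor. -/
theorem covD2_raise {F : Coord → Tensor2} (hF : DiffMatAt (fun z => Matrix.of (F z)) y)
    (μ : Fin 4) : matD μ (fun z => Matrix.of (L.raise z (F z))) y =
      Matrix.of (L.raise y (L.covD2 y F μ)) - toC (L.chr μ y) * Matrix.of (L.raise y (F y)) -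
        Matrix.of (L.raise y (F y)) * (toC (L.chr μ y)).transpose := by
  have hGr := h.smoothMat_gInv.diffMatAt h.isOpen hy
  have hG : DiffMatAt (fun z => toC (L.gInvMat z)) y :=
    h.smoothMat_gInv.ofReal.diffMatAt h.isOpen hy
  have hdG : matD μ (fun z => toC (L.gInvMat z)) y = -(toC (L.chr μ y) * toC (L.gInvMat y)) -
      toC (L.gInvMat y) * (toC (L.chr μ y)).transpose := by
    have := congrArg toC (h.matD_gInv hy μ)
    rw [toC_sub, toC_neg, toC_mul, toC_mul, toC_transpose] at this
    rw [← this]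
    exact matD_ofReal hGr
  have hGF := hG.mul hF
  simp only [raise_eq]
  rw [matD_mul hGF hG.transpose, matD_mul hG hF, matD_transpose, hdG, covD2_eq_matD]
  simp only [Matrix.transpose_sub, Matrix.transpose_neg, Matrix.transpose_mul,
    Matrix.transpose_transpose]
  noncomm_ring

theorem diffMatAt_raise {F : Coord → Tensor2} (hF : DiffMatAt (fun z => Matrix.of (F z)) y) :
    DiffMatAt (fun z => Matrix.of (L.raise z (F z))) y := by
  have hG : DiffMatAt (fun z => toC (L.gInvMat z)) y :=
    h.smoothMat_gInv.ofReal.diffMatAt h.isOpen hy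
  simp only [raise_eq]
  exact (hG.mul hF).mul hG.transpose

/-- Parallel double 2-forms commute with the covariant derivative. -/
theorem covD2_act {P : Coord → Tensor4} (hP : L.IsParallelAt P y) {F : Coord → Tensor2}
    (hF : DiffMatAt (fun z => Matrix.of (F z)) y) (μ : Fin 4) :
    L.covD2 y (fun z => L.act z (P z) (F z)) μ = L.act y (P y) (L.covD2 y F μ) := by
  funext α β
  have hX := h.diffMatAt_raise hy hF
  have hPd : DiffMatAt (fun z => Matrix.of (P z α β)) y := hP.diff α β
  have hc : DifferentiableAt ℝ (fun z => contract (P z α β) (L.raise z (F z))) y :=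
    DifferentiableAt.fun_sum fun i _ => DifferentiableAt.fun_sum fun j _ =>
      (hPd i j).fun_mul (hX i j)
  set Γ := toC (L.chr μ y) with hΓ
  set E : Matrix (Fin 4) (Fin 4) ℂ := Matrix.of (P y α β) with hE
  set X : Matrix (Fin 4) (Fin 4) ℂ := Matrix.of (L.raise y (F y)) with hXd
  -- Y collects the Christoffel terms from the derivative of the raised field, and D those from the
  -- derivative of the contracted index pair of P.
  obtain ⟨Y, hY⟩ : ∃ Y : Tensor2, Y = (-(Γ * X) - X * Γ.transpose : Matrix _ _ ℂ) := ⟨_, rfl⟩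
  obtain ⟨D, hD⟩ : ∃ D : Tensor2, D = (Γ.transpose * E + E * Γ : Matrix _ _ ℂ) := ⟨_, rfl⟩
  obtain ⟨c, hcΓ⟩ : ∃ c : Fin 4 → Fin 4 → ℂ, ∀ l κ, c l κ = (L.christoffel y l μ κ : ℂ) :=
    ⟨_, fun _ _ => rfl⟩
  have h1 : (fun γ δ => partialD μ (fun z => L.raise z (F z) γ δ) y : Tensor2) =
      (fun γ δ => L.raise y (L.covD2 y F μ) γ δ + Y γ δ) := by
    funext γ δ
    rw [hY]
    have := congrFun (congrFun (h.covD2_raise hy hF μ) γ) δ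
    refine this.trans ?_
    simp only [Matrix.sub_apply, Matrix.neg_apply, Matrix.of_apply]
    ring
  have h2 : (fun γ δ => partialD μ (fun z => P z α β γ δ) y : Tensor2) =
      (fun γ δ => ((∑ l, c l α * P y l β γ δ) + (∑ l, c l β * P y α l γ δ)) + D γ δ) := by
    funext γ δ
    rw [hP.eq, hD]
    simp only [Finset.sum_add_distrib, Matrix.add_apply, Matrix.mul_apply, Matrix.transpose_apply,
      hΓ, hE, toC_apply, chr, Matrix.of_apply, hcΓ]
    rw [add_assoc]
    congr 2
    exact Finset.sum_congr rfl fun _ _ => mul_comm _ _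
  -- Christoffel terms on contracted indices cancel: the covariant and the contravariant
  -- contributions are adjoint with opposite signs.
  have h3 : contract D (L.raise y (F y)) + contract (P y α β) Y = 0 := by
    rw [hD, hY]
    change contract (Γ.transpose * E + E * Γ : Matrix _ _ ℂ) X +
      contract E (-(Γ * X) - X * Γ.transpose : Matrix _ _ ℂ) = 0
    have e1 : contract (Γ.transpose * E + E * Γ : Matrix _ _ ℂ) X = _ := contract_add_left _ _ _
    have e2 : contract E (-(Γ * X) - X * Γ.transpose : Matrix _ _ ℂ) =
        -(contract E (Γ * X : Matrix _ _ ℂ) + contract E (X * Γ.transpose : Matrix _ _ ℂ)) := by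
      simp only [contract, Matrix.sub_apply, Matrix.neg_apply, mul_sub, mul_neg,
        Finset.sum_sub_distrib, Finset.sum_neg_distrib]
      ring
    have e3 := contract_transpose_mul Γ E X
    have e4 := contract_mul Γ E X
    rw [e1, e2, ← e3, ← e4]
    exact add_neg_cancel _
  simp only [covD2, act_apply]
  rw [partialD_const_mul _ hc, partialD_contract hPd hX, h1, h2, contract_add_left,
    contract_add_left, contract_add_right, contract_sum_left (fun l => c l α),
    contract_sum_left (fun l => c l β)]
  simp only [← hcΓ, mul_left_comm _ (1 / 2 : ℂ), ← Finset.mul_sum]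
  linear_combination (1 / 2 : ℂ) * h3

/-- The covariant derivative of the canonical 2-form. -/
theorem covD2_U (μ α β : Fin 4) :
    L.covD2 y (fun z α β => (L.U z α β : ℂ)) μ α β =
      ((matD μ L.uMat y - (L.chr μ y).transpose * L.uMat y - L.uMat y * L.chr μ y) α β : ℝ) := by
  have h1 := covD2_eq_matD L y (fun z α β => (L.U z α β : ℂ)) μ
  have h2 : matD μ (fun z => Matrix.of fun α β => (L.U z α β : ℂ)) y = toC (matD μ L.uMat y) :=
    matD_ofReal (h.smoothMat_u.diffMatAt h.isOpen hy)
  have h3 : Matrix.of (fun α β => (L.U y α β : ℂ)) = toC (L.uMat y) := rfl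
  rw [h2, h3, ← toC_transpose, ← toC_mul, ← toC_mul, ← toC_sub, ← toC_sub] at h1
  exact congrFun (congrFun h1 α) β

theorem covD2_calU (μ : Fin 4) :
    L.covD2 y L.calU μ = ((1 / √2 : ℝ) : ℂ) • (L.covD2 y (fun z α β => (L.U z α β : ℂ)) μ -
      Complex.I • L.hodge y (L.covD2 y (fun z α β => (L.U z α β : ℂ)) μ)) := by
  have hU : DiffMatAt (fun z => Matrix.of fun α β => (L.U z α β : ℂ)) y := fun α β =>
    (h.smooth_UC α β).differentiableAt_of_isOpen h.isOpen hy
  have hH : DiffMatAt (fun z => Matrix.of (L.hodge z fun α β => (L.U z α β : ℂ))) y := fun α β =>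
    (h.smooth_hodge_U α β).differentiableAt_of_isOpen h.isOpen hy
  have hIH : DiffMatAt
      (fun z => Matrix.of (Complex.I • L.hodge z fun α β => (L.U z α β : ℂ))) y := fun α β =>
    (hH α β).const_mul _
  have hs : DiffMatAt (fun z => Matrix.of ((fun α β => (L.U z α β : ℂ)) -
      Complex.I • L.hodge z fun α β => (L.U z α β : ℂ))) y := fun α β =>
    (hU α β).fun_sub (hIH α β)
  have h1 : L.covD2 y (fun z => L.hodge z fun α β => (L.U z α β : ℂ)) μ = _ :=
    h.covD2_act hy (h.isParallelAt_eta hy) hU μ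
  have h2 : L.covD2 y L.calU μ = _ := covD2_const_smul hs _ μ
  rw [h2, covD2_sub hU hIH, covD2_const_smul hH, h1]
  rfl

end RegularOn

end LocalFields

/-! ## Umbilical structures in an adapted frame -/

namespace LocalFields

/-- The matrix of the canonical 2-form in an adapted frame. -/
def uHat : Matrix (Fin 4) (Fin 4) ℝ := Matrix.of (minkowskiModel.U 0)

/-- The matrix of the projector on the time-like plane in an adapted frame. -/
def pHat : Matrix (Fin 4) (Fin 4) ℝ := Matrix.diagonal ![1, 1, 0, 0]

/-- The matrix of the projector on the space-like plane in an adapted frame. -/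
def qHat : Matrix (Fin 4) (Fin 4) ℝ := Matrix.diagonal ![0, 0, 1, 1]

theorem pHat_eq : Matrix.of minkowski * uHat * Matrix.of minkowski * uHat = pHat := by
  rw [minkowski_eq_diagonal]
  ext i j
  fin_cases i <;> fin_cases j <;>
    simp [Matrix.mul_apply, Fin.sum_univ_four, uHat, minkowskiModel, pHat]

theorem one_sub_pHat : 1 - pHat = qHat := by
  rw [pHat, qHat, ← Matrix.diagonal_one, Matrix.diagonal_sub]
  congr 1
  ext i
  fin_cases i <;> simp

theorem uHat_mul_pHat : uHat * pHat = uHat := by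
  ext i j
  fin_cases i <;> fin_cases j <;> simp [uHat, minkowskiModel, pHat]

/-- The covariant derivative of the canonical 2-form. -/
def nablaU (L : LocalFields) (μ : Fin 4) (y : Coord) : Matrix (Fin 4) (Fin 4) ℝ :=
  matD μ L.uMat y - (L.chr μ y).transpose * L.uMat y - L.uMat y * L.chr μ y

theorem matD_u (L : LocalFields) (y : Coord) (μ : Fin 4) : matD μ L.uMat y =
    L.nablaU μ y + (L.chr μ y).transpose * L.uMat y + L.uMat y * L.chr μ y := by
  simp only [nablaU]
  abel

variable {L : LocalFields} {s : Set Coord} {y : Coord} {B : Matrix (Fin 4) (Fin 4) ℝ}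

theorem secondForm_eq (L : LocalFields) (y : Coord) (p q : Coord → Fin 4 → Fin 4 → ℝ)
    (α β γ : Fin 4) : L.secondForm y p q α β γ =
      ∑ μ, p y μ α * (Matrix.of (q y) *
        (matD μ (fun z => Matrix.of (p z)) y + L.chr μ y * Matrix.of (p y))) γ β := by
  simp only [secondForm, Matrix.mul_apply, Matrix.add_apply, matD, Matrix.of_apply, chr,
    Finset.mul_sum]
  rw [Finset.sum_comm]
  refine Finset.sum_congr rfl fun _ _ => Finset.sum_congr rfl fun _ _ => ?_
  ring

theorem projV_eq (L : LocalFields) (y : Coord) :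
    Matrix.of (L.projV y) = L.gInvMat y * L.uMat y * (L.gInvMat y * L.uMat y) := by
  ext α β
  simp only [projV, Matrix.mul_apply, Matrix.of_apply, gInvMat_apply, uMat, Finset.sum_mul,
    Finset.mul_sum]
  rw [Finset.sum_comm]
  refine Finset.sum_congr rfl fun ν _ => ?_
  rw [Finset.sum_comm]
  refine Finset.sum_congr rfl fun _ _ => Finset.sum_congr rfl fun _ _ => ?_
  ring

theorem projH_eq (L : LocalFields) (y : Coord) :
    Matrix.of (L.projH y) = 1 - Matrix.of (L.projV y) := by
  ext α β
  simp [projH, Matrix.one_apply]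

namespace FrameAt

theorem uMat_eq (h : L.FrameAt y B) : B.transpose * L.uMat y * B = uHat :=
  toC_injective (by
    rw [toC_mul, toC_mul, toC_transpose]
    exact h.pull_U)

theorem uMat_eq_coframe (h : L.FrameAt y B) : L.uMat y = B⁻¹.transpose * uHat * B⁻¹ := by
  have h1 : B⁻¹.transpose * B.transpose = 1 := by
    rw [← Matrix.transpose_mul, h.mul_inv, Matrix.transpose_one]
  rw [← h.uMat_eq, ← mul_assoc, ← mul_assoc, h1, one_mul, mul_assoc, h.mul_inv, mul_one]

theorem transpose_mul_inv (h : L.FrameAt y B) : B.transpose * B⁻¹.transpose = 1 := by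
  rw [← Matrix.transpose_mul, h.inv_mul, Matrix.transpose_one]

theorem gInv_mul_uMat (h : L.FrameAt y B) :
    L.gInvMat y * L.uMat y = B * (Matrix.of minkowski * uHat) * B⁻¹ := by
  rw [h.gInvMat_eq, h.uMat_eq_coframe]
  calc _ = B * Matrix.of minkowski * (B.transpose * B⁻¹.transpose) * uHat * B⁻¹ := by
        simp only [mul_assoc]
    _ = _ := by rw [h.transpose_mul_inv]; simp only [mul_assoc, mul_one]

theorem projV_eq (h : L.FrameAt y B) : Matrix.of (L.projV y) = B * pHat * B⁻¹ := by
  rw [LocalFields.projV_eq, h.gInv_mul_uMat, ← pHat_eq]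
  calc _ = B * (Matrix.of minkowski * uHat) * (B⁻¹ * B) * (Matrix.of minkowski * uHat) * B⁻¹ := by
        simp only [mul_assoc]
    _ = _ := by rw [h.inv_mul]; simp only [mul_assoc, mul_one]

theorem projH_eq (h : L.FrameAt y B) : Matrix.of (L.projH y) = B * qHat * B⁻¹ := by
  rw [LocalFields.projH_eq, h.projV_eq, ← one_sub_pHat, mul_sub, sub_mul, mul_one, h.mul_inv]

theorem uMat_mul_projV (h : L.FrameAt y B) : L.uMat y * Matrix.of (L.projV y) = L.uMat y := by
  rw [h.projV_eq, h.uMat_eq_coframe]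
  calc _ = B⁻¹.transpose * uHat * (B⁻¹ * B) * pHat * B⁻¹ := by simp only [mul_assoc]
    _ = B⁻¹.transpose * (uHat * pHat) * B⁻¹ := by
        rw [h.inv_mul]; simp only [mul_assoc, mul_one]
    _ = _ := by rw [uHat_mul_pHat]

/-- This is U³ = U with indices lowered. It encodes that U is the volume form of a plane, and its
derivative constrains ∇U. -/
theorem uMat_cubic (h : L.FrameAt y B) :
    L.uMat y * L.gInvMat y * L.uMat y * L.gInvMat y * L.uMat y = L.uMat y := by
  conv_rhs => rw [← h.uMat_mul_projV, LocalFields.projV_eq]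
  simp only [mul_assoc]

end FrameAt

namespace RegularOn

variable (h : L.RegularOn s) (hy : y ∈ s)
include h

theorem exists_frameAt (hy : y ∈ s) : ∃ B, L.FrameAt y B := by
  obtain ⟨C, hC⟩ := h.exists_coframeAt y hy
  exact ⟨_, hC.frameAt⟩

include hy

theorem nablaU_transpose (μ : Fin 4) : (L.nablaU μ y).transpose = -L.nablaU μ y := by
  obtain ⟨C, hC⟩ := h.exists_coframeAt y hy
  have h1 : matD μ (fun z => (L.uMat z).transpose) y = -matD μ L.uMat y := by
    have h2 := h.smoothMat_u.diffMatAt h.isOpen hy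
    have h3 := matD_sub (μ := μ) (h2.sub h2) h2
    have h4 : matD μ (fun z => L.uMat z - L.uMat z) y = 0 := by
      rw [matD_sub h2 h2, sub_self]
    rw [h4, zero_sub] at h3
    rw [← h3]
    refine matD_congr h.isOpen hy fun z hz => ?_
    obtain ⟨C, hC⟩ := h.exists_coframeAt z hz
    rw [hC.uMat_transpose, sub_self, zero_sub]
  rw [matD_transpose] at h1
  simp only [nablaU, Matrix.transpose_sub, Matrix.transpose_mul, Matrix.transpose_transpose, h1,
    hC.uMat_transpose]
  noncomm_ring

theorem matD_gInv_mul_u (μ : Fin 4) : matD μ (fun z => L.gInvMat z * L.uMat z) y =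
    L.gInvMat y * L.nablaU μ y - L.chr μ y * (L.gInvMat y * L.uMat y) +
      L.gInvMat y * L.uMat y * L.chr μ y := by
  rw [matD_mul (h.smoothMat_gInv.diffMatAt h.isOpen hy) (h.smoothMat_u.diffMatAt h.isOpen hy),
    h.matD_gInv hy, matD_u]
  noncomm_ring

/-- The covariant derivative of U³ = U. The Christoffel terms assemble into multiples of U − U³ and
disappear. -/
theorem nablaU_cubic (μ : Fin 4) :
    L.nablaU μ y * L.gInvMat y * L.uMat y * L.gInvMat y * L.uMat y +
      L.uMat y * L.gInvMat y * L.nablaU μ y * L.gInvMat y * L.uMat y +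
      L.uMat y * L.gInvMat y * L.uMat y * L.gInvMat y * L.nablaU μ y = L.nablaU μ y := by
  obtain ⟨B, hB⟩ := h.exists_frameAt hy
  have hu := h.smoothMat_u.diffMatAt h.isOpen hy
  have hgu := (h.smoothMat_gInv.mul h.smoothMat_u).diffMatAt h.isOpen hy
  have h1 : matD μ (fun z => L.uMat z * (L.gInvMat z * L.uMat z) * (L.gInvMat z * L.uMat z)) y =
      matD μ L.uMat y := matD_congr h.isOpen hy fun z hz => by
    obtain ⟨B, hB⟩ := h.exists_frameAt hz
    conv_rhs => rw [← hB.uMat_cubic]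
    simp only [mul_assoc]
  rw [matD_mul (hu.mul hgu) hgu, matD_mul hu hgu, h.matD_gInv_mul_u hy, matD_u] at h1
  have h2 := hB.uMat_cubic
  set u := L.uMat y
  set G := L.gInvMat y
  set N := L.nablaU μ y
  set Γ := L.chr μ y
  have h3 : N * G * u * G * u + u * G * N * G * u + u * G * u * G * N =
      N + Γ.transpose * (u - u * G * u * G * u) + (u - u * G * u * G * u) * Γ := by
    rw [← sub_eq_zero] at h1 ⊢
    rw [← h1]
    noncomm_ring
  rw [h3, h2, sub_self, mul_zero, zero_mul, add_zero, add_zero]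

/-- Write v = W² with W = g⁻¹U, so that ∇v = (∇W)W + W(∇W). The second term is killed by h, since hW
= W − W³ = 0. -/
theorem projH_mul_matD_projV (μ : Fin 4) : Matrix.of (L.projH y) *
    (matD μ (fun z => Matrix.of (L.projV z)) y + L.chr μ y * Matrix.of (L.projV y)) =
      Matrix.of (L.projH y) * (L.gInvMat y * L.nablaU μ y * (L.gInvMat y * L.uMat y)) := by
  obtain ⟨B, hB⟩ := h.exists_frameAt hy
  have hgu := (h.smoothMat_gInv.mul h.smoothMat_u).diffMatAt h.isOpen hy
  have h2 : L.gInvMat y * L.uMat y * (L.gInvMat y * L.uMat y) * (L.gInvMat y * L.uMat y) =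
      L.gInvMat y * L.uMat y := by
    conv_rhs => rw [← hB.uMat_cubic]
    simp only [mul_assoc]
  simp only [LocalFields.projH_eq, LocalFields.projV_eq]
  rw [matD_mul hgu hgu, h.matD_gInv_mul_u hy]
  generalize L.gInvMat y * L.uMat y = W at *
  generalize L.gInvMat y * L.nablaU μ y = K at *
  generalize L.chr μ y = Γ at *
  have h3 : (W - W * W * W) * (K + W * Γ) = 0 := by
    rw [h2, sub_self, zero_mul]
  rw [← sub_eq_zero, ← h3]
  noncomm_ring

/-- Here ∇h = −∇v, and both terms of ∇(W²), where W = g⁻¹U, survive projection on V; the second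
simplifies by vW = W. -/
theorem projV_mul_matD_projH (μ : Fin 4) : Matrix.of (L.projV y) *
    (matD μ (fun z => Matrix.of (L.projH z)) y + L.chr μ y * Matrix.of (L.projH y)) =
      -(Matrix.of (L.projV y) * (L.gInvMat y * L.nablaU μ y * (L.gInvMat y * L.uMat y)) +
        L.gInvMat y * L.uMat y * (L.gInvMat y * L.nablaU μ y)) := by
  obtain ⟨B, hB⟩ := h.exists_frameAt hy
  have hgu := (h.smoothMat_gInv.mul h.smoothMat_u).diffMatAt h.isOpen hy
  have h2 : L.gInvMat y * L.uMat y * (L.gInvMat y * L.uMat y) * (L.gInvMat y * L.uMat y) =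
      L.gInvMat y * L.uMat y := by
    conv_rhs => rw [← hB.uMat_cubic]
    simp only [mul_assoc]
  simp only [LocalFields.projH_eq, LocalFields.projV_eq]
  have h1 : DiffMatAt (fun _ : Coord => (1 : Matrix (Fin 4) (Fin 4) ℝ)) y := fun i j =>
    differentiableAt_const _
  rw [matD_sub h1 (hgu.mul hgu), matD_const, zero_sub, matD_mul hgu hgu,
    h.matD_gInv_mul_u hy]
  generalize L.gInvMat y * L.uMat y = W at *
  generalize L.gInvMat y * L.nablaU μ y = K at *
  generalize L.chr μ y = Γ at *
  have h3 : (W - W * W * W) * (K + W * Γ) = 0 := by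
    rw [h2, sub_self, zero_mul]
  rw [← sub_eq_zero, ← h3]
  noncomm_ring

end RegularOn

/-- The covariant derivative of the canonical 2-form in the frame with matrix `B`. -/
def nablaHat (L : LocalFields) (y : Coord) (B : Matrix (Fin 4) (Fin 4) ℝ) (k : Fin 4) :
    Matrix (Fin 4) (Fin 4) ℝ :=
  ∑ μ, B μ k • (B.transpose * L.nablaU μ y * B)

/-- Umbilicity of one plane, read in the frame. Its later use is to say that the symmetrised form is
proportional to the metric of the plane with some coefficient vector H; H itself is then eliminated.
-/
theorem FrameAt.frame_umbilical (hB : L.FrameAt y B) {p q : Coord → Fin 4 → Fin 4 → ℝ}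
    {ph : Matrix (Fin 4) (Fin 4) ℝ} (hp : Matrix.of (p y) = B * ph * B⁻¹)
    (A : Fin 4 → Matrix (Fin 4) (Fin 4) ℝ)
    (hA : ∀ μ, Matrix.of (q y) *
      (matD μ (fun z => Matrix.of (p z)) y + L.chr μ y * Matrix.of (p y)) = A μ)
    (hU : L.UmbilicalPlaneAt y p q) :
    ∃ H : Fin 4 → ℝ, ∀ i j c,
      ∑ k, ph k i * (∑ μ, B μ k • (B⁻¹ * A μ * B)) c j +
        ∑ k, ph k j * (∑ μ, B μ k • (B⁻¹ * A μ * B)) c i =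
      (Matrix.of minkowski * ph) i j * H c := by
  refine ⟨fun c => ∑ γ, B⁻¹ c γ * ∑ μ, ∑ ν, L.gInv y μ ν * L.symForm y p q μ ν γ,
    fun i j c => ?_⟩
  set t : Fin 4 → ℝ := fun γ => ∑ μ, ∑ ν, L.gInv y μ ν * L.symForm y p q μ ν γ with ht
  set X : Matrix (Fin 4) (Fin 4) ℝ := Matrix.of fun α β => ∑ γ, B⁻¹ c γ *
    L.secondForm y p q α β γ with hX
  have h1 : X + X.transpose = (∑ γ, B⁻¹ c γ * t γ) • (L.gMat y * Matrix.of (p y)) := by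
    ext α β
    simp only [hX, Matrix.add_apply, Matrix.of_apply, Matrix.transpose_apply, Matrix.smul_apply,
      smul_eq_mul, Finset.sum_mul, ← Finset.sum_add_distrib]
    refine Finset.sum_congr rfl fun γ _ => ?_
    have h2 := hU α β γ
    simp only [symForm] at h2
    have h3 : (L.gMat y * Matrix.of (p y)) α β = ∑ μ, L.g y α μ * p y μ β := rfl
    rw [h3]
    have h4 : t γ = ∑ μ, ∑ ν, L.gInv y μ ν * (1 / 2 * (L.secondForm y p q μ ν γ +
      L.secondForm y p q ν μ γ)) := rfl
    rw [← h4] at h2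
    linear_combination 2 * B⁻¹ c γ * h2
  have hS : ∀ α β γ, L.secondForm y p q α β γ = ∑ μ, p y μ α * A μ γ β := fun α β γ => by
    rw [secondForm_eq]
    simp only [hA]
  have h5 : ∀ i j, (B.transpose * X * B) i j =
      ∑ k, ph k i * (∑ μ, B μ k • (B⁻¹ * A μ * B)) c j := by
    intro i j
    have h6 : X * B = Matrix.of fun α j => ∑ μ, p y μ α * (B⁻¹ * A μ * B) c j := by
      ext α j
      simp only [hX, Matrix.mul_apply (M := Matrix.of _), Matrix.of_apply, hS]
      simp only [Matrix.mul_apply, Finset.sum_mul, Finset.mul_sum]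
      rw [Finset.sum_congr rfl fun _ _ => Finset.sum_comm, Finset.sum_comm]
      refine Finset.sum_congr rfl fun _ _ => Finset.sum_congr rfl fun _ _ =>
        Finset.sum_congr rfl fun _ _ => ?_
      ring
    have h7 : ∀ μ, ∑ α, p y μ α * B α i = ∑ k, B μ k * ph k i := fun μ => by
      have h8 : Matrix.of (p y) * B = B * ph := by rw [hp, mul_assoc, hB.inv_mul, mul_one]
      exact congrFun (congrFun h8 μ) i
    rw [mul_assoc, h6]
    simp only [Matrix.mul_apply (M := B.transpose), Matrix.transpose_apply, Matrix.of_apply,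
      Matrix.sum_apply, Matrix.smul_apply, smul_eq_mul]
    calc _ = ∑ μ, (∑ α, p y μ α * B α i) * (B⁻¹ * A μ * B) c j := by
          simp only [Finset.mul_sum, Finset.sum_mul]
          rw [Finset.sum_comm]
          refine Finset.sum_congr rfl fun _ _ => Finset.sum_congr rfl fun _ _ => ?_
          ring
      _ = _ := by
          simp only [h7, Finset.mul_sum, Finset.sum_mul]
          rw [Finset.sum_comm]
          refine Finset.sum_congr rfl fun _ _ => Finset.sum_congr rfl fun _ _ => ?_
          ring
  have h9 : (B.transpose * X * B) i j + (B.transpose * X * B) j i =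
      (Matrix.of minkowski * ph) i j * ∑ γ, B⁻¹ c γ * t γ := by
    have h10 : (B.transpose * X * B) j i = (B.transpose * X.transpose * B) i j := by
      rw [← Matrix.transpose_apply (B.transpose * X * B)]
      simp only [Matrix.transpose_mul, Matrix.transpose_transpose, mul_assoc]
    rw [h10, ← Matrix.add_apply, ← add_mul, ← mul_add, h1, Matrix.mul_smul, Matrix.smul_mul,
      Matrix.smul_apply, smul_eq_mul, mul_comm]
    congr 2
    rw [hp, ← hB.transpose_mul_gMat_mul]
    simp only [mul_assoc, hB.inv_mul, mul_one]
  rw [← h5, ← h5, h9]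

end LocalFields

/-! ## The first structure equation -/

namespace LocalFields

variable {L : LocalFields} {s : Set Coord} {y : Coord} {B : Matrix (Fin 4) (Fin 4) ℝ}

/-- The components of a 1-form in the frame with matrix `B`. -/
def pullv (B : Matrix (Fin 4) (Fin 4) ℝ) (x : Fin 4 → ℂ) (i : Fin 4) : ℂ := ∑ α, (B α i : ℂ) * x α

theorem pullv_injective (h : L.FrameAt y B) {x x' : Fin 4 → ℂ} (hx : pullv B x = pullv B x') :
    x = x' := by
  have h1 : ∀ x, pullv B x = (toC B).transpose.mulVec x := fun x => rfl
  have h2 : (toC B⁻¹).transpose * (toC B).transpose = 1 := by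
    rw [← Matrix.transpose_mul, h.toC_mul_inv, Matrix.transpose_one]
  have h3 := congrArg (toC B⁻¹).transpose.mulVec hx
  simpa [h1, h2] using h3

theorem FrameAt.sum_gInv (h : L.FrameAt y B) (F : Tensor2) :
    ∑ α, ∑ β, (L.gInv y α β : ℂ) * F α β = ∑ k, (minkowski k k : ℂ) * pull B F k k := by
  have h1 : ∀ α β, (L.gInv y α β : ℂ) = ∑ k, (minkowski k k : ℂ) * ((B α k : ℂ) * (B β k : ℂ)) := by
    intro α β
    have h2 := congrFun (congrFun h.gInvMat_eq α) β
    rw [minkowski_eq_diagonal, Matrix.mul_apply] at h2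
    rw [← gInvMat_apply, h2]
    simp [Fin.sum_univ_four, minkowski, Matrix.diagonal_apply, Matrix.mul_apply]
  simp only [h1, pull_apply, Finset.mul_sum, Finset.sum_mul]
  rw [Finset.sum_congr rfl fun _ _ => Finset.sum_comm, Finset.sum_comm]
  refine Finset.sum_congr rfl fun _ _ => Finset.sum_congr rfl fun _ _ =>
    Finset.sum_congr rfl fun _ _ => ?_
  ring

theorem pull_tensor (x x' : Fin 4 → ℂ) (i j : Fin 4) :
    pull B (fun α β => x α * x' β) i j = pullv B x i * pullv B x' j := by
  simp only [pull_apply, pullv, Finset.sum_mul_sum]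
  refine Finset.sum_congr rfl fun _ _ => Finset.sum_congr rfl fun _ _ => ?_
  ring

theorem FrameAt.sum_gInv_mul (h : L.FrameAt y B) (x x' : Fin 4 → ℂ) :
    ∑ α, ∑ β, (L.gInv y α β : ℂ) * (x α * x' β) =
      ∑ k, (minkowski k k : ℂ) * (pullv B x k * pullv B x' k) := by
  rw [h.sum_gInv]
  simp only [pull_tensor]

theorem nablaHat_conj (L : LocalFields) (y : Coord) (k : Fin 4)
    (X Y : Matrix (Fin 4) (Fin 4) ℝ) :
    ∑ μ, B μ k • (X * (B.transpose * L.nablaU μ y * B) * Y) = X * L.nablaHat y B k * Y := by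
  simp only [nablaHat, Finset.mul_sum, Finset.sum_mul, Matrix.mul_smul, Matrix.smul_mul]

namespace RegularOn

variable (h : L.RegularOn s) (hy : y ∈ s) (hB : L.FrameAt y B)
include h hy

theorem nablaHat_antisymm (k i j : Fin 4) : L.nablaHat y B k i j = -L.nablaHat y B k j i := by
  have h1 : (L.nablaHat y B k).transpose = -L.nablaHat y B k := by
    simp only [nablaHat, Matrix.transpose_sum, Matrix.transpose_smul, Matrix.transpose_mul,
      Matrix.transpose_transpose, h.nablaU_transpose hy, ← Finset.sum_neg_distrib]
    refine Finset.sum_congr rfl fun μ _ => ?_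
    rw [neg_mul, mul_neg, smul_neg, mul_assoc]
  exact congrFun (congrFun h1 j) i

include hB

theorem nablaHat_cubic (k : Fin 4) :
    L.nablaHat y B k * (Matrix.of minkowski * uHat * Matrix.of minkowski * uHat) +
      uHat * Matrix.of minkowski * L.nablaHat y B k * (Matrix.of minkowski * uHat) +
      uHat * Matrix.of minkowski * uHat * Matrix.of minkowski * L.nablaHat y B k =
      L.nablaHat y B k := by
  set η := Matrix.of minkowski
  have h1 : ∀ μ, 1 * (B.transpose * L.nablaU μ y * B) * (η * uHat * η * uHat) +
      uHat * η * (B.transpose * L.nablaU μ y * B) * (η * uHat) +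
      uHat * η * uHat * η * (B.transpose * L.nablaU μ y * B) * 1 =
      B.transpose * L.nablaU μ y * B := by
    intro μ
    conv_rhs => rw [← h.nablaU_cubic hy μ, hB.gInvMat_eq]
    simp only [← hB.uMat_eq]
    noncomm_ring
  have h2 := congrArg (fun f : Fin 4 → Matrix (Fin 4) (Fin 4) ℝ => ∑ μ, B μ k • f μ) (funext h1)
  simp only [smul_add, Finset.sum_add_distrib] at h2
  rw [nablaHat_conj, nablaHat_conj, nablaHat_conj, one_mul, mul_one] at h2
  exact h2

theorem nablaHat_umbilicalV (hU : L.UmbilicalPlaneAt y L.projV L.projH) :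
    ∃ H : Fin 4 → ℝ, ∀ i j c,
      ∑ k, pHat k i * (qHat * Matrix.of minkowski * L.nablaHat y B k *
          (Matrix.of minkowski * uHat)) c j +
        ∑ k, pHat k j * (qHat * Matrix.of minkowski * L.nablaHat y B k *
          (Matrix.of minkowski * uHat)) c i =
      (Matrix.of minkowski * pHat) i j * H c := by
  obtain ⟨H, hH⟩ := hB.frame_umbilical hB.projV_eq _ (h.projH_mul_matD_projV hy) hU
  refine ⟨H, fun i j c => ?_⟩
  have h1 : ∀ k, ∑ μ, B μ k • (B⁻¹ * (Matrix.of (L.projH y) *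
      (L.gInvMat y * L.nablaU μ y * (L.gInvMat y * L.uMat y))) * B) =
      qHat * Matrix.of minkowski * L.nablaHat y B k * (Matrix.of minkowski * uHat) := by
    intro k
    rw [← nablaHat_conj]
    refine Finset.sum_congr rfl fun μ _ => ?_
    rw [hB.projH_eq, hB.gInv_mul_uMat, hB.gInvMat_eq]
    congr 1
    calc _ = (B⁻¹ * B) * qHat * (B⁻¹ * B) * Matrix.of minkowski *
          (B.transpose * L.nablaU μ y * B) * (Matrix.of minkowski * uHat) * (B⁻¹ * B) := by
          simp only [mul_assoc]
      _ = _ := by rw [hB.inv_mul]; simp only [mul_one, one_mul]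
  have h2 := hH i j c
  simp only [h1] at h2
  exact h2

theorem nablaHat_umbilicalH (hU : L.UmbilicalPlaneAt y L.projH L.projV) :
    ∃ H : Fin 4 → ℝ, ∀ i j c,
      ∑ k, qHat k i * (pHat * Matrix.of minkowski * L.nablaHat y B k *
          (Matrix.of minkowski * uHat) + Matrix.of minkowski * uHat * Matrix.of minkowski *
            L.nablaHat y B k) c j +
        ∑ k, qHat k j * (pHat * Matrix.of minkowski * L.nablaHat y B k *
          (Matrix.of minkowski * uHat) + Matrix.of minkowski * uHat * Matrix.of minkowski *
            L.nablaHat y B k) c i =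
      (Matrix.of minkowski * qHat) i j * H c := by
  obtain ⟨H, hH⟩ := hB.frame_umbilical hB.projH_eq _ (h.projV_mul_matD_projH hy) hU
  -- The minus sign in the formula for v∇h is absorbed into the coefficient vector.
  refine ⟨fun c => -H c, fun i j c => ?_⟩
  have h1 : ∀ k, ∑ μ, B μ k • (B⁻¹ * -(Matrix.of (L.projV y) *
      (L.gInvMat y * L.nablaU μ y * (L.gInvMat y * L.uMat y)) +
        L.gInvMat y * L.uMat y * (L.gInvMat y * L.nablaU μ y)) * B) =
      -(pHat * Matrix.of minkowski * L.nablaHat y B k * (Matrix.of minkowski * uHat) +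
        Matrix.of minkowski * uHat * Matrix.of minkowski * L.nablaHat y B k) := by
    intro k
    rw [← nablaHat_conj, ← mul_one (Matrix.of minkowski * uHat * Matrix.of minkowski *
      L.nablaHat y B k), ← nablaHat_conj, ← Finset.sum_add_distrib, ← Finset.sum_neg_distrib]
    refine Finset.sum_congr rfl fun μ _ => ?_
    rw [hB.projV_eq, hB.gInv_mul_uMat, hB.gInvMat_eq, ← smul_add, ← smul_neg]
    congr 1
    calc _ = -((B⁻¹ * B) * pHat * (B⁻¹ * B) * Matrix.of minkowski *
          (B.transpose * L.nablaU μ y * B) * (Matrix.of minkowski * uHat) * (B⁻¹ * B) +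
          (B⁻¹ * B) * (Matrix.of minkowski * uHat) * (B⁻¹ * B) * Matrix.of minkowski *
            (B.transpose * L.nablaU μ y * B)) := by
          simp only [mul_assoc, mul_neg, neg_mul, mul_add, add_mul]
      _ = _ := by rw [hB.inv_mul]; simp only [mul_one, one_mul, mul_assoc]
  have h2 := hH i j c
  simp only [h1] at h2
  simp only [Matrix.neg_apply, mul_neg, Finset.sum_neg_distrib] at h2
  linarith

/-- The components of the covariant derivative of the canonical 2-form of an umbilical
structure. -/
theorem nablaHat_eqs (hU : L.UmbilicalAt y) :
    (∀ k, L.nablaHat y B k 0 1 = 0 ∧ L.nablaHat y B k 2 3 = 0) ∧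
    (L.nablaHat y B 1 0 2 = -L.nablaHat y B 0 1 2 ∧ L.nablaHat y B 1 1 2 = -L.nablaHat y B 0 0 2 ∧
      L.nablaHat y B 1 0 3 = -L.nablaHat y B 0 1 3 ∧
      L.nablaHat y B 1 1 3 = -L.nablaHat y B 0 0 3) ∧
    (L.nablaHat y B 3 1 3 = L.nablaHat y B 2 1 2 ∧ L.nablaHat y B 3 1 2 = -L.nablaHat y B 2 1 3 ∧
      L.nablaHat y B 3 0 3 = L.nablaHat y B 2 0 2 ∧
      L.nablaHat y B 3 0 2 = -L.nablaHat y B 2 0 3) := by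
  have ha := h.nablaHat_antisymm (B := B) hy
  obtain ⟨H, hH⟩ := h.nablaHat_umbilicalV hy hB hU.1
  obtain ⟨K, hK⟩ := h.nablaHat_umbilicalH hy hB hU.2
  have hc := h.nablaHat_cubic hy hB
  generalize L.nablaHat y B = n at *
  have hd : ∀ k i, n k i i = 0 := fun k i => by linarith [ha k i i]
  have e1 : Matrix.of minkowski * uHat = !![0, 1, 0, 0; 1, 0, 0, 0; 0, 0, 0, 0; 0, 0, 0, 0] := by
    rw [minkowski_eq_diagonal]
    ext i j
    fin_cases i <;> fin_cases j <;> simp [uHat, minkowskiModel]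
  have e2 : uHat * Matrix.of minkowski =
      !![0, -1, 0, 0; -1, 0, 0, 0; 0, 0, 0, 0; 0, 0, 0, 0] := by
    rw [minkowski_eq_diagonal]
    ext i j
    fin_cases i <;> fin_cases j <;> simp [uHat, minkowskiModel]
  have e3 : qHat * Matrix.of minkowski = qHat := by
    rw [minkowski_eq_diagonal, qHat, Matrix.diagonal_mul_diagonal]
    congr 1; ext i; fin_cases i <;> simp
  have e4 : Matrix.of minkowski * qHat = qHat := by
    rw [minkowski_eq_diagonal, qHat, Matrix.diagonal_mul_diagonal]
    congr 1; ext i; fin_cases i <;> simp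
  have e5 : pHat * Matrix.of minkowski = Matrix.diagonal ![-1, 1, 0, 0] := by
    rw [minkowski_eq_diagonal, pHat, Matrix.diagonal_mul_diagonal]
    congr 1; ext i; fin_cases i <;> simp
  have e6 : Matrix.of minkowski * pHat = Matrix.diagonal ![-1, 1, 0, 0] := by
    rw [minkowski_eq_diagonal, pHat, Matrix.diagonal_mul_diagonal]
    congr 1; ext i; fin_cases i <;> simp
  have e7 : Matrix.of minkowski * uHat * Matrix.of minkowski =
      !![0, 1, 0, 0; -1, 0, 0, 0; 0, 0, 0, 0; 0, 0, 0, 0] := by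
    rw [e1, minkowski_eq_diagonal]
    ext i j
    fin_cases i <;> fin_cases j <;> simp [Matrix.mul_diagonal]
  have e8 : uHat * Matrix.of minkowski * uHat * Matrix.of minkowski = pHat := by
    rw [mul_assoc (uHat * Matrix.of minkowski), e2]
    ext i j
    fin_cases i <;> fin_cases j <;> simp [pHat, Matrix.mul_apply, Fin.sum_univ_four]
  simp only [e3, e6] at hH
  simp only [e5, e7, e4] at hK
  simp only [pHat_eq, e8] at hc
  simp only [e1] at hH hK
  simp only [e2, e1] at hc
  -- The linearised relation U³ = U kills the components of ∇U with both indices in the same plane.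
  have c01 : ∀ k, n k 0 1 = 0 := fun k => by
    have := congrFun (congrFun (hc k) 0) 1
    simp only [Matrix.add_apply, Matrix.mul_apply, Fin.sum_univ_four, pHat] at this
    simp at this
    linarith [ha k 0 1]
  have c23 : ∀ k, n k 2 3 = 0 := fun k => by
    have := congrFun (congrFun (hc k) 2) 3
    simp only [Matrix.add_apply, Matrix.mul_apply, Fin.sum_univ_four, pHat] at this
    simp at this
    linarith
  refine ⟨fun k => ⟨c01 k, c23 k⟩, ?_, ?_⟩
  -- For the time-like plane proportionality to diag(−1, 1) means S₀₀ + S₁₁ = 0 and S₀₁ = 0, for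
  -- each of the normal components 2 and 3.
  · have f := fun c => hH 0 0 c
    have g := fun c => hH 1 1 c
    have m := fun c => hH 0 1 c
    have f2 := f 2; have f3 := f 3; have g2 := g 2; have g3 := g 3; have m2 := m 2; have m3 := m 3
    simp only [Matrix.mul_apply, Fin.sum_univ_four, pHat, qHat,
      Matrix.diagonal_apply] at f2 f3 g2 g3 m2 m3
    simp at f2 f3 g2 g3 m2 m3
    refine ⟨?_, ?_, ?_, ?_⟩ <;>
      linarith [ha 0 2 0, ha 0 2 1, ha 0 3 0, ha 0 3 1, ha 1 2 0, ha 1 2 1, ha 1 3 0, ha 1 3 1]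
  -- For the space-like plane the conditions are S₂₂ = S₃₃ and S₂₃ = 0, for each of the normal
  -- components 0 and 1.
  · have f := fun c => hK 2 2 c
    have g := fun c => hK 3 3 c
    have m := fun c => hK 2 3 c
    have f0 := f 0; have f1 := f 1; have g0 := g 0; have g1 := g 1; have m0 := m 0; have m1 := m 1
    simp only [Matrix.add_apply, Matrix.mul_apply, Fin.sum_univ_four, qHat,
      Matrix.diagonal_apply] at f0 f1 g0 g1 m0 m1
    simp at f0 f1 g0 g1 m0 m1
    refine ⟨?_, ?_, ?_, ?_⟩ <;>
      linarith

end RegularOn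

end LocalFields

/-! ### The first structure equation in the model -/

namespace LocalFields

variable {L : LocalFields} {s : Set Coord} {y : Coord} {B : Matrix (Fin 4) (Fin 4) ℝ}

theorem raise_minkowskiModel (F : Tensor2) (i j : Fin 4) :
    minkowskiModel.raise 0 F i j = minkowski i i * minkowski j j * F i j := by
  simp only [raise, gInv_minkowskiModel]
  fin_cases i <;> fin_cases j <;> simp [minkowski, Fin.sum_univ_four]

theorem hodge_minkowskiModel {F : Tensor2} (hF : ∀ i j, F i j = -F j i) :
    minkowskiModel.hodge 0 F = ![![0, F 2 3, -F 1 3, F 1 2], ![-F 2 3, 0, -F 0 3, F 0 2],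
      ![F 1 3, F 0 3, 0, -F 0 1], ![-F 1 2, -F 0 2, F 0 1, 0]] := by
  have h1 := hF 1 0; have h2 := hF 2 0; have h3 := hF 3 0; have h4 := hF 2 1; have h5 := hF 3 1
  have h6 := hF 3 2
  have hv : ∀ i j k l, minkowskiModel.eta 0 i j k l = (leviCivita i j k l : ℂ) := fun _ _ _ _ => rfl
  funext i j
  simp only [hodge, act_apply, contract, raise_minkowskiModel, hv]
  fin_cases i <;> fin_cases j <;>
    simp [Fin.sum_univ_four, leviCivita, minkowski, h1, h2, h3, h4, h5, h6] <;> norm_num <;> ring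

/-- The canonical SD bivector of the model, up to the factor `1 / √2`. -/
def calUHat : Tensor2 :=
  ![![0, -1, 0, 0], ![1, 0, 0, 0], ![0, 0, 0, -Complex.I], ![0, 0, Complex.I, 0]]

theorem calU_minkowskiModel : minkowskiModel.calU 0 = ((1 / √2 : ℝ) : ℂ) • calUHat := by
  have hU : ∀ i j, minkowskiModel.U 0 i j =
    !![0, -1, 0, 0; 1, 0, 0, 0; 0, 0, 0, 0; 0, 0, 0, (0 : ℝ)] i j := by
    intro i j
    fin_cases i <;> fin_cases j <;> simp [minkowskiModel]
  rw [calU]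
  congr 1
  simp only [hU]
  rw [hodge_minkowskiModel]
  · funext i j
    fin_cases i <;> fin_cases j <;> simp [calUHat]
  · intro i j
    fin_cases i <;> fin_cases j <;> simp

theorem calG_minkowskiModel (i j k l : Fin 4) : minkowskiModel.calG 0 i j k l =
    1 / 2 * (((minkowski i k * minkowski j l - minkowski i l * minkowski j k : ℝ) : ℂ)
      - Complex.I * (leviCivita i j k l : ℝ)) := rfl

/-- The array D is the general shape of √2 ∇𝒰 left by umbilicity. Its divergence is x = (2c, 2i d,
2a, 2b), so x recovers all four parameters and the formula becomes a finite check. The coefficient ½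
is the product of two normalising factors 1/√2. -/
theorem first_structure_model (a b c d : ℂ) (D : Fin 4 → Tensor2)
    (hD : D = ![![![0, 0, a, b], ![0, 0, Complex.I * b, -Complex.I * a],
        ![-a, -Complex.I * b, 0, 0], ![-b, Complex.I * a, 0, 0]],
      ![![0, 0, -Complex.I * b, Complex.I * a], ![0, 0, -a, -b],
        ![Complex.I * b, a, 0, 0], ![-Complex.I * a, b, 0, 0]],
      ![![0, 0, c, d], ![0, 0, Complex.I * d, -Complex.I * c],
        ![-c, -Complex.I * d, 0, 0], ![-d, Complex.I * c, 0, 0]],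
      ![![0, 0, -d, c], ![0, 0, Complex.I * c, Complex.I * d],
        ![d, -Complex.I * c, 0, 0], ![-c, -Complex.I * d, 0, 0]]])
    (x : Fin 4 → ℂ) (hx : ∀ j, x j = -∑ k, (minkowski k k : ℂ) * D k k j) (k i j : Fin 4) :
    D k i j = 1 / 2 * (∑ p, (minkowski p p : ℂ) * (x p * calUHat p k)) * calUHat i j -
      ∑ p, (minkowski p p : ℂ) * (minkowskiModel.calG 0 k p i j * x p) := by
  have hx0 : x 0 = 2 * c := by
    simp [hx, hD, Fin.sum_univ_four, minkowski]; ring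
  have hx1 : x 1 = 2 * Complex.I * d := by
    simp [hx, hD, Fin.sum_univ_four, minkowski]; ring
  have hx2 : x 2 = 2 * a := by
    simp [hx, hD, Fin.sum_univ_four, minkowski]; ring
  have hx3 : x 3 = 2 * b := by
    simp [hx, hD, Fin.sum_univ_four, minkowski]; ring
  have hI := Complex.I_mul_I
  simp only [Fin.sum_univ_four, hx0, hx1, hx2, hx3, calG_minkowskiModel, hD, calUHat]
  fin_cases k <;> fin_cases i <;> fin_cases j <;> simp [minkowski, leviCivita] <;> norm_num <;> grind

end LocalFields

/-! ### Frame components of ∇𝒰, ξ and χ -/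

namespace LocalFields

variable {L : LocalFields} {s : Set Coord} {y : Coord} {B : Matrix (Fin 4) (Fin 4) ℝ}

/-- The 2-tensor with real components `A`. -/
def toTensor (A : Matrix (Fin 4) (Fin 4) ℝ) : Tensor2 := fun i j => (A i j : ℂ)

/-- The components of a 3-tensor in the frame with matrix `B`. -/
def pull3 (B : Matrix (Fin 4) (Fin 4) ℝ) (T : Fin 4 → Tensor2) (k : Fin 4) : Tensor2 :=
  ∑ α, (B α k : ℂ) • pull B (T α)

theorem pull3_apply (B : Matrix (Fin 4) (Fin 4) ℝ) (T : Fin 4 → Tensor2) (k i j : Fin 4) :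
    pull3 B T k i j = ∑ α, (B α k : ℂ) * pull B (T α) i j := by
  simp [pull3]

theorem pull3_injective (h : L.FrameAt y B) {T T' : Fin 4 → Tensor2}
    (hT : pull3 B T = pull3 B T') : T = T' := by
  have h1 : ∀ i j, (fun α => pull B (T α) i j) = fun α => pull B (T' α) i j := fun i j => by
    refine pullv_injective h (funext fun k => ?_)
    have := congrFun (congrFun (congrFun hT k) i) j
    rwa [pull3_apply, pull3_apply] at this
  funext α
  refine h.pull_injective ?_
  funext i j
  exact congrFun (h1 i j) α

/-- The 3-tensor `𝒢_{αμβγ} w^μ`. -/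
def insertG (L : LocalFields) (y : Coord) (w : Fin 4 → ℂ) (α : Fin 4) : Tensor2 :=
  fun β γ => ∑ μ, ∑ ν, (L.gInv y μ ν : ℂ) * (L.calG y α μ β γ * w ν)

theorem FrameAt.pull3_insertG (h : L.FrameAt y B) (w : Fin 4 → ℂ) (k i j : Fin 4) :
    pull3 B (L.insertG y w) k i j =
      ∑ p, (minkowski p p : ℂ) * (minkowskiModel.calG 0 k p i j * pullv B w p) := by
  have h1 : ∀ α, L.insertG y w α =
      ∑ μ, ∑ ν, ((L.gInv y μ ν : ℂ) * w ν) • (L.calG y α μ : Tensor2) := fun α => by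
    funext β γ
    simp only [insertG, Finset.sum_apply, Pi.smul_apply, smul_eq_mul]
    refine Finset.sum_congr rfl fun _ _ => Finset.sum_congr rfl fun _ _ => ?_
    ring
  have h2 := h.sum_gInv_mul (fun μ => ∑ α, (B α k : ℂ) * pull B (L.calG y α μ) i j) w
  have h3 : ∀ p, pullv B (fun μ => ∑ α, (B α k : ℂ) * pull B (L.calG y α μ) i j) p =
      minkowskiModel.calG 0 k p i j := fun p => by
    rw [← h.pull4_calG, pull4, pull_apply, Finset.sum_comm]
    simp only [pullv, Finset.mul_sum]
    refine Finset.sum_congr rfl fun _ _ => Finset.sum_congr rfl fun _ _ => ?_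
    ring
  simp only [h3] at h2
  rw [← h2, pull3_apply]
  simp only [h1, map_sum, map_smul, Finset.sum_apply, Pi.smul_apply, smul_eq_mul,
    Finset.mul_sum, Finset.sum_mul]
  rw [Finset.sum_comm]
  refine Finset.sum_congr rfl fun _ _ => ?_
  rw [Finset.sum_comm]
  refine Finset.sum_congr rfl fun _ _ => Finset.sum_congr rfl fun _ _ => ?_
  ring

theorem FrameAt.pullv_chi (h : L.FrameAt y B) (k : Fin 4) : pullv B (L.chi y) k =
    ∑ p, (minkowski p p : ℂ) * (pullv B (L.xi y) p * minkowskiModel.calU 0 p k) := by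
  have h1 : ∀ p, pullv B (fun α => ∑ β, (B β k : ℂ) * L.calU y α β) p =
      minkowskiModel.calU 0 p k := fun p => by
    rw [← h.pull_calU, pull_apply, pullv]
    refine Finset.sum_congr rfl fun _ _ => ?_
    rw [Finset.mul_sum]
    refine Finset.sum_congr rfl fun _ _ => ?_
    ring
  have h2 := h.sum_gInv_mul (fun α => ∑ β, (B β k : ℂ) * L.calU y α β) (L.xi y)
  simp only [h1] at h2
  calc _ = ∑ α, ∑ β, (L.gInv y α β : ℂ) *
        ((∑ γ, (B γ k : ℂ) * L.calU y α γ) * L.xi y β) := by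
        simp only [pullv, chi, Finset.mul_sum, Finset.sum_mul]
        rw [Finset.sum_comm]
        refine Finset.sum_congr rfl fun _ _ => ?_
        rw [Finset.sum_comm]
        refine Finset.sum_congr rfl fun _ _ => Finset.sum_congr rfl fun _ _ => ?_
        ring
    _ = _ := by
        rw [h2]
        refine Finset.sum_congr rfl fun _ _ => ?_
        ring

theorem FrameAt.pullv_xi (h : L.FrameAt y B) (j : Fin 4) : pullv B (L.xi y) j =
    -∑ k, (minkowski k k : ℂ) * pull3 B (L.covD2 y L.calU) k k j := by
  have h1 : ∀ k, pull3 B (L.covD2 y L.calU) k k j =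
      pull B (fun α β => ∑ γ, (B γ j : ℂ) * L.covD2 y L.calU α β γ) k k := fun k => by
    simp only [pull3_apply, pull_apply, Finset.mul_sum]
    refine Finset.sum_congr rfl fun _ _ => Finset.sum_congr rfl fun _ _ =>
      Finset.sum_congr rfl fun _ _ => ?_
    ring
  simp only [h1]
  rw [← h.sum_gInv]
  simp only [pullv, xi, codiff, Finset.mul_sum, ← Finset.sum_neg_distrib]
  rw [Finset.sum_comm]
  refine Finset.sum_congr rfl fun _ _ => ?_
  rw [Finset.sum_comm]
  refine Finset.sum_congr rfl fun _ _ => Finset.sum_congr rfl fun _ _ => ?_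
  ring

namespace RegularOn

variable (h : L.RegularOn s) (hy : y ∈ s) (hB : L.FrameAt y B)
include h hy

theorem pull3_covD2_U (k : Fin 4) :
    pull3 B (L.covD2 y (fun z α β => (L.U z α β : ℂ))) k = toTensor (L.nablaHat y B k) := by
  have h1 : ∀ μ, L.covD2 y (fun z α β => (L.U z α β : ℂ)) μ =
      toTensor (L.nablaU μ y) := fun μ => by
    funext α β
    exact h.covD2_U hy μ α β
  have h2 : ∀ α, pull B (toTensor (L.nablaU α y)) =
      toTensor (B.transpose * L.nablaU α y * B) := fun α => by
    change _ = toC (B.transpose * L.nablaU α y * B)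
    rw [toC_mul, toC_mul, toC_transpose]
    rfl
  funext i j
  simp only [pull3_apply, h1, h2, toTensor, nablaHat, Matrix.sum_apply, Matrix.smul_apply,
    smul_eq_mul, Complex.ofReal_sum, Complex.ofReal_mul]

include hB in
theorem pull3_covD2_calU (k : Fin 4) : pull3 B (L.covD2 y L.calU) k =
    ((1 / √2 : ℝ) : ℂ) • (toTensor (L.nablaHat y B k) -
      Complex.I • minkowskiModel.hodge 0 (toTensor (L.nablaHat y B k))) := by
  rw [← h.pull3_covD2_U hy]
  simp only [pull3, h.covD2_calU hy, map_smul, map_sub, hB.pull_hodge, map_sum, Finset.smul_sum,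
    ← Finset.sum_sub_distrib, smul_sub]
  refine Finset.sum_congr rfl fun _ _ => ?_
  module

include hB in
theorem pull3_covD2_calU_of_umbilical (hU : L.UmbilicalAt y) :
    ∃ a b c d : ℂ, pull3 B (L.covD2 y L.calU) = fun k => ((1 / √2 : ℝ) : ℂ) •
      ![![![0, 0, a, b], ![0, 0, Complex.I * b, -Complex.I * a],
        ![-a, -Complex.I * b, 0, 0], ![-b, Complex.I * a, 0, 0]],
      ![![0, 0, -Complex.I * b, Complex.I * a], ![0, 0, -a, -b],
        ![Complex.I * b, a, 0, 0], ![-Complex.I * a, b, 0, 0]],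
      ![![0, 0, c, d], ![0, 0, Complex.I * d, -Complex.I * c],
        ![-c, -Complex.I * d, 0, 0], ![-d, Complex.I * c, 0, 0]],
      ![![0, 0, -d, c], ![0, 0, Complex.I * c, Complex.I * d],
        ![d, -Complex.I * c, 0, 0], ![-c, -Complex.I * d, 0, 0]]] k := by
  have ha := h.nablaHat_antisymm hy (B := B)
  obtain ⟨h0, ⟨h1, h2, h3, h4⟩, h5, h6, h7, h8⟩ := h.nablaHat_eqs hy hB hU
  set n := L.nablaHat y B with hn
  have hd : ∀ k, n k 0 0 = 0 ∧ n k 1 1 = 0 ∧ n k 2 2 = 0 ∧ n k 3 3 = 0 := fun k => by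
    refine ⟨?_, ?_, ?_, ?_⟩ <;> linarith [ha k 0 0, ha k 1 1, ha k 2 2, ha k 3 3]
  -- The parameters are the components 02 and 03 of ∇U − i *∇U in the directions 0 and 2. The eight
  -- umbilicity relations express the directions 1 and 3 through them.
  refine ⟨n 0 0 2 + Complex.I * n 0 1 3, n 0 0 3 - Complex.I * n 0 1 2,
    n 2 0 2 + Complex.I * n 2 1 3, n 2 0 3 - Complex.I * n 2 1 2, ?_⟩
  funext k
  rw [h.pull3_covD2_calU hy hB]
  congr 1
  rw [← hn, hodge_minkowskiModel (fun i j => by simp [toTensor, ha k i j])]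
  have hI := Complex.I_mul_I
  have r1 := fun k => ha k 1 0
  have r2 := fun k => ha k 2 0
  have r3 := fun k => ha k 3 0
  have r4 := fun k => ha k 2 1
  have r5 := fun k => ha k 3 1
  have r6 := fun k => ha k 3 2
  funext i j
  simp only [Pi.sub_apply, Pi.smul_apply, smul_eq_mul, toTensor]
  fin_cases k <;> fin_cases i <;> fin_cases j <;>
    simp [r1, r2, r3, r4, r5, r6, h0, h1, h2, h3, h4, h5, h6, h7, h8, hd] <;> grind

end RegularOn

end LocalFields

/-! ### The first structure equation and derivatives of its right-hand side -/

namespace LocalFields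

variable {L : LocalFields} {s : Set Coord} {y : Coord} {B : Matrix (Fin 4) (Fin 4) ℝ}

theorem FrameAt.pull3_smul_calU (hB : L.FrameAt y B) (x : Fin 4 → ℂ) (k : Fin 4) :
    pull3 B (fun α => x α • L.calU y) k = pullv B x k • minkowskiModel.calU 0 := by
  simp only [pull3, pullv, map_smul, hB.pull_calU, Finset.sum_smul, mul_smul]

theorem pull3_sub (T T' : Fin 4 → Tensor2) (k : Fin 4) :
    pull3 B (fun α => T α - T' α) k = pull3 B T k - pull3 B T' k := by
  simp only [pull3, map_sub, smul_sub, Finset.sum_sub_distrib]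

/-- The contravariant components of a 1-form. -/
def raiseV (L : LocalFields) (y : Coord) (w : Fin 4 → ℂ) (μ : Fin 4) : ℂ :=
  ∑ ν, (L.gInv y μ ν : ℂ) * w ν

theorem insertG_eq (L : LocalFields) (y : Coord) (w : Fin 4 → ℂ) (α β γ : Fin 4) :
    L.insertG y w α β γ = ∑ μ, L.calG y α μ β γ * L.raiseV y w μ := by
  simp only [insertG, raiseV, Finset.mul_sum]
  refine Finset.sum_congr rfl fun _ _ => Finset.sum_congr rfl fun _ _ => ?_
  ring

theorem insertG_sub_smul (L : LocalFields) (y : Coord) (w w' : Fin 4 → ℂ) (c : ℂ) (α : Fin 4) :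
    L.insertG y (fun ν => w ν - c * w' ν) α = L.insertG y w α - c • L.insertG y w' α := by
  funext β γ
  simp only [insertG, Pi.sub_apply, Pi.smul_apply, smul_eq_mul, Finset.mul_sum,
    ← Finset.sum_sub_distrib]
  refine Finset.sum_congr rfl fun _ _ => Finset.sum_congr rfl fun _ _ => ?_
  ring

namespace RegularOn

variable (h : L.RegularOn s) (hy : y ∈ s)
include h hy

/-- The first structure equation of an umbilical 2+2 structure:
`∇_α 𝒰_{βγ} = χ_α 𝒰_{βγ} - 𝒢_{αμβγ} ξ^μ`. -/
theorem covD2_calU_of_umbilical (hU : L.UmbilicalAt y) (α : Fin 4) :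
    L.covD2 y L.calU α = L.chi y α • L.calU y - L.insertG y (L.xi y) α := by
  obtain ⟨B, hB⟩ := h.exists_frameAt hy
  refine congrFun (pull3_injective hB (T := L.covD2 y L.calU)
    (T' := fun α => L.chi y α • L.calU y - L.insertG y (L.xi y) α) ?_) α
  obtain ⟨a, b, c, d, hD⟩ := h.pull3_covD2_calU_of_umbilical hy hB hU
  generalize hDD : (![![![0, 0, a, b], ![0, 0, Complex.I * b, -Complex.I * a],
        ![-a, -Complex.I * b, 0, 0], ![-b, Complex.I * a, 0, 0]],
      ![![0, 0, -Complex.I * b, Complex.I * a], ![0, 0, -a, -b],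
        ![Complex.I * b, a, 0, 0], ![-Complex.I * a, b, 0, 0]],
      ![![0, 0, c, d], ![0, 0, Complex.I * d, -Complex.I * c],
        ![-c, -Complex.I * d, 0, 0], ![-d, Complex.I * c, 0, 0]],
      ![![0, 0, -d, c], ![0, 0, Complex.I * c, Complex.I * d],
        ![d, -Complex.I * c, 0, 0], ![-c, -Complex.I * d, 0, 0]]] : Fin 4 → Tensor2) = D at hD
  -- The term χ ⊗ 𝒰 carries three factors 1/√2 while ∇𝒰 carries one; the excess two give the ½ of
  -- the model formula.
  have hk : ((1 / √2 : ℝ) : ℂ) * ((1 / √2 : ℝ) : ℂ) = 1 / 2 := by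
    rw [← Complex.ofReal_mul, div_mul_div_comm, Real.mul_self_sqrt (by norm_num)]
    norm_num
  have hu := calU_minkowskiModel
  generalize ((1 / √2 : ℝ) : ℂ) = κ at hk hD hu
  have hx : ∀ p, pullv B (L.xi y) p = κ * -∑ k, (minkowski k k : ℂ) * D k k p := fun p => by
    rw [hB.pullv_xi, hD, mul_neg, Finset.mul_sum]
    congr 1
    refine Finset.sum_congr rfl fun _ _ => ?_
    simp only [Pi.smul_apply, smul_eq_mul]
    ring
  funext k i j
  have h1 := first_structure_model a b c d D hDD.symm _ (fun _ => rfl) k i j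
  rw [pull3_sub, hB.pull3_smul_calU, Pi.sub_apply, Pi.sub_apply, hB.pull3_insertG, hB.pullv_chi,
    hD, hu]
  simp only [hx, Pi.smul_apply, smul_eq_mul]
  rw [h1, mul_sub]
  have e1 : ∀ (f : Fin 4 → ℂ) (g : Fin 4 → ℂ),
      ∑ p, (minkowski p p : ℂ) * (g p * (κ * f p)) =
        κ * ∑ p, (minkowski p p : ℂ) * (g p * f p) := fun f g => by
    rw [Finset.mul_sum]
    refine Finset.sum_congr rfl fun _ _ => ?_
    ring
  have e2 : ∀ (f : Fin 4 → ℂ) (g : Fin 4 → ℂ),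
      ∑ p, (minkowski p p : ℂ) * (κ * f p * (g p)) =
        κ * ∑ p, (minkowski p p : ℂ) * (f p * g p) := fun f g => by
    rw [Finset.mul_sum]
    refine Finset.sum_congr rfl fun _ _ => ?_
    ring
  generalize hX : (fun p => -∑ k, (minkowski k k : ℂ) * D k k p) = X at *
  have hX' : ∀ p, -∑ k, (minkowski k k : ℂ) * D k k p = X p := fun p => congrFun hX p
  simp only [hX']
  rw [e1 X, e2 X, e1 (fun p => calUHat p k) X]
  linear_combination (-(∑ p, (minkowski p p : ℂ) * (X p * calUHat p k)) * κ * calUHat i j) * hk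

theorem partialD_gInv (δ μ ν : Fin 4) : partialD δ (fun z => L.gInv z μ ν) y =
    -(∑ l, L.christoffel y μ δ l * L.gInv y l ν) - ∑ l, L.gInv y μ l * L.christoffel y ν δ l :=
  congrFun (congrFun (h.matD_gInv hy δ) μ) ν

variable {w : Coord → Fin 4 → ℂ} (hw : ∀ ν, DifferentiableAt ℝ (fun z => w z ν) y)
include hw

theorem differentiableAt_raiseV (μ : Fin 4) :
    DifferentiableAt ℝ (fun z => L.raiseV z (w z) μ) y := by
  have hg : ∀ ν, DifferentiableAt ℝ (fun z => L.gInv z μ ν) y := fun ν =>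
    (h.smooth_gInv μ ν).differentiableAt_of_isOpen h.isOpen hy
  exact DifferentiableAt.fun_sum fun ν _ =>
    (Complex.ofRealCLM.differentiableAt.comp y (hg ν)).fun_mul (hw ν)

theorem partialD_raiseV (δ μ : Fin 4) : partialD δ (fun z => L.raiseV z (w z) μ) y =
    L.raiseV y (L.covD1 y w δ) μ - ∑ l, (L.christoffel y μ δ l : ℂ) * L.raiseV y (w y) l := by
  have hg : ∀ ν, DifferentiableAt ℝ (fun z => L.gInv z μ ν) y := fun ν =>
    (h.smooth_gInv μ ν).differentiableAt_of_isOpen h.isOpen hy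
  have hgC : ∀ ν, DifferentiableAt ℝ (fun z => (L.gInv z μ ν : ℂ)) y := fun ν =>
    Complex.ofRealCLM.differentiableAt.comp y (hg ν)
  have hd : ∀ ν, partialD δ (fun z => w z ν) y =
      L.covD1 y w δ ν + ∑ l, (L.christoffel y l δ ν : ℂ) * w y l := fun ν => by
    simp [covD1]
  unfold raiseV
  rw [partialD_sum fun ν _ => (hgC ν).fun_mul (hw ν)]
  simp only [partialD_mul (hgC _) (hw _), partialD_ofReal (hg _), h.partialD_gInv hy, hd]
  push_cast
  have h1 : ∑ ν, ∑ l, (L.gInv y μ l : ℂ) * (L.christoffel y ν δ l : ℂ) * w y ν =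
      ∑ ν, ∑ l, (L.gInv y μ ν : ℂ) * ((L.christoffel y l δ ν : ℂ) * w y l) := by
    rw [Finset.sum_comm]
    refine Finset.sum_congr rfl fun _ _ => Finset.sum_congr rfl fun _ _ => ?_
    ring
  have h2 : ∑ ν, ∑ l, (L.christoffel y μ δ l : ℂ) * (L.gInv y l ν : ℂ) * w y ν =
      ∑ l, ∑ ν, (L.christoffel y μ δ l : ℂ) * ((L.gInv y l ν : ℂ) * w y ν) := by
    rw [Finset.sum_comm]
    refine Finset.sum_congr rfl fun _ _ => Finset.sum_congr rfl fun _ _ => ?_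
    ring
  simp only [mul_add, Finset.mul_sum, sub_mul, neg_mul, Finset.sum_mul, Finset.sum_add_distrib,
    Finset.sum_sub_distrib, Finset.sum_neg_distrib]
  rw [h1, h2]
  ring

theorem diffMatAt_insertG (α : Fin 4) :
    DiffMatAt (fun z => Matrix.of (L.insertG z (w z) α)) y := fun β γ => by
  have h1 : DifferentiableAt ℝ (fun z => ∑ μ, L.calG z α μ β γ * L.raiseV z (w z) μ) y :=
    DifferentiableAt.fun_sum fun μ _ =>
      ((h.isParallelAt_calG hy).diff _ _ _ _).fun_mul (h.differentiableAt_raiseV hy hw μ)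
  simpa only [Matrix.of_apply, insertG_eq] using h1

/-- Since 𝒢 and the metric are parallel, ∇_δ(𝒢_{αμ} w^μ) = 𝒢_{αμ} ∇_δ w^μ. The remaining terms are
the Christoffel corrections for the three free indices. -/
theorem matD_insertG (δ α : Fin 4) : matD δ (fun z => Matrix.of (L.insertG z (w z) α)) y =
    (toC (L.chr δ y)).transpose * Matrix.of (L.insertG y (w y) α) +
      Matrix.of (L.insertG y (w y) α) * toC (L.chr δ y) +
      ∑ l, (L.christoffel y l δ α : ℂ) • Matrix.of (L.insertG y (w y) l) +
      Matrix.of (L.insertG y (L.covD1 y w δ) α) := by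
  have hG := h.isParallelAt_calG hy
  have hr := h.differentiableAt_raiseV hy hw
  ext β γ
  simp only [matD, Matrix.of_apply, Matrix.add_apply, Matrix.mul_apply, Matrix.transpose_apply,
    toC_apply, chr, Matrix.sum_apply, Matrix.smul_apply, smul_eq_mul, insertG_eq]
  rw [partialD_sum fun μ _ => (hG.diff α μ β γ).fun_mul (hr μ)]
  simp only [partialD_mul (hG.diff _ _ _ _) (hr _), hG.eq, h.partialD_raiseV hy hw]
  have h1 : ∑ μ, ∑ l, L.calG y α μ β γ * ((L.christoffel y μ δ l : ℂ) * L.raiseV y (w y) l) =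
      ∑ μ, ∑ l, (L.christoffel y l δ μ : ℂ) * L.calG y α l β γ * L.raiseV y (w y) μ := by
    rw [Finset.sum_comm]
    refine Finset.sum_congr rfl fun _ _ => Finset.sum_congr rfl fun _ _ => ?_
    ring
  have h2 : ∑ l, (L.christoffel y l δ α : ℂ) * ∑ μ, L.calG y l μ β γ * L.raiseV y (w y) μ =
      ∑ μ, ∑ l, (L.christoffel y l δ α : ℂ) * L.calG y l μ β γ * L.raiseV y (w y) μ := by
    simp only [Finset.mul_sum]
    rw [Finset.sum_comm]
    refine Finset.sum_congr rfl fun _ _ => Finset.sum_congr rfl fun _ _ => ?_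
    ring
  have h3 : ∑ l, (L.christoffel y l δ β : ℂ) * ∑ μ, L.calG y α μ l γ * L.raiseV y (w y) μ =
      ∑ μ, ∑ l, (L.christoffel y l δ β : ℂ) * L.calG y α μ l γ * L.raiseV y (w y) μ := by
    simp only [Finset.mul_sum]
    rw [Finset.sum_comm]
    refine Finset.sum_congr rfl fun _ _ => Finset.sum_congr rfl fun _ _ => ?_
    ring
  have h4 : ∑ l, (∑ μ, L.calG y α μ β l * L.raiseV y (w y) μ) * (L.christoffel y l δ γ : ℂ) =
      ∑ μ, ∑ l, (L.christoffel y l δ γ : ℂ) * L.calG y α μ β l * L.raiseV y (w y) μ := by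
    simp only [Finset.sum_mul]
    rw [Finset.sum_comm]
    refine Finset.sum_congr rfl fun _ _ => Finset.sum_congr rfl fun _ _ => ?_
    ring
  rw [h2, h3, h4]
  simp only [mul_sub, Finset.mul_sum, Finset.sum_mul, add_mul, Finset.sum_add_distrib,
    Finset.sum_sub_distrib]
  rw [h1]
  ring

end RegularOn

/-! ### The Ricci identity for 𝒰 -/

namespace RegularOn

variable (h : L.RegularOn s) (hy : y ∈ s)
include h hy

theorem matD_calU (hU : ∀ z ∈ s, L.UmbilicalAt z) (α : Fin 4) :
    matD α (fun z => Matrix.of (L.calU z)) y = (toC (L.chr α y)).transpose * Matrix.of (L.calU y) +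
      Matrix.of (L.calU y) * toC (L.chr α y) + L.chi y α • Matrix.of (L.calU y) -
      Matrix.of (L.insertG y (L.xi y) α) := by
  have h1 := L.covD2_eq_matD y L.calU α
  rw [h.covD2_calU_of_umbilical hy (hU y hy)] at h1
  change L.chi y α • Matrix.of (L.calU y) - Matrix.of (L.insertG y (L.xi y) α) = _ at h1
  rw [add_sub_assoc, h1]
  abel

/-- The second structure equation of an umbilical 2+2 structure: the Ricci identity for `𝒰`. -/
theorem curv_calU (hU : ∀ z ∈ s, L.UmbilicalAt z) (δ α : Fin 4) :
    (toC (L.curv δ α y)).transpose * Matrix.of (L.calU y) +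
      Matrix.of (L.calU y) * toC (L.curv δ α y) +
      (partialD δ (fun z => L.chi z α) y - partialD α (fun z => L.chi z δ) y) •
        Matrix.of (L.calU y) -
      Matrix.of (L.insertG y (L.tensorT y δ) α) + Matrix.of (L.insertG y (L.tensorT y α) δ) = 0 := by
  have hxi : ∀ ν, DifferentiableAt ℝ (fun z => L.xi z ν) y := fun ν =>
    (h.smooth_xi ν).differentiableAt_of_isOpen h.isOpen hy
  have hchi : ∀ ν, DifferentiableAt ℝ (fun z => L.chi z ν) y := fun ν =>
    (h.smooth_chi ν).differentiableAt_of_isOpen h.isOpen hy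
  have hsm : SmoothMat s (fun z => Matrix.of (L.calU z)) := h.smooth_calU
  have hu := hsm.diffMatAt h.isOpen hy
  have hc : ∀ b, DiffMatAt (fun z => toC (L.chr b z)) y := fun b =>
    (h.smoothMat_chr b).ofReal.diffMatAt h.isOpen hy
  have hcD : ∀ a b, matD a (fun z => toC (L.chr b z)) y = toC (matD a (L.chr b) y) := fun a b =>
    matD_ofReal ((h.smoothMat_chr b).diffMatAt h.isOpen hy)
  -- Replace ∇ξ by T + χ ⊗ ξ. The contribution of χ ⊗ ξ joins the ξ-term from differentiating χ ⊗ 𝒰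
  -- to form an expression symmetric in the two directions, so it drops out on antisymmetrising.
  have hT : ∀ a b, Matrix.of (L.insertG y (L.covD1 y L.xi a) b) =
      Matrix.of (L.insertG y (L.tensorT y a) b) +
        L.chi y a • Matrix.of (L.insertG y (L.xi y) b) := fun a b => by
    have h1 := L.insertG_sub_smul y (L.covD1 y L.xi a) (L.xi y) (L.chi y a) b
    change L.insertG y (L.tensorT y a) b = _ at h1
    rw [h1]
    exact (sub_add_cancel (Matrix.of (L.insertG y (L.covD1 y L.xi a) b)) _).symm
  have hd : ∀ a b, matD a (fun z => matD b (fun z => Matrix.of (L.calU z)) z) y =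
      (toC (matD a (L.chr b) y)).transpose * Matrix.of (L.calU y) +
      (toC (L.chr b y)).transpose * matD a (fun z => Matrix.of (L.calU z)) y +
      (matD a (fun z => Matrix.of (L.calU z)) y * toC (L.chr b y) +
        Matrix.of (L.calU y) * toC (matD a (L.chr b) y)) +
      (partialD a (fun z => L.chi z b) y • Matrix.of (L.calU y) +
        L.chi y b • matD a (fun z => Matrix.of (L.calU z)) y) -
      matD a (fun z => Matrix.of (L.insertG z (L.xi z) b)) y := fun a b => by
    rw [matD_congr h.isOpen hy fun z hz => h.matD_calU hz hU b,
      matD_sub ((((hc b).transpose.mul hu).add (hu.mul (hc b))).add (hu.smul (hchi b)))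
        (h.diffMatAt_insertG hy hxi b),
      matD_add (((hc b).transpose.mul hu).add (hu.mul (hc b))) (hu.smul (hchi b)),
      matD_add ((hc b).transpose.mul hu) (hu.mul (hc b)), matD_mul (hc b).transpose hu,
      matD_mul hu (hc b), matD_smul (hchi b) hu, matD_transpose, hcD]
  have h1 := matD_comm (μ := δ) (ν := α) h.isOpen hsm hy
  -- Absence of torsion removes the Christoffel terms attached to the differentiation index.
  have hs : ∑ l, (L.christoffel y l δ α : ℂ) • Matrix.of (L.insertG y (L.xi y) l) =
      ∑ l, (L.christoffel y l α δ : ℂ) • Matrix.of (L.insertG y (L.xi y) l) := by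
    simp only [h.christoffel_symm hy _ δ α]
  rw [hd, hd, h.matD_insertG hy hxi, h.matD_insertG hy hxi, h.matD_calU hy hU,
    h.matD_calU hy hU, hs, hT, hT] at h1
  rw [curv_eq]
  simp only [toC_sub, toC_add, toC_mul, Matrix.transpose_sub, Matrix.transpose_add,
    Matrix.transpose_mul]
  generalize ∑ l, (L.christoffel y l α δ : ℂ) • Matrix.of (L.insertG y (L.xi y) l) = Sg at h1
  rw [← sub_eq_zero] at h1
  refine Eq.trans ?_ h1
  simp only [mul_add, add_mul, mul_sub, sub_mul, smul_add, smul_sub, Matrix.mul_smul,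
    Matrix.smul_mul, sub_smul, smul_smul, mul_assoc, mul_comm (L.chi y α) (L.chi y δ)]
  abel

end RegularOn

end LocalFields

/-! ## Curvature tensors in a frame -/

/-- The algebraic symmetries of a curvature tensor. -/
structure IsCurvatureTensor (r : Tensor4) : Prop where
  left : ∀ i j k l, r i j k l = -r j i k l
  pair : ∀ i j k l, r i j k l = r k l i j
  bianchi : ∀ i j k l, r i j k l + r i k l j + r i l j k = 0

namespace LocalFields

variable {L : LocalFields} {s : Set Coord} {y : Coord} {B : Matrix (Fin 4) (Fin 4) ℝ}

/-- The Riemann tensor, with complex values. -/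
def riemC (L : LocalFields) (y : Coord) : Tensor4 := fun α β μ ν => (L.riemann y α β μ ν : ℂ)

/-- The Ricci tensor, with complex values. -/
def ricC (L : LocalFields) (y : Coord) : Tensor2 := fun α β => (L.ricci y α β : ℂ)

/-- The Weyl tensor, with complex values. -/
def weylC (L : LocalFields) (y : Coord) : Tensor4 := fun α β μ ν => (L.weyl y α β μ ν : ℂ)

theorem pull4_apply (B : Matrix (Fin 4) (Fin 4) ℝ) (P : Tensor4) (i j k l : Fin 4) :
    pull4 B P i j k l = ∑ α, ∑ β, ∑ μ, ∑ ν,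
      (B α i : ℂ) * (B β j : ℂ) * (B μ k : ℂ) * (B ν l : ℂ) * P α β μ ν := by
  simp only [pull4, pull_apply, Finset.mul_sum]
  refine Finset.sum_congr rfl fun _ _ => Finset.sum_congr rfl fun _ _ =>
    Finset.sum_congr rfl fun _ _ => Finset.sum_congr rfl fun _ _ => ?_
  ring

theorem pull4_swap_left (B : Matrix (Fin 4) (Fin 4) ℝ) (P : Tensor4) (i j k l : Fin 4) :
    pull4 B (fun α β μ ν => P β α μ ν) i j k l = pull4 B P j i k l := by
  rw [pull4_apply, pull4_apply, Finset.sum_comm]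
  refine Finset.sum_congr rfl fun _ _ => Finset.sum_congr rfl fun _ _ =>
    Finset.sum_congr rfl fun _ _ => Finset.sum_congr rfl fun _ _ => ?_
  ring

theorem pull4_swap_mid (B : Matrix (Fin 4) (Fin 4) ℝ) (P : Tensor4) (i j k l : Fin 4) :
    pull4 B (fun α β μ ν => P α μ β ν) i j k l = pull4 B P i k j l := by
  rw [pull4_apply, pull4_apply]
  refine Finset.sum_congr rfl fun _ _ => ?_
  rw [Finset.sum_comm]
  refine Finset.sum_congr rfl fun _ _ =>
    Finset.sum_congr rfl fun _ _ => Finset.sum_congr rfl fun _ _ => ?_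
  ring

theorem pull4_swap_right (B : Matrix (Fin 4) (Fin 4) ℝ) (P : Tensor4) (i j k l : Fin 4) :
    pull4 B (fun α β μ ν => P α β ν μ) i j k l = pull4 B P i j l k := by
  rw [pull4_apply, pull4_apply]
  refine Finset.sum_congr rfl fun _ _ => Finset.sum_congr rfl fun _ _ => ?_
  rw [Finset.sum_comm]
  refine Finset.sum_congr rfl fun _ _ => Finset.sum_congr rfl fun _ _ => ?_
  ring

theorem _root_.IsCurvatureTensor.pull4 {P : Tensor4} (hP : IsCurvatureTensor P)
    (B : Matrix (Fin 4) (Fin 4) ℝ) : IsCurvatureTensor (pull4 B P) where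
  left i j k l := by
    have h1 : P = fun α β μ ν => -1 * P β α μ ν := by
      funext α β μ ν
      rw [hP.left, neg_one_mul]
    have h2 := congrArg (fun Q => _root_.pull4 B Q i j k l) h1
    simp only [LocalFields.FrameAt.pull4_const_mul] at h2
    rw [h2, pull4_swap_left B P, neg_one_mul]
  pair i j k l := by
    have h1 : P = fun α β μ ν => P μ ν α β := by
      funext α β μ ν
      rw [hP.pair]
    conv_lhs => rw [h1]
    rw [pull4_swap_mid B (fun α μ β ν => P μ ν α β), pull4_swap_left B (fun μ α β ν => P μ ν α β),
      pull4_swap_right B (fun μ α ν β => P μ ν α β), pull4_swap_mid B (fun μ ν α β => P μ ν α β)]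
  bianchi i j k l := by
    have h1 : (fun α β μ ν => P α β μ ν + P α μ ν β + P α ν β μ) =
        fun α β μ ν => 0 * P α β μ ν := by
      funext α β μ ν
      rw [hP.bianchi, zero_mul]
    have h2 := congrArg (fun Q => _root_.pull4 B Q i j k l) h1
    simp only [LocalFields.FrameAt.pull4_add, LocalFields.FrameAt.pull4_const_mul] at h2
    rw [zero_mul] at h2
    rw [← h2, pull4_swap_mid B (fun α μ β ν => P α μ ν β), pull4_swap_right B P,
      pull4_swap_right B (fun α β ν μ => P α ν β μ), pull4_swap_mid B P]

namespace RegularOn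

variable (h : L.RegularOn s) (hy : y ∈ s)
include h hy

theorem isCurvatureTensor_riemC : IsCurvatureTensor (L.riemC y) where
  left α β μ ν := by simp only [riemC]; exact_mod_cast h.riemann_antisymm_left hy α β μ ν
  pair α β μ ν := by simp only [riemC]; exact_mod_cast h.riemann_pair_symm hy α β μ ν
  bianchi α β μ ν := by simp only [riemC]; exact_mod_cast h.riemann_bianchi hy α β μ ν

/-- The curvature matrices in terms of the Riemann tensor. -/
theorem curv_eq_gInvMat_mul (δ α : Fin 4) :
    L.curv δ α y = L.gInvMat y * Matrix.of (fun μ ν => L.riemann y δ α μ ν) := by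
  obtain ⟨C, hC⟩ := h.exists_coframeAt y hy
  have h1 : L.gMat y * L.curv δ α y = Matrix.of (fun μ ν => L.riemann y δ α μ ν) := by
    ext μ ν
    rw [Matrix.of_apply, h.riemann_pair_symm hy]
    rfl
  rw [← h1, ← mul_assoc, hC.gInv_mul, one_mul]

variable (hB : L.FrameAt y B)
include hB

theorem pull_curv_calU (δ α : Fin 4) :
    pull B (fun β γ => ((toC (L.curv δ α y)).transpose * Matrix.of (L.calU y) +
      Matrix.of (L.calU y) * toC (L.curv δ α y)) β γ) = fun i j =>
      ∑ p, (minkowski p p : ℂ) * (pull B (L.riemC y δ α) p i * minkowskiModel.calU 0 p j +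
        minkowskiModel.calU 0 i p * pull B (L.riemC y δ α) p j) := by
  have h1 : (toC B)⁻¹ = toC B⁻¹ := Matrix.inv_eq_left_inv hB.toC_inv_mul
  set R : Matrix (Fin 4) (Fin 4) ℂ := Matrix.of (L.riemC y δ α) with hR
  have h2 : toC (L.curv δ α y) = toC B * toC (Matrix.of minkowski) * (toC B).transpose * R := by
    rw [h.curv_eq_gInvMat_mul hy, toC_mul, hB.gInvMat_eq, toC_mul, toC_mul, toC_transpose]
    rfl
  set m := toC (Matrix.of minkowski) with hm
  have hmT : m.transpose = m := by
    rw [hm, ← toC_transpose, minkowski_transpose]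
  have h3 : pull B (fun β γ => ((toC (L.curv δ α y)).transpose * Matrix.of (L.calU y) +
      Matrix.of (L.calU y) * toC (L.curv δ α y)) β γ) =
      (m * Matrix.of (pull B (L.riemC y δ α))).transpose * Matrix.of (minkowskiModel.calU 0) +
      Matrix.of (minkowskiModel.calU 0) * (m * Matrix.of (pull B (L.riemC y δ α))) := by
    rw [← hB.pull_calU, pull_eq, pull_eq, ← hR]
    change (toC B).transpose * ((toC (L.curv δ α y)).transpose * Matrix.of (L.calU y) +
      Matrix.of (L.calU y) * toC (L.curv δ α y)) * toC B = _
    rw [h2]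
    simp only [Matrix.transpose_mul, Matrix.transpose_transpose, hmT, mul_add, add_mul, mul_assoc]
  rw [h3]
  funext i j
  rw [hm, minkowski_eq_diagonal]
  change (_ : ℂ) + _ = _
  simp [Matrix.mul_apply, Fin.sum_univ_four, toC_apply, Matrix.diagonal_apply, minkowski]
  ring

/-- The second structure equation in a frame. -/
theorem frame_curv_calU (hU : ∀ z ∈ s, L.UmbilicalAt z) : ∃ X : Tensor2, ∀ d a i j,
    ∑ p, (minkowski p p : ℂ) * (pull4 B (L.riemC y) d a p i * minkowskiModel.calU 0 p j +
        minkowskiModel.calU 0 i p * pull4 B (L.riemC y) d a p j) +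
      X d a * minkowskiModel.calU 0 i j -
      ∑ p, (minkowski p p : ℂ) * (minkowskiModel.calG 0 a p i j * pull B (L.tensorT y) d p) +
      ∑ p, (minkowski p p : ℂ) * (minkowskiModel.calG 0 d p i j * pull B (L.tensorT y) a p) = 0 := by
  -- This is dχ. Only its position as coefficient of 𝒰 matters, because the components used later
  -- are orthogonal to 𝒰.
  let x : Tensor2 := fun δ α =>
    partialD δ (fun z => L.chi z α) y - partialD α (fun z => L.chi z δ) y
  refine ⟨pull B x, fun d a i j => ?_⟩
  have h1 : ∀ δ α, (fun β γ => ((toC (L.curv δ α y)).transpose * Matrix.of (L.calU y) +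
      Matrix.of (L.calU y) * toC (L.curv δ α y)) β γ) + x δ α • L.calU y -
      L.insertG y (L.tensorT y δ) α + L.insertG y (L.tensorT y α) δ = 0 :=
    fun δ α => h.curv_calU hy hU δ α
  have h2 : ∀ δ α, pull B (fun β γ => ((toC (L.curv δ α y)).transpose * Matrix.of (L.calU y) +
      Matrix.of (L.calU y) * toC (L.curv δ α y)) β γ) i j + x δ α * minkowskiModel.calU 0 i j -
      pull B (L.insertG y (L.tensorT y δ) α) i j +
      pull B (L.insertG y (L.tensorT y α) δ) i j = 0 := fun δ α => by
    have h3 := congrFun (congrFun (congrArg (pull B) (h1 δ α)) i) j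
    rw [map_add, map_sub, map_add, map_smul, hB.pull_calU, map_zero] at h3
    exact h3
  simp only [h.pull_curv_calU hy hB] at h2
  have h4 : ∑ δ, ∑ α, (B δ d : ℂ) * (B α a : ℂ) *
      (∑ p, (minkowski p p : ℂ) * (pull B (L.riemC y δ α) p i * minkowskiModel.calU 0 p j +
        minkowskiModel.calU 0 i p * pull B (L.riemC y δ α) p j) +
        x δ α * minkowskiModel.calU 0 i j -
      pull B (L.insertG y (L.tensorT y δ) α) i j +
      pull B (L.insertG y (L.tensorT y α) δ) i j) = 0 := by
    simp only [h2, mul_zero, Finset.sum_const_zero]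
  have hK : ∀ d a, ∑ δ, ∑ α, (B δ d : ℂ) * (B α a : ℂ) *
      pull B (L.insertG y (L.tensorT y δ) α) i j =
      ∑ p, (minkowski p p : ℂ) * (minkowskiModel.calG 0 a p i j * pull B (L.tensorT y) d p) := by
    intro d a
    have h5 : ∀ p, pull B (L.tensorT y) d p = ∑ δ, (B δ d : ℂ) * pullv B (L.tensorT y δ) p :=
      fun p => by
        simp only [pull_apply, pullv, Finset.mul_sum, mul_assoc]
    have h6 := fun δ => hB.pull3_insertG (L.tensorT y δ) a i j
    simp only [pull3_apply] at h6
    simp only [mul_assoc, ← Finset.mul_sum, h6, h5]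
    simp only [Finset.mul_sum]
    rw [Finset.sum_comm]
    refine Finset.sum_congr rfl fun _ _ => Finset.sum_congr rfl fun _ _ => ?_
    ring
  have hK' : ∑ δ, ∑ α, (B δ d : ℂ) * (B α a : ℂ) *
      pull B (L.insertG y (L.tensorT y α) δ) i j =
      ∑ p, (minkowski p p : ℂ) * (minkowskiModel.calG 0 d p i j * pull B (L.tensorT y) a p) := by
    rw [← hK, Finset.sum_comm]
    refine Finset.sum_congr rfl fun _ _ => Finset.sum_congr rfl fun _ _ => ?_
    ring
  simp only [mul_add, mul_sub, Finset.sum_add_distrib, Finset.sum_sub_distrib] at h4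
  rw [hK, hK'] at h4
  rw [← h4]
  congr 2
  have hr : ∀ p q, pull4 B (L.riemC y) d a p q =
      ∑ δ, ∑ α, (B δ d : ℂ) * (B α a : ℂ) * pull B (L.riemC y δ α) p q := fun p q => by
    rw [pull4, pull_apply]
  congr 1
  · simp only [hr, mul_add, Finset.sum_add_distrib, Fin.sum_univ_four]
    ring
  · rw [pull_apply]
    simp only [Finset.sum_mul, mul_assoc]

end RegularOn

end LocalFields

/-! ### Algebraic curvature tensors and their Weyl parts -/

/-- The Ricci tensor of an algebraic curvature tensor in an orthonormal frame. -/
def ricHat (r : Tensor4) : Tensor2 := fun i j => ∑ p, (minkowski p p : ℂ) * r p i p j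

/-- The scalar curvature of an algebraic curvature tensor in an orthonormal frame. -/
def scalarHat (r : Tensor4) : ℂ := ∑ i, (minkowski i i : ℂ) * ricHat r i i

/-- The Weyl tensor of an algebraic curvature tensor in an orthonormal frame. -/
def weylHat (r : Tensor4) : Tensor4 := fun i j k l => r i j k l
    - 1 / 2 * (minkowski i k * ricHat r j l + minkowski j l * ricHat r i k
      - minkowski i l * ricHat r j k - minkowski j k * ricHat r i l)
    + scalarHat r / 6 * (minkowski i k * minkowski j l - minkowski i l * minkowski j k)

/-- The algebraic symmetries of a Weyl tensor in an orthonormal frame. -/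
structure IsWeylTensor (w : Tensor4) : Prop extends IsCurvatureTensor w where
  trace : ∀ i j, ∑ p, (minkowski p p : ℂ) * w p i p j = 0

namespace IsCurvatureTensor

variable {r : Tensor4} (hr : IsCurvatureTensor r)
include hr

theorem right (i j k l : Fin 4) : r i j k l = -r i j l k := by
  rw [hr.pair, hr.left, hr.pair l k]

theorem diag_left (i k l : Fin 4) : r i i k l = 0 := by
  have := hr.left i i k l
  linear_combination (1 / 2) * this

theorem diag_right (i k l : Fin 4) : r k l i i = 0 := by
  rw [hr.pair, hr.diag_left]

/-- Rewriting of the components of a curvature tensor in terms of the independent ones. -/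
theorem normalize : (∀ i k l, r i i k l = 0) ∧ (∀ i k l, r k l i i = 0) ∧
    (∀ k l, r 1 0 k l = -r 0 1 k l ∧ r 2 0 k l = -r 0 2 k l ∧ r 3 0 k l = -r 0 3 k l ∧
      r 2 1 k l = -r 1 2 k l ∧ r 3 1 k l = -r 1 3 k l ∧ r 3 2 k l = -r 2 3 k l) ∧
    (∀ k l, r k l 1 0 = -r k l 0 1 ∧ r k l 2 0 = -r k l 0 2 ∧ r k l 3 0 = -r k l 0 3 ∧
      r k l 2 1 = -r k l 1 2 ∧ r k l 3 1 = -r k l 1 3 ∧ r k l 3 2 = -r k l 2 3) ∧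
    (r 0 2 0 1 = r 0 1 0 2 ∧ r 0 3 0 1 = r 0 1 0 3 ∧ r 1 2 0 1 = r 0 1 1 2 ∧
      r 1 3 0 1 = r 0 1 1 3 ∧ r 2 3 0 1 = r 0 1 2 3 ∧ r 0 3 0 2 = r 0 2 0 3 ∧
      r 1 2 0 2 = r 0 2 1 2 ∧ r 1 3 0 2 = r 0 2 1 3 ∧ r 2 3 0 2 = r 0 2 2 3 ∧
      r 1 2 0 3 = r 0 2 1 3 - r 0 1 2 3 ∧ r 1 3 0 3 = r 0 3 1 3 ∧ r 2 3 0 3 = r 0 3 2 3 ∧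
      r 1 3 1 2 = r 1 2 1 3 ∧ r 2 3 1 2 = r 1 2 2 3 ∧ r 2 3 1 3 = r 1 3 2 3 ∧
      r 0 3 1 2 = r 0 2 1 3 - r 0 1 2 3) := by
  have hb : r 0 3 1 2 = r 0 2 1 3 - r 0 1 2 3 := by
    linear_combination hr.bianchi 0 1 2 3 - hr.right 0 2 3 1
  refine ⟨hr.diag_left, hr.diag_right, fun k l => ⟨hr.left _ _ _ _, hr.left _ _ _ _,
    hr.left _ _ _ _, hr.left _ _ _ _, hr.left _ _ _ _, hr.left _ _ _ _⟩,
    fun k l => ⟨hr.right _ _ _ _, hr.right _ _ _ _,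
    hr.right _ _ _ _, hr.right _ _ _ _, hr.right _ _ _ _, hr.right _ _ _ _⟩,
    hr.pair _ _ _ _, hr.pair _ _ _ _, hr.pair _ _ _ _, hr.pair _ _ _ _, hr.pair _ _ _ _,
    hr.pair _ _ _ _, hr.pair _ _ _ _, hr.pair _ _ _ _, hr.pair _ _ _ _,
    (hr.pair _ _ _ _).trans hb, hr.pair _ _ _ _, hr.pair _ _ _ _, hr.pair _ _ _ _,
    hr.pair _ _ _ _, hr.pair _ _ _ _, hb⟩

theorem ricHat_symm (i j : Fin 4) : ricHat r i j = ricHat r j i :=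
  Finset.sum_congr rfl fun p _ => by rw [hr.pair]

/-- The trace-free identity depends on dimension four: the coefficients 1/2 and 1/6 are those of the
Weyl tensor in that dimension. -/
theorem isWeylTensor_weylHat : IsWeylTensor (weylHat r) where
  left i j k l := by
    simp only [weylHat]
    rw [hr.left]
    ring
  pair i j k l := by
    have hm : ∀ i j, (minkowski i j : ℂ) = minkowski j i := fun i j => by
      simp only [minkowski, eq_comm (a := i)]
      split_ifs with h1 h2 h3 <;> simp_all
    simp only [weylHat]
    rw [hr.pair, hr.ricHat_symm l j, hr.ricHat_symm k i, hr.ricHat_symm l i, hr.ricHat_symm k j,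
      hm k i, hm l j, hm k j, hm l i]
    ring
  bianchi i j k l := by
    have hm : ∀ i j, (minkowski i j : ℂ) = minkowski j i := fun i j => by
      simp only [minkowski, eq_comm (a := i)]
      split_ifs with h1 h2 h3 <;> simp_all
    simp only [weylHat]
    rw [hr.ricHat_symm l j, hr.ricHat_symm k j, hr.ricHat_symm l k, hm l j, hm k j, hm l k]
    linear_combination hr.bianchi i j k l
  trace i j := by
    have hd := hr.diag_left
    have hs : scalarHat r = -ricHat r 0 0 + ricHat r 1 1 + ricHat r 2 2 + ricHat r 3 3 := by
      simp [scalarHat, Fin.sum_univ_four, minkowski]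
    have hR : ricHat r i j = -r 0 i 0 j + r 1 i 1 j + r 2 i 2 j + r 3 i 3 j := by
      simp [ricHat, Fin.sum_univ_four, minkowski]
    simp only [weylHat, hs, Fin.sum_univ_four]
    generalize hq : ricHat r = q at *
    have hsym := hr.ricHat_symm
    rw [hq] at hsym
    have e : (minkowski 0 0 : ℂ) * r 0 i 0 j + minkowski 1 1 * r 1 i 1 j +
        minkowski 2 2 * r 2 i 2 j + minkowski 3 3 * r 3 i 3 j = q i j := by
      rw [hR]; simp [minkowski]
    -- The Riemann contribution to the trace is isolated as the Ricci component q i j. What remains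
    -- is an identity in q alone.
    refine Eq.trans (b := (q i j + -(minkowski 0 0 : ℂ) * (1 / 2 * (minkowski 0 0 * q i j +
      minkowski i j * q 0 0 - minkowski 0 j * q i 0 - minkowski i 0 * q 0 j) -
      (-q 0 0 + q 1 1 + q 2 2 + q 3 3) / 6 *
        (minkowski 0 0 * minkowski i j - minkowski 0 j * minkowski i 0)) +
      -(minkowski 1 1 : ℂ) * (1 / 2 * (minkowski 1 1 * q i j +
      minkowski i j * q 1 1 - minkowski 1 j * q i 1 - minkowski i 1 * q 1 j) -
      (-q 0 0 + q 1 1 + q 2 2 + q 3 3) / 6 *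
        (minkowski 1 1 * minkowski i j - minkowski 1 j * minkowski i 1)) +
      -(minkowski 2 2 : ℂ) * (1 / 2 * (minkowski 2 2 * q i j +
      minkowski i j * q 2 2 - minkowski 2 j * q i 2 - minkowski i 2 * q 2 j) -
      (-q 0 0 + q 1 1 + q 2 2 + q 3 3) / 6 *
        (minkowski 2 2 * minkowski i j - minkowski 2 j * minkowski i 2)) +
      -(minkowski 3 3 : ℂ) * (1 / 2 * (minkowski 3 3 * q i j +
      minkowski i j * q 3 3 - minkowski 3 j * q i 3 - minkowski i 3 * q 3 j) -
      (-q 0 0 + q 1 1 + q 2 2 + q 3 3) / 6 *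
        (minkowski 3 3 * minkowski i j - minkowski 3 j * minkowski i 3)))) ?_ ?_
    · rw [← e]; ring
    · clear hR e
      fin_cases i <;> fin_cases j <;> simp [minkowski] <;> ring

end IsCurvatureTensor

namespace LocalFields

variable {L : LocalFields} {s : Set Coord} {y : Coord} {B : Matrix (Fin 4) (Fin 4) ℝ}

namespace RegularOn

variable (h : L.RegularOn s) (hy : y ∈ s) (hB : L.FrameAt y B)
include h hy hB

theorem pull_ricC : pull B (L.ricC y) = ricHat (pull4 B (L.riemC y)) := by
  have h1 : L.ricC y = ∑ ρ, ∑ l, (L.gInv y ρ l : ℂ) • (fun σ ν => L.riemC y l σ ρ ν : Tensor2) := by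
    funext σ ν
    simp only [Finset.sum_apply, Pi.smul_apply, smul_eq_mul, riemC, ricC, ricci]
    push_cast
    refine Finset.sum_congr rfl fun ρ _ => ?_
    have h2 := congrFun (congrFun (h.curv_eq_gInvMat_mul hy ρ ν) ρ) σ
    rw [Matrix.mul_apply] at h2
    change L.riemannUp y ρ σ ρ ν = _ at h2
    rw [h2]
    push_cast
    refine Finset.sum_congr rfl fun l _ => ?_
    rw [Matrix.of_apply, h.riemann_pair_symm hy ρ ν l σ]
    rfl
  funext i j
  have h3 := hB.sum_gInv (fun ρ l => pull B (fun σ ν => L.riemC y l σ ρ ν) i j)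
  rw [h1]
  simp only [map_sum, map_smul, Finset.sum_apply, Pi.smul_apply, smul_eq_mul]
  rw [h3]
  refine Finset.sum_congr rfl fun p _ => ?_
  congr 1
  have h4 : pull4 B (L.riemC y) p i p j = pull4 B (fun l ρ σ ν => L.riemC y l σ ρ ν) p p i j :=
    pull4_swap_mid B (fun l ρ σ ν => L.riemC y l σ ρ ν) p i p j
  have h5 : pull4 B (fun l ρ σ ν => L.riemC y l σ ρ ν) p p i j =
      pull4 B (fun ρ l σ ν => L.riemC y l σ ρ ν) p p i j :=
    pull4_swap_left B (fun ρ l σ ν => L.riemC y l σ ρ ν) p p i j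
  rw [h4, h5, pull4]

theorem scalarCurv_eq : (L.scalarCurv y : ℂ) = scalarHat (pull4 B (L.riemC y)) := by
  have h3 := hB.sum_gInv (L.ricC y)
  rw [h.pull_ricC hy hB] at h3
  rw [scalarHat, ← h3]
  simp only [scalarCurv, ricC]
  push_cast
  rfl

theorem pull4_weylC : pull4 B (L.weylC y) = weylHat (pull4 B (L.riemC y)) := by
  obtain ⟨G, hG'⟩ : ∃ G : Tensor2, G = fun α β => (L.g y α β : ℂ) := ⟨_, rfl⟩
  have h1 : L.weylC y = fun α β μ ν => L.riemC y α β μ ν +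
      (-1 / 2 * (G α μ * L.ricC y β ν + (L.ricC y α μ * G β ν +
        (-1 * (G α ν * L.ricC y β μ) + -1 * (L.ricC y α ν * G β μ)))) +
        (L.scalarCurv y : ℂ) / 6 * (G α μ * G β ν + -1 * (G α ν * G β μ))) := by
    funext α β μ ν
    simp only [weylC, weyl, riemC, ricC, hG']
    push_cast
    ring
  have hm := FrameAt.pull4_tensor_mid B
  have hc := FrameAt.pull4_tensor_cross B
  have hG : pull B G = fun i j => (minkowski i j : ℂ) := hG' ▸ hB.pull_g
  rw [h1]
  simp only [FrameAt.pull4_add, FrameAt.pull4_const_mul, hm G (L.ricC y), hm (L.ricC y) G,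
    hc G (L.ricC y), hc (L.ricC y) G, hm G G, hc G G, hG, h.pull_ricC hy hB,
    h.scalarCurv_eq hy hB]
  funext i j k l
  simp only [weylHat]
  ring

omit h hy in
theorem pull4_calW : pull4 B (L.calW y) = fun i j k l => 1 / 2 * (pull4 B (L.weylC y) i j k l -
    Complex.I * minkowskiModel.comp 0 (minkowskiModel.eta 0) (pull4 B (L.weylC y)) i j k l) := by
  have h1 : L.calW y = fun α β μ ν => 1 / 2 * (L.weylC y α β μ ν +
      -Complex.I * L.comp y (L.eta y) (L.weylC y) α β μ ν) := by
    funext α β μ ν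
    change 1 / 2 * (L.weylC y α β μ ν -
      Complex.I * L.comp y (L.eta y) (L.weylC y) α β μ ν) = _
    ring
  rw [h1, FrameAt.pull4_const_mul, FrameAt.pull4_add, FrameAt.pull4_const_mul, hB.pull4_comp,
    hB.pull4_eta]
  funext i j k l
  ring

end RegularOn

end LocalFields

/-! ### The self-dual Weyl tensor from the second structure equation -/

/-- The self-dual part `½ (w - i *w)` of a double 2-form in an orthonormal frame. -/
def selfDualHat (w : Tensor4) : Tensor4 := fun i j k l => 1 / 2 * (w i j k l -
    Complex.I * LocalFields.comp minkowskiModel 0 (LocalFields.eta minkowskiModel 0) w i j k l)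

namespace LocalFields

/-- The components of the self-dual part of a curvature tensor. -/
theorem selfDualHat_eq {w : Tensor4} (hw : IsCurvatureTensor w) (k l : Fin 4) :
    selfDualHat w 0 1 k l = 1 / 2 * (w 0 1 k l - Complex.I * w 2 3 k l) ∧
    selfDualHat w 0 2 k l = 1 / 2 * (w 0 2 k l + Complex.I * w 1 3 k l) ∧
    selfDualHat w 0 3 k l = 1 / 2 * (w 0 3 k l - Complex.I * w 1 2 k l) := by
  have h1 : ∀ i j, minkowskiModel.comp 0 (minkowskiModel.eta 0) w i j k l =
      minkowskiModel.hodge 0 (fun μ ν => w μ ν k l) i j := fun _ _ => rfl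
  simp only [selfDualHat, h1]
  rw [hodge_minkowskiModel (fun i j => hw.left i j k l)]
  refine ⟨?_, ?_, ?_⟩ <;> simp

/-- The components of the self-dual Weyl tensor, from the second structure equation. -/
theorem frame_algebra {r : Tensor4} (hr : IsCurvatureTensor r) {t x : Tensor2}
    (hE : ∀ d a i j, ∑ p, (minkowski p p : ℂ) * (r d a p i * calUHat p j +
        calUHat i p * r d a p j) + x d a * calUHat i j -
      ∑ p, (minkowski p p : ℂ) * (minkowskiModel.calG 0 a p i j * t d p) +
      ∑ p, (minkowski p p : ℂ) * (minkowskiModel.calG 0 d p i j * t a p) = 0)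
    {a : Tensor2} (ha : ∀ i j, a i j = 1 / 2 * (t i j - t j i)) {Om z2 z3 : ℂ}
    (hO : Om = -(scalarHat r / 12 + 1 / 2 * (a 0 1 - Complex.I * a 2 3)))
    (h2 : z2 = 1 / 2 * (a 0 2 + Complex.I * a 1 3))
    (h3 : z3 = 1 / 2 * (a 0 3 - Complex.I * a 1 2)) :
    selfDualHat (weylHat r) 0 1 0 1 = Om ∧ selfDualHat (weylHat r) 0 1 0 2 = -(1 / 2) * z2 ∧
    selfDualHat (weylHat r) 0 1 0 3 = -(1 / 2) * z3 ∧
    selfDualHat (weylHat r) 0 2 0 2 = -(1 / 2) * Om ∧ selfDualHat (weylHat r) 0 2 0 3 = 0 ∧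
    selfDualHat (weylHat r) 0 3 0 3 = -(1 / 2) * Om := by
  have hI := Complex.I_mul_I
  obtain ⟨n1, n2, n3, n4, n5⟩ := hr.normalize
  have hS := selfDualHat_eq hr.isWeylTensor_weylHat.toIsCurvatureTensor
  -- All selected equations have (i, j) equal to (0, 2) or (0, 3), where 𝒰 vanishes; the unknown x
  -- therefore drops out.
  have e0203 := hE 0 2 0 3
  have e0302 := hE 0 3 0 2
  have e1202 := hE 1 2 0 2
  have e1303 := hE 1 3 0 3
  have e0103 := hE 0 1 0 3
  have e2303 := hE 2 3 0 3
  have e0102 := hE 0 1 0 2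
  have e2302 := hE 2 3 0 2
  have e0202 := hE 0 2 0 2
  have e1203 := hE 1 2 0 3
  have e0303 := hE 0 3 0 3
  have e1302 := hE 1 3 0 2
  clear hE
  simp [Fin.sum_univ_four, minkowski, calUHat, calG_minkowskiModel, leviCivita, n2, n4,
    n5] at e0203 e0302 e1202 e1303 e0103 e2303 e0102 e2302 e0202 e1203 e0303 e1302
  subst hO h2 h3
  simp only [ha, hS]
  simp only [weylHat, scalarHat, ricHat, Fin.sum_univ_four]
  simp [minkowski, n1, n2, n3, n4, n5]
  -- Each combination pairs the equations for (d, a) and its dual pair with relative factor ±i,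
  -- which takes the self-dual part in (d, a). The trace-free Ricci tensor exchanges self-dual and
  -- anti-self-dual bivectors, so only the Weyl tensor and the scalar curvature remain.
  refine ⟨?_, ?_, ?_, ?_, ?_, ?_⟩
  · linear_combination (norm := (ring_nf; simp only [Complex.I_sq]; ring))
      Complex.I / 4 * e0203 - Complex.I / 4 * e0302 - 1 / 4 * e1202 - 1 / 4 * e1303
  · linear_combination (norm := (ring_nf; simp only [Complex.I_sq]; ring))
      -Complex.I / 4 * e0103 - 1 / 4 * e2303
  · linear_combination (norm := (ring_nf; simp only [Complex.I_sq]; ring))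
      Complex.I / 4 * e0102 + 1 / 4 * e2302
  · linear_combination (norm := (ring_nf; simp only [Complex.I_sq]; ring))
      -Complex.I / 4 * e0203 + 1 / 4 * e1303
  · linear_combination (norm := (ring_nf; simp only [Complex.I_sq]; ring))
      Complex.I / 4 * e0202 - 1 / 4 * e1203 - Complex.I / 4 * e0303 - 1 / 4 * e1302
  · linear_combination (norm := (ring_nf; simp only [Complex.I_sq]; ring))
      Complex.I / 4 * e0302 + 1 / 4 * e1202

end LocalFields

/-- The SD bivector orthogonal to the canonical one with the given components in a frame. -/
def zHat (p q : ℂ) : Tensor2 :=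
  ![![0, 0, p, q], ![0, 0, Complex.I * q, -Complex.I * p], ![-p, -Complex.I * q, 0, 0],
    ![-q, Complex.I * p, 0, 0]]

namespace LocalFields

variable {L : LocalFields} {s : Set Coord} {y : Coord} {B : Matrix (Fin 4) (Fin 4) ℝ}

theorem pairing_minkowskiModel (F H : Tensor2) : minkowskiModel.pairing 0 F H =
    1 / 2 * ∑ i, ∑ j, F i j * (minkowski i i * minkowski j j * H i j) := by
  simp only [pairing, raise_minkowskiModel]

theorem inv_sqrt_two_mul_self : ((1 / √2 : ℝ) : ℂ) * ((1 / √2 : ℝ) : ℂ) = 1 / 2 := by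
  rw [← Complex.ofReal_mul, div_mul_div_comm, Real.mul_self_sqrt (by norm_num)]
  norm_num

theorem pairing_calUHat {F : Tensor2} (hF : ∀ i j, F i j = -F j i) :
    minkowskiModel.pairing 0 F calUHat = F 0 1 - Complex.I * F 2 3 := by
  have h1 := hF 1 0
  have h2 := hF 3 2
  rw [pairing_minkowskiModel]
  simp [Fin.sum_univ_four, minkowski, calUHat, h1, h2]
  ring

theorem act_calGperp_minkowskiModel {F : Tensor2} (hF : ∀ i j, F i j = -F j i) :
    minkowskiModel.act 0 (minkowskiModel.calGperp 0) F =
      zHat (1 / 2 * (F 0 2 + Complex.I * F 1 3)) (1 / 2 * (F 0 3 - Complex.I * F 1 2)) := by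
  have hd : ∀ i, F i i = 0 := fun i => by
    have := hF i i
    linear_combination (1 / 2) * this
  have h1 := hF 1 0; have h2 := hF 2 0; have h3 := hF 3 0; have h4 := hF 2 1; have h5 := hF 3 1
  have h6 := hF 3 2
  have hI := Complex.I_mul_I
  have hk := inv_sqrt_two_mul_self
  have hu := calU_minkowskiModel
  generalize ((1 / √2 : ℝ) : ℂ) = κ at hk hu
  funext i j
  simp only [act_apply, contract, raise_minkowskiModel, calGperp, hu, calG_minkowskiModel,
    Pi.smul_apply, smul_eq_mul]
  fin_cases i <;> fin_cases j <;>
    simp [Fin.sum_univ_four, minkowski, calUHat, leviCivita, zHat, hd, h1, h2, h3, h4, h5, h6] <;>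
    grind

/-- The data of an umbilical 2+2 structure in an adapted frame: the components of the self-dual
Weyl tensor are given by `Ω` and `𝒵`. -/
structure SelfDualFrame (L : LocalFields) (y : Coord) (B : Matrix (Fin 4) (Fin 4) ℝ)
    (p q : ℂ) : Prop where
  frameAt : L.FrameAt y B
  isWeylTensor : IsWeylTensor (pull4 B (L.weylC y))
  calW : pull4 B (L.calW y) = selfDualHat (pull4 B (L.weylC y))
  calZ : pull B (L.calZ y) = ((1 / √2 : ℝ) : ℂ) • zHat p q
  calW_0101 : selfDualHat (pull4 B (L.weylC y)) 0 1 0 1 = L.Omega y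
  calW_0102 : selfDualHat (pull4 B (L.weylC y)) 0 1 0 2 = -(1 / 2) * p
  calW_0103 : selfDualHat (pull4 B (L.weylC y)) 0 1 0 3 = -(1 / 2) * q
  calW_0202 : selfDualHat (pull4 B (L.weylC y)) 0 2 0 2 = -(1 / 2) * L.Omega y
  calW_0203 : selfDualHat (pull4 B (L.weylC y)) 0 2 0 3 = 0
  calW_0303 : selfDualHat (pull4 B (L.weylC y)) 0 3 0 3 = -(1 / 2) * L.Omega y

/-- Here the differential geometry ends: an umbilical structure yields a frame in which 𝒲 has the
normal form fixed by Ω and 𝒵, and everything after is algebra at one point. -/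
theorem RegularOn.exists_selfDualFrame (h : L.RegularOn s) (hy : y ∈ s)
    (hU : ∀ z ∈ s, L.UmbilicalAt z) : ∃ B p q, L.SelfDualFrame y B p q := by
  obtain ⟨B, hB⟩ := h.exists_frameAt hy
  obtain ⟨X, hX⟩ := h.frame_curv_calU hy hB hU
  have hk := inv_sqrt_two_mul_self
  have hu := calU_minkowskiModel
  have hr := (h.isCurvatureTensor_riemC hy).pull4 B
  set r := pull4 B (L.riemC y) with hrdef
  obtain ⟨κ, hκ⟩ : ∃ κ : ℂ, κ = ((1 / √2 : ℝ) : ℂ) := ⟨_, rfl⟩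
  rw [← hκ] at hk hu
  -- Since κ² = ½, the factor 2κ is the inverse of κ. With T = κ t every term of the structure
  -- equation other than dχ ⊗ 𝒰 is visibly κ times a normalised one, and dχ ⊗ 𝒰 carries its κ in 𝒰,
  -- so κ cancels.
  set t : Tensor2 := (2 * κ) • pull B (L.tensorT y) with ht
  have hT : ∀ i j, pull B (L.tensorT y) i j = κ * t i j := fun i j => by
    rw [ht, Pi.smul_apply, Pi.smul_apply, smul_eq_mul]
    linear_combination (-2 * pull B (L.tensorT y) i j) * hk
  set a : Tensor2 := fun i j => 1 / 2 * (t i j - t j i) with ha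
  have haa : ∀ i j, a i j = -a j i := fun i j => by simp only [ha]; ring
  have hA : pull B (L.tensorA y) = κ • a := by
    funext i j
    have h1 : pull B (L.tensorA y) i j =
        1 / 2 * (pull B (L.tensorT y) i j - pull B (L.tensorT y) j i) := by
      rw [pull_apply, pull_apply, pull_apply, Finset.sum_comm (s := Finset.univ)
        (f := fun α β => (B α j : ℂ) * (B β i : ℂ) * L.tensorT y α β), ← Finset.sum_sub_distrib,
        Finset.mul_sum]
      refine Finset.sum_congr rfl fun _ _ => ?_
      rw [← Finset.sum_sub_distrib, Finset.mul_sum]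
      refine Finset.sum_congr rfl fun _ _ => ?_
      simp only [tensorA]
      ring
    rw [h1, hT, hT]
    simp only [ha, Pi.smul_apply, smul_eq_mul]
    ring
  have hE : ∀ d a i j, ∑ p, (minkowski p p : ℂ) * (r d a p i * calUHat p j +
        calUHat i p * r d a p j) + X d a * calUHat i j -
      ∑ p, (minkowski p p : ℂ) * (minkowskiModel.calG 0 a p i j * t d p) +
      ∑ p, (minkowski p p : ℂ) * (minkowskiModel.calG 0 d p i j * t a p) = 0 := by
    intro d a i j
    have h1 := hX d a i j
    simp only [hu, hT, Pi.smul_apply, smul_eq_mul] at h1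
    have hκ0 : κ ≠ 0 := fun h0 => by simp [h0] at hk
    refine mul_left_cancel₀ hκ0 ?_
    rw [mul_zero, ← h1]
    simp only [Fin.sum_univ_four]
    ring
  have hO : L.Omega y = -(scalarHat r / 12 + 1 / 2 * (a 0 1 - Complex.I * a 2 3)) := by
    rw [Omega, h.scalarCurv_eq hy hB, hB.pairing, hA, hB.pull_calU, hu, ← pairing_calUHat haa,
      pairing_minkowskiModel, pairing_minkowskiModel]
    have h1 : ∑ i, ∑ j, (κ • a) i j * (minkowski i i * minkowski j j * (κ • calUHat) i j) =
        (κ * κ) * ∑ i, ∑ j, a i j * (minkowski i i * minkowski j j * calUHat i j) := by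
      simp only [Pi.smul_apply, smul_eq_mul, Finset.mul_sum]
      refine Finset.sum_congr rfl fun _ _ => Finset.sum_congr rfl fun _ _ => ?_
      ring
    rw [h1, hk]
  have hZ : pull B (L.calZ y) = κ • zHat (1 / 2 * (a 0 2 + Complex.I * a 1 3))
      (1 / 2 * (a 0 3 - Complex.I * a 1 2)) := by
    rw [LocalFields.calZ, hB.pull_act, hB.pull4_calGperp, hA, map_smul,
      act_calGperp_minkowskiModel haa]
  have hmain := frame_algebra hr hE (fun i j => rfl) hO rfl rfl
  rw [hrdef, ← h.pull4_weylC hy hB] at hmain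
  obtain ⟨h1, h2, h3, h4, h5, h6⟩ := hmain
  refine ⟨B, _, _, hB, ?_, ?_, hκ ▸ hZ, h1, h2, h3, h4, h5, h6⟩
  · rw [h.pull4_weylC hy hB]
    exact hr.isWeylTensor_weylHat
  · rw [RegularOn.pull4_calW hB]
    rfl

end LocalFields

/-! ## Petrov-Bel types -/

/-- The matrix of the self-dual Weyl tensor of an umbilical 2+2 structure. -/
def petrovMatrix (Om p q : ℂ) : Matrix (Fin 3) (Fin 3) ℂ :=
  !![-2 * Om, p, q; p, Om, 0; q, 0, Om]

/-- The condition on `Ω` and `𝒵` which characterizes a Petrov-Bel type. -/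
def PetrovBel.Condition (Om p q : ℂ) : PetrovBel → Prop
  | .O => Om = 0 ∧ p = 0 ∧ q = 0
  | .N => False
  | .III => Om = 0 ∧ ¬(p = 0 ∧ q = 0) ∧ p ^ 2 + q ^ 2 = 0
  | .D => Om ≠ 0 ∧ p = 0 ∧ q = 0
  | .II => Om ≠ 0 ∧ ¬(p = 0 ∧ q = 0) ∧
      (p ^ 2 + q ^ 2) * (9 * Om ^ 2 + 4 * (p ^ 2 + q ^ 2)) = 0
  | .I => (p ^ 2 + q ^ 2) * (9 * Om ^ 2 + 4 * (p ^ 2 + q ^ 2)) ≠ 0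

section Conj

variable {V W : Type*} [AddCommGroup V] [Module ℂ V] [AddCommGroup W] [Module ℂ W]
  {f : Module.End ℂ V} {g : Module.End ℂ W} (e : V ≃ₗ[ℂ] W)

theorem hasEigenvalue_iff_of_conj (h : ∀ x, e (f x) = g (e x)) (c : ℂ) :
    f.HasEigenvalue c ↔ g.HasEigenvalue c := by
  constructor <;> intro hc <;> obtain ⟨x, hx⟩ := hc.exists_hasEigenvector
  · refine Module.End.hasEigenvalue_of_hasEigenvector (x := e x) ⟨?_, ?_⟩
    · rw [Module.End.mem_genEigenspace_one, ← h, hx.apply_eq_smul, map_smul]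
    · simpa using hx.2
  · refine Module.End.hasEigenvalue_of_hasEigenvector (x := e.symm x) ⟨?_, ?_⟩
    · rw [Module.End.mem_genEigenspace_one]
      apply e.injective
      rw [h, e.apply_symm_apply, hx.apply_eq_smul, map_smul, e.apply_symm_apply]
    · simpa using hx.2

/-- Conjugation preserves the eigenvalues, the minimal polynomial and vanishing, which are all that
the types involve. It permits replacing 𝒲 by its matrix. -/
theorem hasPetrovBelType_iff_of_conj (h : ∀ x, e (f x) = g (e x)) (t : PetrovBel) :
    HasPetrovBelType f t ↔ HasPetrovBelType g t := by
  have h1 : numEigenvalues f = numEigenvalues g := by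
    simp only [numEigenvalues, hasEigenvalue_iff_of_conj e h]
  have h2 : e.conjAlgEquiv ℂ f = g := by
    ext x
    simp [h]
  have h3 : minpoly ℂ f = minpoly ℂ g := by
    rw [← h2, minpoly.algEquiv_eq]
  have h4 : f = 0 ↔ g = 0 := by
    rw [← h2]
    simp
  cases t <;> simp only [HasPetrovBelType, h1, h3, h4]

variable [Nontrivial V]

theorem numEigenvalues_zero : numEigenvalues (0 : Module.End ℂ V) = 1 := by
  have : {c : ℂ | (0 : Module.End ℂ V).HasEigenvalue c} = {0} := by
    ext c
    simp only [Set.mem_ofPred_eq, Set.mem_singleton_iff]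
    constructor
    · intro hc
      obtain ⟨x, hx⟩ := hc.exists_hasEigenvector
      have h1 := hx.apply_eq_smul
      rw [LinearMap.zero_apply] at h1
      exact (smul_eq_zero.mp h1.symm).resolve_right hx.2
    · rintro rfl
      obtain ⟨x, hx⟩ := exists_ne (0 : V)
      exact Module.End.hasEigenvalue_of_hasEigenvector (x := x)
        ⟨by rw [Module.End.mem_genEigenspace_one]; simp, hx⟩
  rw [numEigenvalues, this, Set.ncard_singleton]

/-- The Petrov-Bel type of an endomorphism is unique. -/
theorem HasPetrovBelType.unique {t t' : PetrovBel} (h : HasPetrovBelType f t)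
    (h' : HasPetrovBelType f t') : t = t' := by
  -- Type O is stated as f = 0. On a nontrivial space this gives one eigenvalue and degree 1, so
  -- that O can be compared numerically with the other types.
  have h0 : f = 0 → numEigenvalues f = 1 ∧ (minpoly ℂ f).natDegree = 1 := by
    rintro rfl
    exact ⟨numEigenvalues_zero, by simp [minpoly.zero]⟩
  cases t <;> cases t' <;> simp only [HasPetrovBelType] at h h' <;> first
    | rfl
    | (exfalso; first
      | (have := h0 h; omega)
      | (have := h0 h'; omega)
      | omega)

end Conj

/-- The characteristic polynomial always splits off c − Ω, since M maps (0, −q, p) to Ω times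
itself. At c = Ω the quadratic factor equals −(p² + q²), and its discriminant is 9Ω² + 4(p² + q²).
-/
theorem hasEigenvalue_petrovMatrix (Om p q c : ℂ) :
    Module.End.HasEigenvalue (Matrix.toLin' (petrovMatrix Om p q)) c ↔
      (c - Om) * (c ^ 2 + Om * c - 2 * Om ^ 2 - (p ^ 2 + q ^ 2)) = 0 := by
  have h1 : (c • (1 : Matrix (Fin 3) (Fin 3) ℂ) - petrovMatrix Om p q).det =
      (c - Om) * (c ^ 2 + Om * c - 2 * Om ^ 2 - (p ^ 2 + q ^ 2)) := by
    rw [Matrix.det_fin_three]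
    simp [petrovMatrix]
    ring
  rw [← h1, ← Matrix.exists_mulVec_eq_zero_iff]
  constructor
  · intro hc
    obtain ⟨x, hx⟩ := hc.exists_hasEigenvector
    refine ⟨x, hx.2, ?_⟩
    have h2 := hx.apply_eq_smul
    rw [Matrix.toLin'_apply] at h2
    rw [Matrix.sub_mulVec, h2, Matrix.smul_mulVec, Matrix.one_mulVec, sub_self]
  · rintro ⟨x, hx, h2⟩
    refine Module.End.hasEigenvalue_of_hasEigenvector (x := x) ⟨?_, hx⟩
    rw [Matrix.sub_mulVec, Matrix.smul_mulVec, Matrix.one_mulVec, sub_eq_zero] at h2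
    rw [Module.End.mem_genEigenspace_one, Matrix.toLin'_apply, h2]

theorem natDegree_minpoly_le_of_aeval {A : Type*} [Ring A] [Algebra ℂ A] {x : A}
    {P : Polynomial ℂ} (hP : P ≠ 0) (h : Polynomial.aeval x P = 0) :
    (minpoly ℂ x).natDegree ≤ P.natDegree :=
  Polynomial.natDegree_le_of_dvd (minpoly.dvd ℂ x h) hP

/-- If aM² + bM + c = 0, the first row forces b = aΩ because p or q is nonzero. The lower block
forces apq = 0 and a(p² − q²) = 0, hence a = 0, and then b = c = 0. Thus no polynomial of degree at
most 2 annihilates M. -/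
theorem natDegree_minpoly_petrovMatrix_of_ne {Om p q : ℂ} (h : ¬(p = 0 ∧ q = 0)) :
    (minpoly ℂ (petrovMatrix Om p q)).natDegree = 3 := by
  set M := petrovMatrix Om p q with hM
  have hint : IsIntegral ℂ M := Matrix.isIntegral M
  apply le_antisymm
  · have h1 := natDegree_minpoly_le_of_aeval M.charpoly_monic.ne_zero M.aeval_self_charpoly
    rwa [Matrix.charpoly_natDegree_eq_dim, Fintype.card_fin] at h1
  · by_contra! hlt
    have hle : (minpoly ℂ M).natDegree ≤ 2 := by omega
    obtain ⟨a, b, c, hP⟩ : ∃ a b c, minpoly ℂ M = Polynomial.C a * Polynomial.X ^ 2 +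
        Polynomial.C b * Polynomial.X + Polynomial.C c :=
      ⟨_, _, _, Polynomial.eq_quadratic_of_degree_le_two
        (Polynomial.natDegree_le_iff_degree_le.mp hle)⟩
    have h1 : a • M ^ 2 + b • M + c • (1 : Matrix (Fin 3) (Fin 3) ℂ) = 0 := by
      have h2 := minpoly.aeval ℂ M
      rw [hP] at h2
      simpa [Algebra.algebraMap_eq_smul_one] using h2
    have e := fun i j => congrFun (congrFun h1 i) j
    have e00 := e 0 0; have e01 := e 0 1; have e02 := e 0 2; have e11 := e 1 1
    have e12 := e 1 2; have e22 := e 2 2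
    simp [hM, petrovMatrix, sq] at e00 e01 e02 e11 e12 e22
    have hb : b = a * Om := by
      by_contra hb
      refine h ⟨?_, ?_⟩
      · refine (mul_eq_zero.mp (?_ : (b - a * Om) * p = 0)).resolve_left (sub_ne_zero.mpr hb)
        linear_combination e01
      · refine (mul_eq_zero.mp (?_ : (b - a * Om) * q = 0)).resolve_left (sub_ne_zero.mpr hb)
        linear_combination e02
    have ha : a = 0 := by
      by_contra ha
      have h3 : p * q = 0 := mul_eq_zero.mpr (e12.resolve_left ha)
      have h4 : p ^ 2 - q ^ 2 = 0 := (mul_eq_zero.mp (by linear_combination e11 - e22 :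
        a * (p ^ 2 - q ^ 2) = 0)).resolve_left ha
      refine h ?_
      rcases mul_eq_zero.mp h3 with h5 | h5 <;> subst h5 <;> simpa using h4
    have hc : c = 0 := by
      subst ha
      rw [zero_mul] at hb
      subst hb
      linear_combination e00
    refine minpoly.ne_zero hint ?_
    rw [hP, hb, ha, hc]
    simp

/-- The matrix is diag(−2Ω, Ω, Ω) with two distinct eigenvalues, so it is annihilated by (X − Ω)(X +
2Ω) and by no polynomial of degree one. -/
theorem natDegree_minpoly_petrovMatrix {Om : ℂ} (h : Om ≠ 0) :
    (minpoly ℂ (petrovMatrix Om 0 0)).natDegree = 2 := by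
  set M := petrovMatrix Om 0 0 with hM
  have hint : IsIntegral ℂ M := Matrix.isIntegral M
  apply le_antisymm
  · have h1 : Polynomial.aeval M ((Polynomial.X - Polynomial.C Om) *
        (Polynomial.X - Polynomial.C (-2 * Om))) = 0 := by
      simp only [map_mul, map_sub, Polynomial.aeval_X, Polynomial.aeval_C,
        Algebra.algebraMap_eq_smul_one]
      ext i j
      fin_cases i <;> fin_cases j <;> simp [hM, petrovMatrix, Matrix.mul_apply,
        Fin.sum_univ_three]
      exact Or.inr (by ring)
    refine (natDegree_minpoly_le_of_aeval (mul_ne_zero (Polynomial.X_sub_C_ne_zero _)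
      (Polynomial.X_sub_C_ne_zero _)) h1).trans ?_
    rw [Polynomial.natDegree_mul (Polynomial.X_sub_C_ne_zero _) (Polynomial.X_sub_C_ne_zero _),
      Polynomial.natDegree_X_sub_C, Polynomial.natDegree_X_sub_C]
  · by_contra! hlt
    obtain ⟨b, c, hP⟩ := Polynomial.exists_eq_X_add_C_of_natDegree_le_one
      (Nat.le_of_lt_succ hlt)
    have h1 : b • M + c • (1 : Matrix (Fin 3) (Fin 3) ℂ) = 0 := by
      have h2 := minpoly.aeval ℂ M
      rw [hP] at h2
      simpa [Algebra.algebraMap_eq_smul_one] using h2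
    have e00 := congrFun (congrFun h1 0) 0
    have e11 := congrFun (congrFun h1 1) 1
    simp [hM, petrovMatrix] at e00 e11
    have hb : b = 0 := (mul_eq_zero.mp (by linear_combination (e11 - e00) / 3 :
      b * Om = 0)).resolve_right h
    have hc : c = 0 := by
      rw [hb] at e00
      linear_combination e00
    refine minpoly.ne_zero hint ?_
    rw [hP, hb, hc]
    simp

theorem numEigenvalues_petrovMatrix {Om p q : ℂ} {S : Finset ℂ}
    (h : ∀ c, (c - Om) * (c ^ 2 + Om * c - 2 * Om ^ 2 - (p ^ 2 + q ^ 2)) = 0 ↔ c ∈ S) :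
    numEigenvalues (Matrix.toLin' (petrovMatrix Om p q)) = S.card := by
  have : {c : ℂ | Module.End.HasEigenvalue (Matrix.toLin' (petrovMatrix Om p q)) c} = S := by
    ext c
    rw [Set.mem_ofPred_eq, hasEigenvalue_petrovMatrix, h]
    rfl
  rw [numEigenvalues, this, Set.ncard_coe_finset]

theorem numEigenvalues_petrovMatrix_of_sq {Om p q : ℂ} (hS : p ^ 2 + q ^ 2 = 0) :
    numEigenvalues (Matrix.toLin' (petrovMatrix Om p q)) =
      ({Om, -2 * Om} : Finset ℂ).card := by
  refine numEigenvalues_petrovMatrix fun c => ?_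
  rw [hS, Finset.mem_insert, Finset.mem_singleton]
  constructor
  · intro h
    have h1 : (c - Om) * ((c - Om) * (c + 2 * Om)) = 0 := by linear_combination h
    rcases mul_eq_zero.mp h1 with h2 | h2
    · exact Or.inl (sub_eq_zero.mp h2)
    · rcases mul_eq_zero.mp h2 with h3 | h3
      · exact Or.inl (sub_eq_zero.mp h3)
      · exact Or.inr (by linear_combination h3)
  · rintro (rfl | rfl) <;> ring

theorem numEigenvalues_petrovMatrix_of_sq' {Om p q : ℂ} (hS : p ^ 2 + q ^ 2 = 0) (h : Om ≠ 0) :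
    numEigenvalues (Matrix.toLin' (petrovMatrix Om p q)) = 2 := by
  rw [numEigenvalues_petrovMatrix_of_sq hS, Finset.card_pair]
  intro h1
  exact h (by linear_combination h1 / 3)

/-- The algebraic case distinction. Coincidences of eigenvalues arise in two ways only: Ω is a root
of the quadratic factor, or that factor has a double root. -/
theorem exists_hasPetrovBelType (Om p q : ℂ) : ∃ t : PetrovBel, t.Condition Om p q ∧
    HasPetrovBelType (Matrix.toLin' (petrovMatrix Om p q)) t := by
  by_cases hZ : p = 0 ∧ q = 0
  · obtain ⟨rfl, rfl⟩ := hZ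
    by_cases hO : Om = 0
    · subst hO
      refine ⟨.O, by simp [PetrovBel.Condition], ?_⟩
      have : petrovMatrix 0 0 0 = 0 := by
        ext i j
        fin_cases i <;> fin_cases j <;> simp [petrovMatrix]
      simp [HasPetrovBelType, this]
    · refine ⟨.D, by simp [PetrovBel.Condition, hO], ?_, ?_⟩
      · exact numEigenvalues_petrovMatrix_of_sq' (by ring) hO
      · rw [Matrix.minpoly_toLin', natDegree_minpoly_petrovMatrix hO]
  · have hdeg : (minpoly ℂ (Matrix.toLin' (petrovMatrix Om p q))).natDegree = 3 := by
      rw [Matrix.minpoly_toLin', natDegree_minpoly_petrovMatrix_of_ne hZ]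
    by_cases hS : p ^ 2 + q ^ 2 = 0
    · by_cases hO : Om = 0
      · refine ⟨.III, ⟨hO, hZ, hS⟩, ?_, hdeg⟩
        rw [numEigenvalues_petrovMatrix_of_sq hS, hO]
        simp
      · exact ⟨.II, ⟨hO, hZ, by rw [hS, zero_mul]⟩,
          numEigenvalues_petrovMatrix_of_sq' hS hO, hdeg⟩
    · by_cases hD : 9 * Om ^ 2 + 4 * (p ^ 2 + q ^ 2) = 0
      · have hO : Om ≠ 0 := by
          rintro rfl
          exact hS (by linear_combination hD / 4)
        refine ⟨.II, ⟨hO, hZ, by rw [hD, mul_zero]⟩, ?_, hdeg⟩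
        -- Vanishing discriminant makes the quadratic factor equal to (c + Ω/2)².
        rw [numEigenvalues_petrovMatrix (S := {Om, -Om / 2}), Finset.card_pair]
        · intro h1
          exact hO (by linear_combination 2 * h1 / 3)
        · intro c
          rw [Finset.mem_insert, Finset.mem_singleton]
          have h2 : (c - Om) * (c ^ 2 + Om * c - 2 * Om ^ 2 - (p ^ 2 + q ^ 2)) =
              (c - Om) * (c + Om / 2) ^ 2 := by linear_combination (-(c - Om) / 4) * hD
          rw [h2, mul_eq_zero, sub_eq_zero, pow_eq_zero_iff (by norm_num)]
          exact or_congr Iff.rfl ⟨fun h => by linear_combination h, fun h => by rw [h]; ring⟩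
      · refine ⟨.I, mul_ne_zero hS hD, ?_⟩
        -- A square root of the discriminant. A coincidence Ω = (−Ω ± δ)/2 would give δ² = 9Ω² and
        -- hence p² + q² = 0.
        obtain ⟨δ, hδ⟩ : ∃ δ : ℂ, 9 * Om ^ 2 + 4 * (p ^ 2 + q ^ 2) = δ * δ :=
          (IsAlgClosed.exists_pow_nat_eq _ two_pos).imp fun z hz => hz.symm.trans (sq z)
        have hδ0 : δ ≠ 0 := by
          rintro rfl
          exact hD (by rw [hδ, mul_zero])
        simp only [HasPetrovBelType]
        rw [numEigenvalues_petrovMatrix (S := {Om, (-Om + δ) / 2, (-Om - δ) / 2}),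
          Finset.card_eq_three.mpr ⟨_, _, _, ?_, ?_, ?_, rfl⟩]
        · intro h1
          exact hS (by linear_combination hδ / 4 - (3 * Om + δ) / 2 * h1)
        · intro h1
          exact hS (by linear_combination hδ / 4 - (3 * Om - δ) / 2 * h1)
        · intro h1
          exact hδ0 (by linear_combination h1)
        · intro c
          rw [Finset.mem_insert, Finset.mem_insert, Finset.mem_singleton]
          have h2 : (c - Om) * (c ^ 2 + Om * c - 2 * Om ^ 2 - (p ^ 2 + q ^ 2)) =
              (c - Om) * ((c - (-Om + δ) / 2) * (c - (-Om - δ) / 2)) := by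
            linear_combination (-(c - Om) / 4) * hδ
          rw [h2, mul_eq_zero, mul_eq_zero, sub_eq_zero, sub_eq_zero, sub_eq_zero]

/-- Mutual exclusion of the conditions is needed, together with that of the types, to obtain
equivalences from the existence statement alone. -/
theorem PetrovBel.Condition.unique {Om p q : ℂ} {t t' : PetrovBel} (h : t.Condition Om p q)
    (h' : t'.Condition Om p q) : t = t' := by
  cases t <;> cases t' <;> simp only [PetrovBel.Condition] at h h' <;> first
    | rfl
    | (exfalso; obtain ⟨h1, h2, h3⟩ := h; simp_all)
    | (exfalso; obtain ⟨h1, h2, h3⟩ := h'; simp_all)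

/-- The Petrov-Bel type of an endomorphism conjugate to the matrix of the self-dual Weyl tensor of
an umbilical 2+2 structure. -/
theorem hasPetrovBelType_iff_condition {V : Type*} [AddCommGroup V] [Module ℂ V]
    {f : Module.End ℂ V} {Om p q : ℂ} (e : V ≃ₗ[ℂ] (Fin 3 → ℂ))
    (h : ∀ x, e (f x) = Matrix.toLin' (petrovMatrix Om p q) (e x)) (t : PetrovBel) :
    HasPetrovBelType f t ↔ t.Condition Om p q := by
  rw [hasPetrovBelType_iff_of_conj e h]
  obtain ⟨t', h1, h2⟩ := exists_hasPetrovBelType Om p q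
  -- Some type holds along with its condition. Since types exclude one another and so do conditions,
  -- each type is equivalent to its condition.
  exact ⟨fun h3 => h3.unique h2 ▸ h1, fun h3 => h3.unique h1 ▸ h2⟩

/-! ### Self-dual bivectors as vectors of ℂ³ -/

/-- The SD bivector with components `F_{0a}` in a frame. -/
def sdHat : (Fin 3 → ℂ) →ₗ[ℂ] Tensor2 where
  toFun v := ![![0, v 0, v 1, v 2], ![-v 0, 0, Complex.I * v 2, -Complex.I * v 1],
    ![-v 1, -Complex.I * v 2, 0, Complex.I * v 0], ![-v 2, Complex.I * v 1, -Complex.I * v 0, 0]]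
  map_add' v w := by
    funext i j
    fin_cases i <;> fin_cases j <;> simp <;> ring
  map_smul' c v := by
    funext i j
    fin_cases i <;> fin_cases j <;> simp <;> ring

theorem sdHat_apply (v : Fin 3 → ℂ) : sdHat v =
    ![![0, v 0, v 1, v 2], ![-v 0, 0, Complex.I * v 2, -Complex.I * v 1],
    ![-v 1, -Complex.I * v 2, 0, Complex.I * v 0],
    ![-v 2, Complex.I * v 1, -Complex.I * v 0, 0]] := rfl

theorem sdHat_succ (v : Fin 3 → ℂ) (a : Fin 3) : sdHat v 0 a.succ = v a := by
  fin_cases a <;> simp [sdHat_apply]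

theorem sdHat_antisymm (v : Fin 3 → ℂ) (i j : Fin 4) : sdHat v i j = -sdHat v j i := by
  fin_cases i <;> fin_cases j <;> simp [sdHat_apply]

namespace IsWeylTensor

/-- The relations between the components of a Weyl tensor given by the vanishing of its trace. -/
theorem normalize {w : Tensor4} (hw : IsWeylTensor w) :
    w 2 3 2 3 = -w 0 1 0 1 ∧ w 1 3 1 3 = -w 0 2 0 2 ∧ w 1 2 1 2 = w 0 1 0 1 + w 0 2 0 2 ∧
    w 0 3 0 3 = -w 0 1 0 1 - w 0 2 0 2 ∧ w 0 3 1 3 = -w 0 2 1 2 ∧ w 0 3 2 3 = w 0 1 1 2 ∧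
    w 0 2 2 3 = -w 0 1 1 3 ∧ w 1 3 2 3 = w 0 1 0 2 ∧ w 1 2 2 3 = -w 0 1 0 3 ∧
    w 1 2 1 3 = w 0 2 0 3 := by
  obtain ⟨n1, n2, n3, n4, n5⟩ := hw.toIsCurvatureTensor.normalize
  have t := hw.trace
  have t00 := t 0 0; have t01 := t 0 1; have t02 := t 0 2; have t03 := t 0 3
  have t11 := t 1 1; have t12 := t 1 2; have t13 := t 1 3; have t22 := t 2 2
  have t23 := t 2 3; have t33 := t 3 3
  simp [Fin.sum_univ_four, minkowski, n1, n2, n3, n4] at t00 t01 t02 t03 t11 t12 t13 t22 t23 t33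
  refine ⟨?_, ?_, ?_, ?_, ?_, ?_, ?_, ?_, ?_, ?_⟩ <;> grind

end IsWeylTensor

namespace LocalFields

variable {L : LocalFields} {s : Set Coord} {y : Coord} {B : Matrix (Fin 4) (Fin 4) ℝ}

theorem hodge_sdHat (v : Fin 3 → ℂ) :
    minkowskiModel.hodge 0 (sdHat v) = Complex.I • sdHat v := by
  rw [hodge_minkowskiModel (sdHat_antisymm v)]
  funext i j
  have hI := Complex.I_mul_I
  fin_cases i <;> fin_cases j <;> simp [sdHat_apply] <;> grind

theorem exists_sdHat_of_hodge {F : Tensor2} (hF : ∀ i j, F i j = -F j i)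
    (hF' : minkowskiModel.hodge 0 F = Complex.I • F) : F = sdHat fun a => F 0 a.succ := by
  have hd : ∀ i, F i i = 0 := fun i => by
    have := hF i i
    linear_combination (1 / 2) * this
  rw [hodge_minkowskiModel hF] at hF'
  have e := fun i j => congrFun (congrFun hF' i) j
  have e1 := e 0 1; have e2 := e 0 2; have e3 := e 0 3
  simp at e1 e2 e3
  have h1 := hF 1 0; have h2 := hF 2 0; have h3 := hF 3 0; have h4 := hF 2 1; have h5 := hF 3 1
  have h6 := hF 3 2
  funext i j
  fin_cases i <;> fin_cases j <;> simp [sdHat_apply, hd] <;> grind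

theorem sdHat_half_sub {F : Tensor2} (hF : ∀ i j, F i j = -F j i) (i j : Fin 4) :
    1 / 2 * (F i j - Complex.I * minkowskiModel.hodge 0 F i j) =
      sdHat (fun a => 1 / 2 * (F 0 a.succ - Complex.I * minkowskiModel.hodge 0 F 0 a.succ)) i j := by
  have hd : ∀ i, F i i = 0 := fun i => by
    have := hF i i
    linear_combination (1 / 2) * this
  have h1 := hF 1 0; have h2 := hF 2 0; have h3 := hF 3 0; have h4 := hF 2 1; have h5 := hF 3 1
  have h6 := hF 3 2
  have hI := Complex.I_mul_I
  rw [hodge_minkowskiModel hF]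
  fin_cases i <;> fin_cases j <;> simp [sdHat_apply, hd] <;> grind

/-- The operator ½(1 − i*) on the first index pair is the projector onto SD bivectors, so the image
is determined by its components F_{0a}. -/
theorem act_selfDualHat {w : Tensor4} (hw : IsCurvatureTensor w) (F : Tensor2) :
    minkowskiModel.act 0 (selfDualHat w) F =
      sdHat fun a => minkowskiModel.act 0 (selfDualHat w) F 0 a.succ := by
  have h1 : ∀ i j k l, selfDualHat w i j k l =
      sdHat (fun a => selfDualHat w 0 a.succ k l) i j := fun i j k l =>
    sdHat_half_sub (fun i j => hw.left i j k l) i j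
  have h2 : (fun a : Fin 3 => minkowskiModel.act 0 (selfDualHat w) F 0 a.succ) =
      ∑ k, ∑ l, (1 / 2 * minkowskiModel.raise 0 F k l) •
        fun a : Fin 3 => selfDualHat w 0 a.succ k l := by
    funext a
    simp only [act_apply, contract, Finset.sum_apply, Pi.smul_apply, smul_eq_mul, Finset.mul_sum]
    refine Finset.sum_congr rfl fun _ _ => Finset.sum_congr rfl fun _ _ => ?_
    ring
  rw [h2]
  funext i j
  simp only [map_sum, map_smul, Finset.sum_apply, Pi.smul_apply, smul_eq_mul, ← h1, act_apply,
    contract, Finset.mul_sum]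
  refine Finset.sum_congr rfl fun _ _ => Finset.sum_congr rfl fun _ _ => ?_
  ring

/-- The trace condition makes * commute with the Weyl tensor, so the self-dual part is self-dual in
its second pair too. The pair (0, b) and its dual then contribute equally, which gives the factor 2;
the sign comes from raising one time index. -/
theorem act_selfDualHat_sdHat {w : Tensor4} (hw : IsWeylTensor w) (v : Fin 3 → ℂ) (a : Fin 3) :
    minkowskiModel.act 0 (selfDualHat w) (sdHat v) 0 a.succ =
      -2 * ∑ b : Fin 3, selfDualHat w 0 a.succ 0 b.succ * v b := by
  obtain ⟨n1, n2, n3, n4, n5⟩ := hw.toIsCurvatureTensor.normalize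
  obtain ⟨t1, t2, t3, t4, t5, t6, t7, t8, t9, t10⟩ := hw.normalize
  have hS := selfDualHat_eq hw.toIsCurvatureTensor
  simp only [act_apply, contract, raise_minkowskiModel, Fin.sum_univ_four, Fin.sum_univ_three]
  fin_cases a <;>
    simp [minkowski, sdHat_apply, hS, n2, n4, n5, t1, t2, t3, t4, t5, t6, t7, t8, t9, t10] <;>
    ring_nf <;> simp only [Complex.I_sq] <;> ring

end LocalFields

/-! ### The endomorphism 𝒲 on SD bivectors and the classification -/

namespace LocalFields

variable {L : LocalFields} {s : Set Coord} {y : Coord} {B : Matrix (Fin 4) (Fin 4) ℝ} {p q : ℂ}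

theorem pull_transpose (B : Matrix (Fin 4) (Fin 4) ℝ) (F : Tensor2) :
    pull B (fun α β => F β α) = fun i j => pull B F j i := by
  funext i j
  rw [pull_apply, pull_apply, Finset.sum_comm]
  refine Finset.sum_congr rfl fun _ _ => Finset.sum_congr rfl fun _ _ => ?_
  ring

namespace FrameAt

variable (hB : L.FrameAt y B)
include hB

theorem antisymm_iff (F : Tensor2) :
    (∀ α β, F α β = -F β α) ↔ ∀ i j, pull B F i j = -pull B F j i := by
  have h1 : (∀ α β, F α β = -F β α) ↔ F = -fun α β => F β α :=
    ⟨fun h => funext fun α => funext fun β => h α β, fun h α β => congrFun (congrFun h α) β⟩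
  have h2 : (∀ i j, pull B F i j = -pull B F j i) ↔ pull B F = -fun i j => pull B F j i :=
    ⟨fun h => funext fun α => funext fun β => h α β, fun h α β => congrFun (congrFun h α) β⟩
  rw [h1, h2, ← pull_transpose, ← map_neg, hB.pull_injective.eq_iff]

theorem mem_sdBivectors_iff (F : Tensor2) :
    F ∈ L.sdBivectors y ↔ pull B F = sdHat fun a => pull B F 0 a.succ := by
  have h1 : F ∈ L.sdBivectors y ↔ (∀ α β, F α β = -F β α) ∧ L.hodge y F = Complex.I • F := Iff.rfl
  rw [h1, hB.antisymm_iff, ← hB.pull_injective.eq_iff, hB.pull_hodge, map_smul]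
  constructor
  · rintro ⟨h2, h3⟩
    exact exists_sdHat_of_hodge h2 h3
  · intro h2
    rw [h2]
    exact ⟨sdHat_antisymm _, hodge_sdHat _⟩

theorem pull_pull_inv (F : Tensor2) : pull B (pull B⁻¹ F) = F := pull_pull hB.inv_mul F

/-- The space of SD bivectors is identified with `ℂ³` by the components `F_{0a}` in a frame. -/
def sdEquiv : L.sdBivectors y ≃ₗ[ℂ] (Fin 3 → ℂ) where
  toFun F a := pull B F.1 0 a.succ
  map_add' F G := by
    funext a
    simp
  map_smul' c F := by
    funext a
    simp
  invFun v := ⟨pull B⁻¹ (sdHat v), by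
    rw [hB.mem_sdBivectors_iff, hB.pull_pull_inv]
    simp only [sdHat_succ]⟩
  left_inv F := by
    apply Subtype.ext
    apply hB.pull_injective
    change pull B (pull B⁻¹ (sdHat _)) = _
    rw [hB.pull_pull_inv, ← (hB.mem_sdBivectors_iff F.1).mp F.2]
  right_inv v := by
    funext a
    change pull B (pull B⁻¹ (sdHat v)) 0 a.succ = v a
    rw [hB.pull_pull_inv, sdHat_succ]

end FrameAt

namespace SelfDualFrame

variable (h : L.SelfDualFrame y B p q)
include h

theorem calW_mem (F : Tensor2) : L.act y (L.calW y) F ∈ L.sdBivectors y := by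
  rw [h.frameAt.mem_sdBivectors_iff, h.frameAt.pull_act, h.calW]
  exact act_selfDualHat h.isWeylTensor.toIsCurvatureTensor _

/-- In the coordinates F_{0a} the endomorphism has entries −2𝒲_{0a0b}; inserting the frame
components gives the Petrov matrix, to which the classification applies. -/
theorem hasType_iff (t : PetrovBel) : L.HasType y t ↔ t.Condition (L.Omega y) p q := by
  have hm : ∀ F ∈ L.sdBivectors y, L.act y (L.calW y) F ∈ L.sdBivectors y :=
    fun F _ => h.calW_mem F
  have h1 : ∀ F, h.frameAt.sdEquiv ((L.act y (L.calW y)).restrict hm F) =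
      Matrix.toLin' (petrovMatrix (L.Omega y) p q) (h.frameAt.sdEquiv F) := by
    intro F
    have hF := (h.frameAt.mem_sdBivectors_iff F.1).mp F.2
    set v := h.frameAt.sdEquiv F with hv
    have hF' : pull B F.1 = sdHat v := hF
    -- The symmetry of 𝒲_{0a0b} uses the trace conditions as well as pair symmetry, because * acts
    -- on the first index pair only.
    have hs : ∀ a b : Fin 3, selfDualHat (pull4 B (L.weylC y)) 0 a.succ 0 b.succ =
        selfDualHat (pull4 B (L.weylC y)) 0 b.succ 0 a.succ := by
      have hS := selfDualHat_eq h.isWeylTensor.toIsCurvatureTensor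
      obtain ⟨n1, n2, n3, n4, n5⟩ := h.isWeylTensor.toIsCurvatureTensor.normalize
      obtain ⟨t1, t2, t3, t4, t5, t6, t7, t8, t9, t10⟩ := h.isWeylTensor.normalize
      intro a b
      fin_cases a <;> fin_cases b <;> simp [hS, n5, t4, t5, t6, t7] <;>
        ring
    have h0 : ∀ a : Fin 3, h.frameAt.sdEquiv ((L.act y (L.calW y)).restrict hm F) a =
        -2 * ∑ b : Fin 3, selfDualHat (pull4 B (L.weylC y)) 0 a.succ 0 b.succ * v b := by
      intro a
      rw [← act_selfDualHat_sdHat h.isWeylTensor, ← hF', ← h.calW, ← h.frameAt.pull_act]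
      rfl
    have e10 := (hs 1 0).trans h.calW_0102
    have e20 := (hs 2 0).trans h.calW_0103
    have e21 := (hs 2 1).trans h.calW_0203
    have e00 := h.calW_0101
    have e01 := h.calW_0102
    have e02 := h.calW_0103
    have e11 := h.calW_0202
    have e12 := h.calW_0203
    have e22 := h.calW_0303
    funext a
    rw [h0, Fin.sum_univ_three, Matrix.toLin'_apply]
    fin_cases a
    · change -2 * (selfDualHat _ 0 1 0 1 * v 0 + selfDualHat _ 0 1 0 2 * v 1 +
        selfDualHat _ 0 1 0 3 * v 2) = _
      rw [e00, e01, e02]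
      simp [petrovMatrix, Matrix.mulVec, dotProduct, Fin.sum_univ_three]
      ring
    · change -2 * (selfDualHat _ 0 2 0 1 * v 0 + selfDualHat _ 0 2 0 2 * v 1 +
        selfDualHat _ 0 2 0 3 * v 2) = _
      rw [e11, e12]
      erw [e10]
      simp [petrovMatrix, Matrix.mulVec, dotProduct, Fin.sum_univ_three]
      ring
    · change -2 * (selfDualHat _ 0 3 0 1 * v 0 + selfDualHat _ 0 3 0 2 * v 1 +
        selfDualHat _ 0 3 0 3 * v 2) = _
      rw [e22]
      erw [e20, e21]
      simp [petrovMatrix, Matrix.mulVec, dotProduct, Fin.sum_univ_three]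
      ring
  constructor
  · rintro ⟨hm', ht⟩
    exact (hasPetrovBelType_iff_condition h.frameAt.sdEquiv h1 t).mp ht
  · intro ht
    exact ⟨hm, (hasPetrovBelType_iff_condition h.frameAt.sdEquiv h1 t).mpr ht⟩

theorem calZ_eq_zero_iff : L.calZ y = 0 ↔ p = 0 ∧ q = 0 := by
  have hk : ((1 / √2 : ℝ) : ℂ) ≠ 0 := fun h0 => by
    have := inv_sqrt_two_mul_self
    rw [h0] at this
    norm_num at this
  rw [← h.frameAt.pull_injective.eq_iff, map_zero, h.calZ, smul_eq_zero, or_iff_right hk]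
  constructor
  · intro h1
    have h2 := congrFun (congrFun h1 0)
    exact ⟨h2 2, h2 3⟩
  · rintro ⟨rfl, rfl⟩
    funext i j
    fin_cases i <;> fin_cases j <;> simp [zHat]

/-- This minus sign turns the discriminant 9Ω² + 4(p² + q²) into 9Ω² − 4(𝒵,𝒵). -/
theorem pairing_calZ : L.pairing y (L.calZ y) (L.calZ y) = -(p ^ 2 + q ^ 2) := by
  have hI := Complex.I_mul_I
  have hk := inv_sqrt_two_mul_self
  rw [h.frameAt.pairing, h.calZ, pairing_minkowskiModel]
  generalize ((1 / √2 : ℝ) : ℂ) = κ at hk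
  simp [Fin.sum_univ_four, minkowski, zHat]
  grind

/-- The Petrov-Bel types in terms of `Ω` and `𝒵`. -/
theorem classification {ZZ : ℂ} (hZZ : ZZ = L.pairing y (L.calZ y) (L.calZ y)) :
    ¬ L.HasType y .N ∧
    (L.HasType y .O ↔ L.Omega y = 0 ∧ L.calZ y = 0) ∧
    (L.HasType y .III ↔ L.Omega y = 0 ∧ L.calZ y ≠ 0 ∧ ZZ = 0) ∧
    (L.HasType y .D ↔ L.Omega y ≠ 0 ∧ L.calZ y = 0) ∧
    (L.HasType y .II ↔
      L.Omega y ≠ 0 ∧ L.calZ y ≠ 0 ∧ ZZ * (9 * L.Omega y ^ 2 - 4 * ZZ) = 0) ∧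
    (L.HasType y .I ↔ ZZ * (9 * L.Omega y ^ 2 - 4 * ZZ) ≠ 0) := by
  have h1 : ZZ * (9 * L.Omega y ^ 2 - 4 * ZZ) =
      -((p ^ 2 + q ^ 2) * (9 * L.Omega y ^ 2 + 4 * (p ^ 2 + q ^ 2))) := by
    rw [hZZ, h.pairing_calZ]
    ring
  have h2 : ZZ = 0 ↔ p ^ 2 + q ^ 2 = 0 := by rw [hZZ, h.pairing_calZ, neg_eq_zero]
  simp only [h.hasType_iff, PetrovBel.Condition, ne_eq, h.calZ_eq_zero_iff, h1, h2, neg_eq_zero,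
    not_false_eq_true, and_self]

end SelfDualFrame

end LocalFields

/-! ## Debever directions -/

namespace LocalFields

variable {L : LocalFields} {s : Set Coord} {y : Coord} {B : Matrix (Fin 4) (Fin 4) ℝ} {p q : ℂ}

theorem exists_real_pull4_weylC (L : LocalFields) (y : Coord) (B : Matrix (Fin 4) (Fin 4) ℝ)
    (i j k l : Fin 4) : ∃ x : ℝ, pull4 B (L.weylC y) i j k l = x :=
  ⟨∑ α, ∑ β, ∑ μ, ∑ ν, B α i * B β j * B μ k * B ν l * L.weyl y α β μ ν, by
    rw [pull4_apply]
    push_cast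
    rfl⟩

/-- The Weyl components are real in a real frame, so each complex equation for the self-dual part
yields two equations for the Weyl tensor. -/
theorem eq_zero_of_add_I_mul {a b : ℂ} (ha : ∃ x : ℝ, a = x) (hb : ∃ x : ℝ, b = x)
    (h : a + Complex.I * b = 0) : a = 0 ∧ b = 0 := by
  obtain ⟨x, rfl⟩ := ha
  obtain ⟨z, rfl⟩ := hb
  have h1 := congrArg Complex.re h
  have h2 := congrArg Complex.im h
  simp at h1 h2
  simp [h1, h2]

/-- The components of `W_{βγδε} l^γ l^δ` in a frame. -/
theorem pull_weyl_contract (L : LocalFields) (y : Coord) (B : Matrix (Fin 4) (Fin 4) ℝ)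
    (x : Fin 4 → ℝ) (i j : Fin 4) :
    pull B (fun β ε => ∑ γ, ∑ δ, L.weylC y β γ δ ε *
      ((B.mulVec x γ : ℂ) * (B.mulVec x δ : ℂ))) i j =
      ∑ c, ∑ d, pull4 B (L.weylC y) i c d j * ((x c : ℂ) * (x d : ℂ)) := by
  let Q : Tensor4 := fun β ε γ δ => L.weylC y β γ δ ε
  let X : Tensor2 := fun c d => (x c : ℂ) * (x d : ℂ)
  have h1 : ∀ γ δ, (B.mulVec x γ : ℂ) * (B.mulVec x δ : ℂ) =
      (toC B * Matrix.of X * (toC B).transpose) γ δ := fun γ δ => by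
    simp only [Matrix.mulVec, dotProduct, Matrix.mul_apply, Matrix.transpose_apply, toC_apply,
      Matrix.of_apply, X]
    push_cast
    rw [mul_comm, Finset.sum_mul_sum]
    refine Finset.sum_congr rfl fun _ _ => ?_
    rw [Finset.sum_mul]
    refine Finset.sum_congr rfl fun _ _ => ?_
    ring
  have h2 : ∀ β ε, ∑ γ, ∑ δ, L.weylC y β γ δ ε *
      ((B.mulVec x γ : ℂ) * (B.mulVec x δ : ℂ)) = 1 * contract (pull B (Q β ε)) X := fun β ε => by
    simp only [h1]
    rw [one_mul, ← contract_push]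
    rfl
  simp only [h2]
  rw [pull_contract]
  simp only [one_mul]
  rw [contract]
  refine Finset.sum_congr rfl fun c _ => Finset.sum_congr rfl fun d _ => ?_
  have h3 : pull4 B Q i j c d = pull4 B (fun β γ ε δ => L.weylC y β γ δ ε) i c j d :=
    pull4_swap_mid B (fun β γ ε δ => L.weylC y β γ δ ε) i j c d
  have h4 : pull4 B (fun β γ ε δ => L.weylC y β γ δ ε) i c j d =
      pull4 B (L.weylC y) i c d j := pull4_swap_right B (L.weylC y) i c j d
  rw [h3, h4]

/-- The algebra of a Weyl tensor along one of its Debever principal null directions. -/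
theorem weyl_contract_null {w : Tensor4} (hw : IsWeylTensor w) (h0203 : w 0 2 0 3 = 0)
    (h0212 : w 0 2 1 2 = 0) (h0101 : w 0 1 0 1 = -2 * w 0 2 0 2)
    (h0123 : w 0 1 2 3 = 2 * w 0 2 1 3) {ε a : ℂ} (hε : ε * ε = 1) {x k v : Fin 4 → ℂ}
    (hx : x = ![a, ε * a, 0, 0]) (hk : k = ![-a, ε * a, 0, 0])
    (hv : v = ![a * w 0 1 0 1 / 2, -ε * a * w 0 1 0 1 / 2, -a * (ε * w 0 1 0 2 + w 0 1 1 2),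
      -a * (ε * w 0 1 0 3 + w 0 1 1 3)]) (i j : Fin 4) :
    ∑ c, ∑ d, w i c d j * (x c * x d) = k i * v j + v i * k j := by
  obtain ⟨n1, n2, n3, n4, n5⟩ := hw.toIsCurvatureTensor.normalize
  obtain ⟨t1, t2, t3, t4, t5, t6, t7, t8, t9, t10⟩ := hw.normalize
  simp only [Fin.sum_univ_four, hx, hk, hv]
  fin_cases i <;> fin_cases j <;>
    simp [n1, n2, n3, n4, n5, t1, t2, t3, t4, t5, t6, t7, t8, t9, t10, h0203, h0212, h0101,
      h0123] <;> grind

/-- The principal null directions of the canonical SD bivector in the model. -/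
theorem principal_null_model {x : Fin 4 → ℝ} (hx0 : x ≠ 0)
    (hn : -x 0 ^ 2 + x 1 ^ 2 + x 2 ^ 2 + x 3 ^ 2 = 0) {c : ℂ}
    (hc : ∀ i, ∑ j, calUHat i j * (x j : ℂ) = c * ((minkowski i i * x i : ℝ) : ℂ)) :
    ∃ ε : ℝ, ε * ε = 1 ∧ x = ![x 0, ε * x 0, 0, 0] := by
  have h00 : x 0 ≠ 0 := by
    intro h0
    apply hx0
    have h1 : x 1 = 0 := by nlinarith [sq_nonneg (x 1), sq_nonneg (x 2), sq_nonneg (x 3)]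
    have h2 : x 2 = 0 := by nlinarith [sq_nonneg (x 1), sq_nonneg (x 2), sq_nonneg (x 3)]
    have h3 : x 3 = 0 := by nlinarith [sq_nonneg (x 1), sq_nonneg (x 2), sq_nonneg (x 3)]
    funext i
    fin_cases i <;> simp [h0, h1, h2, h3]
  have c0 := hc 0
  have c2 := hc 2
  have c3 := hc 3
  simp [Fin.sum_univ_four, calUHat, minkowski] at c0 c2 c3
  -- The time component shows that the eigenvalue is real. The spatial block of 𝒰 is i times a real
  -- rotation generator, so comparing imaginary parts forces x₂ = x₃ = 0.
  have hcr : c = ((x 1 / x 0 : ℝ) : ℂ) := by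
    push_cast
    rw [eq_div_iff (by exact_mod_cast h00)]
    exact c0.symm
  rw [hcr] at c2 c3
  have e2 := congrArg Complex.im c2
  have e3 := congrArg Complex.im c3
  simp [Complex.mul_im] at e2 e3
  have h2 : x 2 = 0 := by simpa [← Complex.ofReal_div] using e3
  have h3 : x 3 = 0 := by simpa [← Complex.ofReal_div] using e2
  refine ⟨x 1 / x 0, ?_, ?_⟩
  · rw [h2, h3] at hn
    field_simp
    linarith
  · funext i
    fin_cases i
    · rfl
    · simp [h00]
    · exact h2
    · exact h3

end LocalFields

namespace LocalFields

variable {L : LocalFields} {s : Set Coord} {y : Coord} {B : Matrix (Fin 4) (Fin 4) ℝ} {p q : ℂ}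

theorem FrameAt.transpose_mulVec_gMat (hB : L.FrameAt y B) (x : Fin 4 → ℝ) (i : Fin 4) :
    ∑ α, B α i * ∑ β, L.g y α β * B.mulVec x β = minkowski i i * x i := by
  have h1 : ∑ α, B α i * ∑ β, L.g y α β * B.mulVec x β =
      (B.transpose * L.gMat y * B).mulVec x i := by
    rw [← Matrix.mulVec_mulVec, ← Matrix.mulVec_mulVec]
    rfl
  rw [h1, hB.transpose_mul_gMat_mul, minkowski_eq_diagonal, Matrix.mulVec_diagonal]
  fin_cases i <;> simp [minkowski]

theorem FrameAt.sum_g_mulVec (hB : L.FrameAt y B) (x : Fin 4 → ℝ) :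
    ∑ α, ∑ β, L.g y α β * B.mulVec x α * B.mulVec x β =
      -x 0 ^ 2 + x 1 ^ 2 + x 2 ^ 2 + x 3 ^ 2 := by
  have h1 : ∑ α, ∑ β, L.g y α β * B.mulVec x α * B.mulVec x β =
      ∑ i, x i * ∑ α, B α i * ∑ β, L.g y α β * B.mulVec x β := by
    rw [Finset.sum_congr rfl fun i _ => Finset.mul_sum Finset.univ
      (fun α => B α i * ∑ β, L.g y α β * B.mulVec x β) (x i)]
    refine Eq.trans (Finset.sum_congr rfl fun α _ => ?_) Finset.sum_comm
    have h2 : B.mulVec x α = ∑ i, B α i * x i := rfl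
    have h3 : ∑ β, L.g y α β * B.mulVec x α * B.mulVec x β =
        B.mulVec x α * ∑ β, L.g y α β * B.mulVec x β := by
      rw [Finset.mul_sum]
      refine Finset.sum_congr rfl fun _ _ => ?_
      ring
    rw [h3]
    generalize ∑ β, L.g y α β * B.mulVec x β = S
    rw [h2, Finset.sum_mul]
    refine Finset.sum_congr rfl fun _ _ => ?_
    ring
  rw [h1]
  simp only [hB.transpose_mulVec_gMat]
  simp [Fin.sum_univ_four, minkowski]
  ring

namespace SelfDualFrame

variable (h : L.SelfDualFrame y B p q)
include h

/-- A principal vector has frame components proportional to (1, ±1, 0, 0). The contraction of the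
Weyl tensor with two copies of it is k_β v_ε + v_β k_ε, where k is the lowered vector, and such a
tensor vanishes after antisymmetrising with k on both sides. -/
theorem isDebeverVector {l : Fin 4 → ℝ} (hl : L.IsPrincipalNullVector y (L.calU y) l) :
    L.IsDebeverVector y l := by
  obtain ⟨hl0, hn, c, hc⟩ := hl
  refine ⟨hl0, hn, ?_⟩
  have hB := h.frameAt
  obtain ⟨x, rfl⟩ : ∃ x, l = B.mulVec x :=
    ⟨B⁻¹.mulVec l, by rw [Matrix.mulVec_mulVec, hB.mul_inv, Matrix.one_mulVec]⟩
  rw [hB.sum_g_mulVec] at hn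
  have hx0 : x ≠ 0 := by
    rintro rfl
    exact hl0 (Matrix.mulVec_zero B)
  have hk0 : ((1 / √2 : ℝ) : ℂ) ≠ 0 := fun h0 => by
    have := inv_sqrt_two_mul_self
    rw [h0] at this
    norm_num at this
  have hu : pull B (L.calU y) = ((1 / √2 : ℝ) : ℂ) • calUHat :=
    hB.pull_calU.trans calU_minkowskiModel
  generalize ((1 / √2 : ℝ) : ℂ) = κ at hk0 hu
  have hc' : ∀ i, ∑ j, calUHat i j * (x j : ℂ) = (c / κ) * ((minkowski i i * x i : ℝ) : ℂ) := by
    intro i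
    have h1 : ∑ j, pull B (L.calU y) i j * (x j : ℂ) =
        ∑ α, (B α i : ℂ) * ∑ β, L.calU y α β * (B.mulVec x β : ℂ) := by
      have h2 : ∀ β, (B.mulVec x β : ℂ) = ∑ j, (B β j : ℂ) * (x j : ℂ) := fun β => by
        simp only [Matrix.mulVec, dotProduct]
        push_cast
        rfl
      simp only [pull_apply, h2, Finset.sum_mul, Finset.mul_sum]
      rw [Finset.sum_comm]
      refine Finset.sum_congr rfl fun _ _ => ?_
      rw [Finset.sum_comm]
      refine Finset.sum_congr rfl fun _ _ => Finset.sum_congr rfl fun _ _ => ?_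
      ring
    simp only [hc] at h1
    have h3 : ∑ α, (B α i : ℂ) * (c * ((∑ β, L.g y α β * B.mulVec x β : ℝ) : ℂ)) =
        c * ((minkowski i i * x i : ℝ) : ℂ) := by
      rw [← hB.transpose_mulVec_gMat]
      push_cast
      rw [Finset.mul_sum]
      refine Finset.sum_congr rfl fun _ _ => ?_
      ring
    rw [h3, hu] at h1
    simp only [Pi.smul_apply, smul_eq_mul, mul_assoc, ← Finset.mul_sum] at h1
    rw [div_mul_eq_mul_div, eq_div_iff hk0, ← h1, mul_comm]
  obtain ⟨ε, hε, hx⟩ := principal_null_model hx0 hn hc'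
  have hW := h.isWeylTensor
  have hreal := L.exists_real_pull4_weylC y B
  have h0203 := h.calW_0203
  have h0202 := h.calW_0202.trans h.calW_0303.symm
  obtain ⟨w, hw⟩ : ∃ w, w = pull4 B (L.weylC y) := ⟨_, rfl⟩
  rw [← hw] at hW hreal h0203 h0202
  have hS := selfDualHat_eq hW.toIsCurvatureTensor
  obtain ⟨n1, n2, n3, n4, n5⟩ := hW.toIsCurvatureTensor.normalize
  obtain ⟨t1, t2, t3, t4, t5, t6, t7, t8, t9, t10⟩ := hW.normalize
  -- Real and imaginary parts of 𝒲₀₂₀₃ = 0, the second rewritten by the trace conditions.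
  have e1 : w 0 2 0 3 = 0 ∧ w 0 2 1 2 = 0 := by
    have h1 := h0203
    rw [(hS 0 3).2.1] at h1
    obtain ⟨h2, h3⟩ := eq_zero_of_add_I_mul (hreal 0 2 0 3) (hreal 1 3 0 3)
      (by linear_combination 2 * h1)
    refine ⟨h2, ?_⟩
    rw [hW.pair, t5] at h3
    linear_combination -h3
  -- Real and imaginary parts of 𝒲₀₂₀₂ = 𝒲₀₃₀₃. The value of Ω itself plays no role.
  have e2 : w 0 1 0 1 + 2 * w 0 2 0 2 = 0 ∧ 2 * w 0 2 1 3 - w 0 1 2 3 = 0 := by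
    have h1 := h0202
    rw [(hS 0 2).2.1, (hS 0 3).2.2, t4, hW.pair 1 3, hW.pair 1 2] at h1
    have h2 : w 0 3 1 2 = w 0 2 1 3 - w 0 1 2 3 := n5.2.2.2.2.2.2.2.2.2.2.2.2.2.2.2
    rw [h2] at h1
    obtain ⟨x1, hx1⟩ := hreal 0 1 0 1
    obtain ⟨x2, hx2⟩ := hreal 0 2 0 2
    obtain ⟨x3, hx3⟩ := hreal 0 2 1 3
    obtain ⟨x4, hx4⟩ := hreal 0 1 2 3
    refine eq_zero_of_add_I_mul ⟨x1 + 2 * x2, by rw [hx1, hx2]; push_cast; ring⟩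
      ⟨2 * x3 - x4, by rw [hx3, hx4]; push_cast; ring⟩ ?_
    linear_combination 2 * h1
  have hεC : (ε : ℂ) * ε = 1 := by exact_mod_cast hε
  -- The covector kH is the null vector with its index lowered, and vH is read off from the
  -- components of the contracted Weyl tensor.
  let kH : Fin 4 → ℂ := ![-(x 0 : ℂ), ε * x 0, 0, 0]
  let vH : Fin 4 → ℂ := ![x 0 * w 0 1 0 1 / 2, -ε * x 0 * w 0 1 0 1 / 2,
    -x 0 * (ε * w 0 1 0 2 + w 0 1 1 2), -x 0 * (ε * w 0 1 0 3 + w 0 1 1 3)]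
  have hmodel := fun i j => weyl_contract_null hW e1.1 e1.2
    (by linear_combination e2.1) (by linear_combination -e2.2) hεC
    (x := fun i => (x i : ℂ)) (a := x 0) (k := kH) (v := vH)
    (by funext i; rw [hx]; fin_cases i <;> simp) rfl rfl i j
  have hk : pullv B (fun α => ((∑ β, L.g y α β * B.mulVec x β : ℝ) : ℂ)) = kH := by
    funext i
    have h1 : pullv B (fun α => ((∑ β, L.g y α β * B.mulVec x β : ℝ) : ℂ)) i =
        ((minkowski i i * x i : ℝ) : ℂ) := by
      rw [← hB.transpose_mulVec_gMat, pullv]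
      push_cast
      rfl
    rw [h1, hx]
    fin_cases i <;> simp [minkowski, kH]
  obtain ⟨v, hv⟩ : ∃ v, pullv B v = vH := by
    refine ⟨(toC B⁻¹).transpose.mulVec vH, ?_⟩
    change (toC B).transpose.mulVec _ = _
    rw [Matrix.mulVec_mulVec, ← Matrix.transpose_mul, hB.toC_inv_mul, Matrix.transpose_one,
      Matrix.one_mulVec]
  set k : Fin 4 → ℝ := fun α => ∑ β, L.g y α β * B.mulVec x β with hkdef
  have hm : (fun β ε => ∑ γ, ∑ δ, L.weylC y β γ δ ε *
      ((B.mulVec x γ : ℂ) * (B.mulVec x δ : ℂ)) : Tensor2) =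
      (fun β ε => (k β : ℂ) * v ε) + fun β ε => v β * (k ε : ℂ) := by
    apply hB.pull_injective
    funext i j
    rw [pull_weyl_contract, ← hw, map_add, Pi.add_apply, Pi.add_apply,
      pull_tensor (fun α => (k α : ℂ)) v, pull_tensor v (fun α => (k α : ℂ)), hk, hv]
    exact hmodel i j
  intro k' m α β ε' ν
  have hm' : ∀ β ε, (m β ε : ℂ) = (k β : ℂ) * v ε + v β * (k ε : ℂ) := fun β ε => by
    have h1 := congrFun (congrFun hm β) ε
    simp only [Pi.add_apply] at h1
    rw [← h1]
    simp only [m, weylC]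
    push_cast
    refine Finset.sum_congr rfl fun _ _ => Finset.sum_congr rfl fun _ _ => ?_
    ring
  have hC : ((k' α * m β ε' * k' ν - k' β * m α ε' * k' ν - k' α * m β ν * k' ε' +
      k' β * m α ν * k' ε' : ℝ) : ℂ) = 0 := by
    push_cast
    rw [hm', hm', hm', hm']
    change (k α : ℂ) * _ * (k ν : ℂ) - _ * _ * (k ν : ℂ) - _ * _ * (k ε' : ℂ) +
      (k β : ℂ) * _ * _ = 0
    ring
  exact_mod_cast hC

theorem isUnitaryDebever : L.IsUnitaryDebever y (L.calU y) := by
  refine ⟨?_, ?_, fun l hl => h.isDebeverVector hl⟩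
  · have h1 : calUHat = sdHat ![-1, 0, 0] := by
      funext i j
      fin_cases i <;> fin_cases j <;> simp [calUHat, sdHat_apply]
    rw [h.frameAt.mem_sdBivectors_iff, h.frameAt.pull_calU, calU_minkowskiModel, h1, ← map_smul]
    simp only [sdHat_succ]
  · have hk := inv_sqrt_two_mul_self
    have hI := Complex.I_mul_I
    rw [h.frameAt.pairing, h.frameAt.pull_calU, calU_minkowskiModel, pairing_minkowskiModel]
    generalize ((1 / √2 : ℝ) : ℂ) = κ at hk
    simp [Fin.sum_univ_four, minkowski, calUHat]
    grind

end SelfDualFrame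

end LocalFields

theorem TwoPlusTwo.regularOn_inChart {M : Type*} [TopologicalSpace M] [ChartedSpace Coord M]
    [IsManifold (𝓡 4) ∞ M] {S : OrientedSpaceTime M} (P : TwoPlusTwo S)
    {e : OpenPartialHomeomorph M Coord} (he : e ∈ IsManifold.maximalAtlas (𝓡 4) ∞ M) :
    (P.inChart e).RegularOn e.target where
  isOpen := e.open_target
  smooth_g := S.smooth_metric e he
  smooth_vol := S.smooth_vol e he
  smooth_U := P.smooth_U e he
  exists_coframeAt _ hy := P.exists_coframeAt he hy

theorem mainTheorem4 {M : Type*} [TopologicalSpace M] [ChartedSpace Coord M]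
    [IsManifold (𝓡 4) ∞ M] (S : OrientedSpaceTime M) (P : TwoPlusTwo S)
    (hP : P.IsUmbilical) (e : OpenPartialHomeomorph M Coord)
    (he : e ∈ IsManifold.maximalAtlas (𝓡 4) ∞ M) (x : M) (hx : x ∈ e.source)
    (L : LocalFields) (hL : L = P.inChart e) (y : Coord) (hy : y = e x)
    (ZZ : ℂ) (hZZ : ZZ = L.pairing y (L.calZ y) (L.calZ y)) :
    L.IsUnitaryDebever y (L.calU y) ∧
    ¬ L.HasType y .N ∧
    (L.HasType y .O ↔ L.Omega y = 0 ∧ L.calZ y = 0) ∧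
    (L.HasType y .III ↔ L.Omega y = 0 ∧ L.calZ y ≠ 0 ∧ ZZ = 0) ∧
    (L.HasType y .D ↔ L.Omega y ≠ 0 ∧ L.calZ y = 0) ∧
    (L.HasType y .II ↔
      L.Omega y ≠ 0 ∧ L.calZ y ≠ 0 ∧ ZZ * (9 * L.Omega y ^ 2 - 4 * ZZ) = 0) ∧
    (L.HasType y .I ↔ ZZ * (9 * L.Omega y ^ 2 - 4 * ZZ) ≠ 0) := by
  subst hL hy
  obtain ⟨B, p, q, h⟩ := (P.regularOn_inChart he).exists_selfDualFrame (e.map_source hx) (hP e he)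
  exact ⟨h.isUnitaryDebever, h.classification hZZ⟩

end
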